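/- Let $s>1$, let $\Omega\subset\mathbb C^n$ be open, and let $\Phi\in\mathcal G^s(\Omega;\mathbb R)$ be strictly plurisubharmonic: $\sum_{j,k}\partial_{x_j}\partial_{\bar x_k}\Phi(x)\,\xi_j\bar\xi_k\ge c(x)|\xi|^2$ for $x\in\Omega$, $\xi\in\mathbb C^n$, with $c>0$ continuous. Here $\mathcal G^s(\Omega)$ is the set of smooth functions $u$ with $|\partial^\alpha u|\le A_KC_K^{|\alpha|}\alpha!^s$ on each compact $K\subset\Omega$ for all $\alpha$, and $\mathcal G^s_{\rm b}$ is the class in which one pair of constants works on the whole set. Let $U\Subset\Omega$ be an open neighbourhood of $x_0$, let $\rho>0$, and put $\widetilde U=\{(x+z,\bar x-\bar z): x\in U,\ z\in\mathbb C^n,\ |z|<\rho\}\subset\mathbb C^{2n}$. Let $\Psi\in\mathcal G^s_{\rm b}(\widetilde U)$ satisfy $\Psi(x,\bar x)=\Phi(x)$ for $x\in U$ and, for some $C>0$, $$|\partial_{\bar x,\bar y}\Psi(x,y)|\le C\exp\bigl(-C^{-1}|x-\bar y|^{-\frac1{s-1}}\bigr),\quad (x,y)\in\widetilde U,$$ and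 put $\phi(y,\tilde x;x,\tilde y)=\Psi(x,\tilde y)-\Psi(x,\tilde x)-\Psi(y,\tilde y)+\Psi(y,\tilde x)$. An amplitude is a family $a(\cdot;h)\in C^\infty(\widetilde U)$, $0<h\le h_0$, for which there are $a_j\in C^\infty(\widetilde U)$ and $C>0$ such that, for all $0<h\le h_0$, $\alpha\in\mathbb N^{4n}$, $N\in\mathbb N$, $$\Bigl\|\partial^\alpha\Bigl(a-\sum_{j<N}a_jh^j\Bigr)\Bigr\|_{L^\infty(\widetilde U)}\le C^{1+|\alpha|+N}\alpha!^sN!^{2s-1}h^N,\qquad |\partial_{\bar x,\bar y}a(x,y;h)|\le C\exp\bigl(-C^{-1}|x-\bar y|^{-\frac1{s-1}}\bigr)\ \text{ on }\widetilde U .$$ A good contour over a set $V\subset\mathbb C^n$ with constant $K>0$ is a family $\Gamma(y,\bar y)=\gamma(y,D)$, $y\in\overline V$, where $D$ is a compact neighbourhood of $0$ in $\mathbb R^{2n}$, $\gamma$ is a smooth map from a neighbourhood of $\overline V\times D$ to $\mathbb C^n\times\mathbb C^n$, and for every $y\in\overline V$: $\gamma(y,\cdot)$ is an injective immersion on $D$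 with $\gamma(y,0)=(y,\bar y)$; the points $(x,\tilde y)$, $(x,\bar y)$, $(y,\tilde y)$, $(y,\bar y)$ lie in $\widetilde U$ for all $(x,\tilde y)\in\Gamma(y,\bar y)$; $$\operatorname{Re}\phi(y,\bar y;x,\tilde y)\le-K^{-1}\operatorname{dist}\bigl((x,\tilde y),(y,\bar y)\bigr)^2,\quad (x,\tilde y)\in\Gamma(y,\bar y);$$ and the orientation is that of the affine contour $z\mapsto(y+z,\bar y-\bar z)$, i.e. the map $t\mapsto x-\overline{\tilde y}$, $(x,\tilde y)=\gamma(y,t)$, from $\mathbb R^{2n}$ to $\mathbb C^n\cong\mathbb R^{2n}$, $z\mapsto(\operatorname{Re}z,\operatorname{Im}z)$, has positive Jacobian determinant at $t=0$. Put $$(A_\Gamma a)(y,\bar y;h)=\frac1{(2ih)^n}\int_{\Gamma(y,\bar y)}e^{\frac2h\phi(y,\bar y;x,\tilde y)}a(x,\tilde y;h)\,dx\,d\tilde y .$$ Then there is an open neighbourhood $V_0$ of $x_0$ with $\overline{V_0}$ compact and contained in $U$ such that for every amplitude $a$ and every $K>0$ there is $C>0$, depending only on $a$, $\phi$, $s$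 (and $V_0$) and $K$, with the following property. For every $V\subset V_0$ (in particular $V=V_0$) and any two good contours $\Gamma_0,\Gamma_1$ over $V$ with constant $K$, we have, uniformly for $y\in V$ and $0<h\le h_0$, $$(A_{\Gamma_0}a)(y,\bar y;h)-(A_{\Gamma_1}a)(y,\bar y;h)=\mathcal O(1)\exp\bigl(-C^{-1}h^{-\frac1{2s-1}}\bigr),$$ where the constant in $\mathcal O(1)$ may depend on the contours. -/

import Mathlib

open scoped ContDiff

noncomputable section

namespace GevreyBergman

/-- `ℂⁿ` with the Euclidean norm. -/
abbrev Cn (n : ℕ) : Type := EuclideanSpace ℂ (Fin n)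

/-- `ℝ²ⁿ`; the index `inl j` stands for `Re z_j`, the index `inr j` for `Im z_j`. -/
abbrev R2n (n : ℕ) : Type := EuclideanSpace ℝ (Fin n ⊕ Fin n)

/-- Componentwise complex conjugation on `ℂⁿ`. -/
def conjVec {n : ℕ} (x : Cn n) : Cn n := WithLp.toLp 2 (fun j => (starRingEnd ℂ) (x j))

/-- The real coordinate directions of `ℂⁿ`: `∂/∂Re x_j` and `∂/∂Im x_j`. -/
def reIm (n : ℕ) : Fin n ⊕ Fin n → Cn n :=
  Sum.elim (fun j => EuclideanSpace.single j (1 : ℂ)) (fun j => EuclideanSpace.single j Complex.I)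

/-- The real coordinate directions of `ℂⁿ × ℂⁿ`. -/
def reIm₂ (n : ℕ) : (Fin n ⊕ Fin n) ⊕ (Fin n ⊕ Fin n) → Cn n × Cn n :=
  Sum.elim (fun k => (reIm n k, 0)) (fun k => (0, reIm n k))

section Gevrey

variable {ι E F : Type*} [Fintype ι] [DecidableEq ι] [NormedAddCommGroup E] [NormedSpace ℝ E]
  [NormedAddCommGroup F] [NormedSpace ℝ F]

/-- `|∂^α u(x)| ≤ B C^|α| (α!)^s` for all `x ∈ U` and all multi-indices `α`, the partial derivatives
being taken in the coordinate directions `b`. A multi-index of length `m` is given by a word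
`v : Fin m → ι` in the coordinates; `α_i` is the number of occurrences of `i` in `v`. -/
def GevreyBound (b : ι → E) (s B C : ℝ) (u : E → F) (U : Set E) : Prop :=
  ∀ x ∈ U, ∀ (m : ℕ) (v : Fin m → ι),
    ‖iteratedFDeriv ℝ m u x (fun k => b (v k))‖ ≤
      B * C ^ m * ∏ i : ι, ((Nat.factorial (Finset.univ.filter (fun k => v k = i)).card : ℝ)) ^ s

/-- The local Gevrey class `𝒢^s(U)`. -/
def IsGevrey (b : ι → E) (s : ℝ) (u : E → F) (U : Set E) : Prop :=
  ContDiffOn ℝ ∞ u U ∧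
    ∀ Q : Set E, IsCompact Q → Q ⊆ U → ∃ B > 0, ∃ C > 0, GevreyBound b s B C u Q

/-- The global Gevrey class `𝒢_b^s(U)`. -/
def IsGevreyB (b : ι → E) (s : ℝ) (u : E → F) (U : Set E) : Prop :=
  ContDiffOn ℝ ∞ u U ∧ ∃ B > 0, ∃ C > 0, GevreyBound b s B C u U

end Gevrey

section Wirtinger

variable {E : Type*} [NormedAddCommGroup E] [NormedSpace ℝ E]

/-- `½ (∂_v - i ∂_w) f`; here `v`, `w` are the directions `∂/∂Re ζ`, `∂/∂Im ζ` of a complex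
coordinate `ζ`, and this is `∂f/∂ζ`. -/
def del (v w : E) (f : E → ℂ) (p : E) : ℂ :=
  (fderiv ℝ f p v - Complex.I * fderiv ℝ f p w) / 2

/-- `½ (∂_v + i ∂_w) f`, that is `∂f/∂ζ̄`. -/
def dbar (v w : E) (f : E → ℂ) (p : E) : ℂ :=
  (fderiv ℝ f p v + Complex.I * fderiv ℝ f p w) / 2

end Wirtinger

/-- The Levi form `∑ ∂²Φ/∂x_j∂x̄_k ξ_j ξ̄_k` at `x`. -/
def leviForm {n : ℕ} (Φ : Cn n → ℝ) (x ξ : Cn n) : ℂ :=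
  ∑ j : Fin n, ∑ k : Fin n,
    del (reIm n (Sum.inl j)) (reIm n (Sum.inr j))
        (dbar (reIm n (Sum.inl k)) (reIm n (Sum.inr k)) (fun t => (Φ t : ℂ))) x
      * ξ j * (starRingEnd ℂ) (ξ k)

/-- Strict plurisubharmonicity of a smooth function. -/
def StrictlyPSH {n : ℕ} (Φ : Cn n → ℝ) (Ω : Set (Cn n)) : Prop :=
  ∃ c : Cn n → ℝ, ContinuousOn c Ω ∧ (∀ x ∈ Ω, 0 < c x) ∧
    ∀ x ∈ Ω, ∀ ξ : Cn n, c x * ‖ξ‖ ^ 2 ≤ (leviForm Φ x ξ).re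

/-- `{(x + z, x̄ - z̄) : x ∈ U, |z| < ρ}`, a neighbourhood of the anti-diagonal over `U`. -/
def tube {n : ℕ} (U : Set (Cn n)) (ρ : ℝ) : Set (Cn n × Cn n) :=
  {p | ∃ x ∈ U, ∃ z : Cn n, ‖z‖ < ρ ∧ p = (x + z, conjVec x - conjVec z)}

/-- `C exp(-C⁻¹ t^{-1/(s-1)})`, with the value `0` at `t = 0`. -/
def flatWeight (s C t : ℝ) : ℝ :=
  if t = 0 then 0 else C * Real.exp (-(C⁻¹ * t ^ (-(1 / (s - 1)))))

/-- Every `∂f/∂x̄_j` and every `∂f/∂ȳ_j` is bounded by `C exp(-C⁻¹ |x - ȳ|^{-1/(s-1)})` on `T`. -/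
def DbarFlat {n : ℕ} (s C : ℝ) (f : Cn n × Cn n → ℂ) (T : Set (Cn n × Cn n)) : Prop :=
  ∀ p ∈ T, ∀ j : Fin n,
    ‖dbar (reIm n (Sum.inl j), (0 : Cn n)) (reIm n (Sum.inr j), 0) f p‖
        ≤ flatWeight s C ‖p.1 - conjVec p.2‖ ∧
    ‖dbar ((0 : Cn n), reIm n (Sum.inl j)) (0, reIm n (Sum.inr j)) f p‖
        ≤ flatWeight s C ‖p.1 - conjVec p.2‖

/-- `Ψ ∈ 𝒢_b^s(T)` with `T = tube U ρ` is a polarization of `Φ`, almost holomorphic along the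
anti-diagonal. -/
structure IsPolarization {n : ℕ} (s : ℝ) (Φ : Cn n → ℝ) (U : Set (Cn n)) (ρ : ℝ)
    (Ψ : Cn n × Cn n → ℂ) : Prop where
  gevrey : IsGevreyB (reIm₂ n) s Ψ (tube U ρ)
  diag : ∀ x ∈ U, Ψ (x, conjVec x) = (Φ x : ℂ)
  flat : ∃ C > 0, DbarFlat s C Ψ (tube U ρ)

/-- A Gevrey amplitude `a(x, ỹ; h)`, `0 < h ≤ h₀`, on `T`: it has an asymptotic expansion
`∑ a_j h^j` with remainders
`|∂^α (a - ∑_{j<N} a_j h^j)| ≤ C^{1+|α|+N} (α!)^s (N!)^{2s-1} h^N`, and a flat `∂̄`, uniformly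
in `h`. -/
structure IsGevreyAmplitude {n : ℕ} (s h₀ : ℝ) (T : Set (Cn n × Cn n))
    (a : ℝ → Cn n × Cn n → ℂ) : Prop where
  smooth : ∀ h, 0 < h → h ≤ h₀ → ContDiffOn ℝ ∞ (a h) T
  expansion : ∃ aj : ℕ → Cn n × Cn n → ℂ, (∀ j, ContDiffOn ℝ ∞ (aj j) T) ∧
    ∃ C > 0, ∀ h, 0 < h → h ≤ h₀ → ∀ N : ℕ,
      GevreyBound (reIm₂ n) s
        (C ^ (1 + N) * ((Nat.factorial N : ℝ)) ^ (2 * s - 1) * h ^ N) C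
        (fun p => a h p - ∑ j ∈ Finset.range N, aj j p * (h : ℂ) ^ j) T
  flat : ∃ C > 0, ∀ h, 0 < h → h ≤ h₀ → DbarFlat s C (a h) T

/-- `φ(y, x̃; x, ỹ) = Ψ(x, ỹ) - Ψ(x, x̃) - Ψ(y, ỹ) + Ψ(y, x̃)`; the first argument is `(y, x̃)`, the
second `(x, ỹ)`. -/
def phase {n : ℕ} (Ψ : Cn n × Cn n → ℂ) (q p : Cn n × Cn n) : ℂ :=
  Ψ (p.1, p.2) - Ψ (p.1, q.2) - Ψ (q.1, p.2) + Ψ (q.1, q.2)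

/-- A family of parametrized `2n`-dimensional contours in `ℂⁿ × ℂⁿ`, indexed by `y ∈ ℂⁿ`:
`Γ(y) = {map y t : t ∈ dom}`. -/
structure Contour (n : ℕ) where
  dom : Set (R2n n)
  map : Cn n → R2n n → Cn n × Cn n

/-- The derivative of the parametrization of `Γ(y)` at `t` in the `k`-th coordinate direction. -/
def Contour.partial {n : ℕ} (Γ : Contour n) (y : Cn n) (t : R2n n) (k : Fin n ⊕ Fin n) :
    Cn n × Cn n :=
  fderiv ℝ (Γ.map y) t (EuclideanSpace.single k (1 : ℝ))

/-- The complex Jacobian determinant of the parametrization: the pull-back of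
`dx_1 ∧ … ∧ dx_n ∧ dỹ_1 ∧ … ∧ dỹ_n` is this function times
`dt_{inl 1} ∧ … ∧ dt_{inl n} ∧ dt_{inr 1} ∧ … ∧ dt_{inr n}`. -/
def Contour.jac {n : ℕ} (Γ : Contour n) (y : Cn n) (t : R2n n) : ℂ :=
  (Matrix.of fun i k : Fin n ⊕ Fin n =>
    Sum.elim (fun j => (Γ.partial y t k).1 j) (fun j => (Γ.partial y t k).2 j) i).det

/-- The real Jacobian matrix at `t = 0` of `t ↦ x - conj ỹ`, `(x, ỹ) = Γ.map y t`. -/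
def Contour.orientMatrix {n : ℕ} (Γ : Contour n) (y : Cn n) :
    Matrix (Fin n ⊕ Fin n) (Fin n ⊕ Fin n) ℝ :=
  Matrix.of fun i k =>
    Sum.elim
      (fun j => ((Γ.partial y 0 k).1 j - (starRingEnd ℂ) ((Γ.partial y 0 k).2 j)).re)
      (fun j => ((Γ.partial y 0 k).1 j - (starRingEnd ℂ) ((Γ.partial y 0 k).2 j)).im) i

/-- `Γ(y) = Γ(y, ȳ)`, `y ∈ L`, is a family of good contours, with constant `K`, for the phases
`(x, ỹ) ↦ φ(y, ȳ; x, ỹ)`, where `φ` comes from a function `Ψ` on `T`.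

A contour carries an orientation, here the one of its parametrization; `oriented` normalizes it to
be that of the affine contour `z ↦ (y + z, ȳ - z̄)`, for which `x - conj ỹ = 2z`. -/
structure IsGoodContour {n : ℕ} (T : Set (Cn n × Cn n)) (Ψ : Cn n × Cn n → ℂ) (K : ℝ)
    (L : Set (Cn n)) (Γ : Contour n) : Prop where
  compact_dom : IsCompact Γ.dom
  dom_nhds : Γ.dom ∈ nhds (0 : R2n n)
  smooth : ∃ O : Set (Cn n × R2n n), IsOpen O ∧ L ×ˢ Γ.dom ⊆ O ∧
    ContDiffOn ℝ ∞ (fun p : Cn n × R2n n => Γ.map p.1 p.2) O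
  injective : ∀ y ∈ L, Set.InjOn (Γ.map y) Γ.dom
  immersion : ∀ y ∈ L, ∀ t ∈ Γ.dom, Function.Injective (fderiv ℝ (Γ.map y) t)
  center : ∀ y ∈ L, Γ.map y 0 = (y, conjVec y)
  oriented : ∀ y ∈ L, 0 < (Γ.orientMatrix y).det
  /-- The contour stays where the phase and the amplitude are defined. -/
  mem_domain : ∀ y ∈ L, ∀ t ∈ Γ.dom, Γ.map y t ∈ T ∧ ((Γ.map y t).1, conjVec y) ∈ T ∧
    (y, (Γ.map y t).2) ∈ T ∧ (y, conjVec y) ∈ T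
  good : ∀ y ∈ L, ∀ t ∈ Γ.dom,
    (phase Ψ (y, conjVec y) (Γ.map y t)).re ≤
      -(K⁻¹ * (‖(Γ.map y t).1 - y‖ ^ 2 + ‖(Γ.map y t).2 - conjVec y‖ ^ 2))

/-- `(A_Γ a)(y, ȳ; h) = (2ih)^{-n} ∫_{Γ(y)} e^{2φ(y, ȳ; x, ỹ)/h} a(x, ỹ; h) dx dỹ`. -/
def contourOp {n : ℕ} (Ψ : Cn n × Cn n → ℂ) (Γ : Contour n) (a : ℝ → Cn n × Cn n → ℂ)
    (y : Cn n) (h : ℝ) : ℂ :=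
  (1 / (2 * Complex.I * (h : ℂ)) ^ n) *
    ∫ t in Γ.dom,
      Complex.exp (2 / (h : ℂ) * phase Ψ (y, conjVec y) (Γ.map y t)) * a h (Γ.map y t) * Γ.jac y t

end GevreyBergman

end

/-!
Write `γ_σ`, `0 ≤ σ ≤ 1`, for the real linear contraction of `ℂⁿ × ℂⁿ` onto the affine contour
`z ↦ (z, -z̄)` that shrinks the transversal component by `σ`. Both operators are compared with the
one over a fixed piece of the affine contour through `(y, ȳ)`, by contracting a good contour with
`γ_σ`.

Two facts make the error exponentially small. First, the Hessian `H` of the phase at `(y, ȳ)` is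
that of a polarization, so that at the point with affine component `z` and transversal component
`w` one has `Re H = Levi(w) - Levi(z)`, which turns into `σ² Levi(w) - Levi(z)` under `γ_σ`. As the
Levi form is nonnegative the phase does not increase along the contraction to leading order, and it
remains at most `-(2K)⁻¹ |p - (y, ȳ)|²`. Second, `d(F dx ∧ dỹ) = ∂̄F ∧ dx ∧ dỹ`, so Stokes' theorem
leaves, besides terms away from the centre, only an integral of `∂̄` of the integrand. There the
Gaussian `exp(-c d²/h)` meets the flat weight `exp(-c d^{-1/(s-1)})`, and their product is at most
`exp(-c' h^{-1/(2s-1)})` whatever the distance `d`.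
-/

noncomputable section

namespace GevreyBergman

set_option maxSynthPendingDepth 3

/-- The Gevrey remainder `exp (-c h^{-1/(2s-1)})`, in terms of which all errors are measured. -/
def gevreyDecay (s c h : ℝ) : ℝ :=
  Real.exp (-(c * h ^ (-(1 / (2 * s - 1)))))

section RealEstimates

variable {s c d h : ℝ}

theorem gevreyDecay_pos : 0 < gevreyDecay s c h :=
  Real.exp_pos _

theorem rpow_neg_le_sq_div (hs : 1 < s) (hh : 0 < h) (hd : h ^ ((s - 1) / (2 * s - 1)) ≤ d) :
    h ^ (-(1 / (2 * s - 1))) ≤ d ^ 2 / h := by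
  have hexp : -(1 / (2 * s - 1)) + 1 = (s - 1) / (2 * s - 1) * 2 := by
    have : 2 * s - 1 ≠ 0 := by linarith
    field_simp
    ring
  rw [le_div_iff₀ hh]
  calc h ^ (-(1 / (2 * s - 1))) * h = (h ^ ((s - 1) / (2 * s - 1))) ^ 2 := by
        rw [← Real.rpow_add_one hh.ne', hexp, Real.rpow_mul hh.le, Real.rpow_two]
    _ ≤ d ^ 2 := by gcongr

theorem rpow_neg_le_rpow_neg (hs : 1 < s) (hh : 0 < h) (hd₀ : 0 < d)
    (hd : d ≤ h ^ ((s - 1) / (2 * s - 1))) :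
    h ^ (-(1 / (2 * s - 1))) ≤ d ^ (-(1 / (s - 1))) := by
  have hs' : 0 < s - 1 := by linarith
  calc h ^ (-(1 / (2 * s - 1))) = (h ^ ((s - 1) / (2 * s - 1))) ^ (-(1 / (s - 1))) := by
        rw [← Real.rpow_mul hh.le]
        field_simp
    _ ≤ d ^ (-(1 / (s - 1))) :=
        Real.rpow_le_rpow_of_nonpos hd₀ hd (neg_nonpos.2 (by positivity))

/-- The exponent `1 / (2s - 1)` of the remainder comes from here: the Gaussian `exp (-A d² / h)`
and the flat weight `exp (-B d^{-1/(s-1)})` balance at distance `d = h^{(s-1)/(2s-1)}`. -/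
theorem min_mul_rpow_neg_le_gaussian_add_flat {A B : ℝ} (hs : 1 < s) (hA : 0 ≤ A) (hB : 0 ≤ B)
    (hd : 0 < d) (hh : 0 < h) :
    min A B * h ^ (-(1 / (2 * s - 1))) ≤ A * (d ^ 2 / h) + B * d ^ (-(1 / (s - 1))) := by
  rcases le_total (h ^ ((s - 1) / (2 * s - 1))) d with hhd | hdh
  · calc min A B * h ^ (-(1 / (2 * s - 1))) ≤ A * (d ^ 2 / h) :=
          mul_le_mul (min_le_left _ _) (rpow_neg_le_sq_div hs hh hhd) (by positivity) hA
      _ ≤ _ := le_add_of_nonneg_right (by positivity)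
  · calc min A B * h ^ (-(1 / (2 * s - 1))) ≤ B * d ^ (-(1 / (s - 1))) :=
          mul_le_mul (min_le_right _ _) (rpow_neg_le_rpow_neg hs hh hd hdh) (by positivity) hB
      _ ≤ _ := le_add_of_nonneg_left (by positivity)

theorem exists_rpow_le_mul_add {β ε : ℝ} (hβ : 0 ≤ β) (hβ₁ : β < 1) (hε : 0 < ε) :
    ∃ R, ∀ u : ℝ, 0 < u → u ^ β ≤ ε * u + R := by
  obtain ⟨u₀, hu₀⟩ := Filter.eventually_atTop.1
    ((tendsto_rpow_neg_atTop (sub_pos.2 hβ₁)).eventually_le_const hε)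
  refine ⟨|u₀| ^ β, fun u hu => ?_⟩
  rcases le_total u₀ u with hle | hle
  · calc u ^ β = u ^ (-(1 - β)) * u := by
          rw [← Real.rpow_add_one hu.ne', neg_sub, sub_add_cancel]
      _ ≤ ε * u := mul_le_mul_of_nonneg_right (hu₀ u hle) hu.le
      _ ≤ ε * u + |u₀| ^ β := le_add_of_nonneg_right (by positivity)
  · exact (Real.rpow_le_rpow hu.le (hle.trans (le_abs_self u₀)) hβ).trans
      (le_add_of_nonneg_left (by positivity))

theorem exists_exp_neg_div_le_gevreyDecay {c' : ℝ} (hs : 1 < s) (hc : 0 < c) (hc' : 0 < c') :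
    ∃ M, 0 < M ∧ ∀ h : ℝ, 0 < h → Real.exp (-(c' / h)) ≤ M * gevreyDecay s c h := by
  have hβ : 1 / (2 * s - 1) < 1 := by
    rw [div_lt_one (by linarith)]
    linarith
  obtain ⟨R, hR⟩ := exists_rpow_le_mul_add (one_div_nonneg.2 (by linarith)) hβ (div_pos hc' hc)
  refine ⟨Real.exp (c * R), Real.exp_pos _, fun h hh => ?_⟩
  rw [gevreyDecay, ← Real.exp_add, Real.exp_le_exp]
  have hscaled : c * h ^ (-(1 / (2 * s - 1))) ≤ c * (c' / c * h⁻¹ + R) := by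
    rw [Real.rpow_neg hh.le, ← Real.inv_rpow hh.le]
    exact mul_le_mul_of_nonneg_left (hR h⁻¹ (inv_pos.2 hh)) hc.le
  have hexpand : c * (c' / c * h⁻¹ + R) = c' / h + c * R := by field_simp
  linarith

theorem rpow_le_mul_exp {p x : ℝ} (hc : 0 < c) (hp : 0 ≤ p) (hx : 0 ≤ x) :
    x ^ p ≤ ((p + 1) / c) ^ p * Real.exp (c * x) := by
  have hlin : c / (p + 1) * x ≤ Real.exp (c / (p + 1) * x) := by
    linarith [Real.add_one_le_exp (c / (p + 1) * x)]
  calc x ^ p = ((p + 1) / c) ^ p * (c / (p + 1) * x) ^ p := by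
        rw [← Real.mul_rpow (by positivity) (by positivity)]
        field_simp
    _ ≤ ((p + 1) / c) ^ p * Real.exp (c / (p + 1) * x) ^ p := by gcongr
    _ ≤ ((p + 1) / c) ^ p * Real.exp (c * x) := by
        rw [← Real.exp_mul]
        refine mul_le_mul_of_nonneg_left (Real.exp_le_exp.2 ?_) (by positivity)
        rw [div_mul_eq_mul_div, div_mul_eq_mul_div, div_le_iff₀ (by positivity)]
        nlinarith [mul_nonneg hc.le hx]

theorem exists_inv_pow_mul_gevreyDecay_le (hs : 1 < s) (hc : 0 < c) (k : ℕ) :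
    ∃ M, 0 < M ∧ ∀ h : ℝ, 0 < h →
      h⁻¹ ^ k * gevreyDecay s (2 * c) h ≤ M * gevreyDecay s c h := by
  have hs' : 0 < 2 * s - 1 := by linarith
  set p : ℝ := (2 * s - 1) * k
  have hp : 0 ≤ p := by positivity
  refine ⟨((p + 1) / c) ^ p, by positivity, fun h hh => ?_⟩
  set x := h ^ (-(1 / (2 * s - 1))) with hx
  have hpow : h⁻¹ ^ k = x ^ p := by
    rw [hx, ← Real.rpow_mul hh.le, ← Real.rpow_neg_one, ← Real.rpow_mul_natCast hh.le]
    congr 1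
    simp only [p]
    field_simp
  calc h⁻¹ ^ k * gevreyDecay s (2 * c) h
      ≤ ((p + 1) / c) ^ p * Real.exp (c * x) * gevreyDecay s (2 * c) h := by
        rw [hpow]
        exact mul_le_mul_of_nonneg_right (rpow_le_mul_exp hc hp (by positivity))
          gevreyDecay_pos.le
    _ = ((p + 1) / c) ^ p * gevreyDecay s c h := by
        rw [gevreyDecay, gevreyDecay, mul_assoc, ← Real.exp_add]
        congr 2
        ring

end RealEstimates

section AntilinearPart

variable {E : Type*} [NormedAddCommGroup E] [NormedSpace ℝ E] [NormedSpace ℂ E]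
  [IsScalarTower ℝ ℂ E]

/-- The antilinear part `v ↦ ½ (L v + i L (i v))` of a real-linear functional `L`. For the
differential of a function this is its `∂̄`-part. -/
def antiPart : (E →L[ℝ] ℂ) →ₗ[ℂ] (E →L[ℝ] ℂ) where
  toFun L := (2⁻¹ : ℂ) •
    (L + Complex.I • L.comp ((Complex.I • ContinuousLinearMap.id ℂ E).restrictScalars ℝ))
  map_add' L M := by
    ext v
    simp only [ContinuousLinearMap.restrictScalars_smul, ContinuousLinearMap.add_comp, smul_add,
      add_apply, smul_apply, smul_eq_mul, ContinuousLinearMap.comp_apply,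
      ContinuousLinearMap.coe_restrictScalars', ContinuousLinearMap.id_apply]
    ring
  map_smul' z L := by
    ext v
    simp only [ContinuousLinearMap.restrictScalars_smul, ContinuousLinearMap.smul_comp, smul_add,
      add_apply, smul_apply, smul_eq_mul, ContinuousLinearMap.comp_apply,
      ContinuousLinearMap.coe_restrictScalars', ContinuousLinearMap.id_apply, RingHom.id_apply]
    ring

theorem antiPart_apply (L : E →L[ℝ] ℂ) (v : E) :
    antiPart L v = (L v + Complex.I * L (Complex.I • v)) / 2 := by
  change 2⁻¹ * (L v + Complex.I * L (Complex.I • v)) = _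
  ring

theorem map_I_smul_sub_antiPart (L : E →L[ℝ] ℂ) (v : E) :
    (L - antiPart L) (Complex.I • v) = Complex.I * (L - antiPart L) v := by
  simp only [sub_apply, antiPart_apply, smul_smul, Complex.I_mul_I, neg_smul,
    one_smul, map_neg]
  linear_combination (1 / 2 * L (Complex.I • v)) * Complex.I_sq

theorem complex_smul_eq_re_smul_add_im_smul (z : ℂ) (v : E) :
    z • v = z.re • v + z.im • Complex.I • v := by
  conv_lhs => rw [← Complex.re_add_im z]
  simp only [add_smul, mul_smul, ← Complex.coe_algebraMap, algebraMap_smul]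

theorem exists_restrictScalars_add_antiPart (L : E →L[ℝ] ℂ) :
    ∃ M : E →L[ℂ] ℂ, L = M.restrictScalars ℝ + antiPart L := by
  refine ⟨⟨⟨(L - antiPart L).toLinearMap.toAddHom, fun z v => ?_⟩, (L - antiPart L).cont⟩, ?_⟩
  · change (L - antiPart L) (z • v) = z * (L - antiPart L) v
    rw [complex_smul_eq_re_smul_add_im_smul, map_add, map_smul, map_smul,
      map_I_smul_sub_antiPart]
    conv_rhs => rw [← Complex.re_add_im z]
    simp only [Complex.real_smul]
    ring
  · ext v
    exact (sub_add_cancel (L v) (antiPart L v)).symm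

theorem antiPart_I_smul (L : E →L[ℝ] ℂ) (v : E) :
    antiPart L (Complex.I • v) = -(Complex.I * antiPart L v) := by
  simp only [antiPart_apply, smul_smul, Complex.I_mul_I, neg_smul, one_smul, map_neg]
  linear_combination (1 / 2 * L (Complex.I • v)) * Complex.I_sq

theorem antiPart_smul (L : E →L[ℝ] ℂ) (z : ℂ) (v : E) :
    antiPart L (z • v) = (starRingEnd ℂ) z * antiPart L v := by
  rw [complex_smul_eq_re_smul_add_im_smul, map_add, map_smul, map_smul, antiPart_I_smul]
  conv_rhs => rw [← Complex.re_add_im z]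
  simp only [Complex.real_smul, map_add, map_mul, Complex.conj_ofReal, Complex.conj_I]
  ring

theorem antiPart_comp_restrictScalars {E' : Type*} [NormedAddCommGroup E'] [NormedSpace ℝ E']
    [NormedSpace ℂ E'] [IsScalarTower ℝ ℂ E'] (L : E →L[ℝ] ℂ) (P : E' →L[ℂ] E) :
    antiPart (L.comp (P.restrictScalars ℝ)) = (antiPart L).comp (P.restrictScalars ℝ) := by
  ext v
  simp [antiPart_apply]

end AntilinearPart

section HolomorphicForms

open ContinuousAlternatingMap

variable {N : ℕ}

theorem alternatizeUncurryFin_eq_zero_of_finrank_le {𝕜 V W : Type*} [NontriviallyNormedField 𝕜]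
    [NormedAddCommGroup V] [NormedSpace 𝕜 V] [NormedAddCommGroup W] [NormedSpace 𝕜 W]
    [FiniteDimensional 𝕜 V] (hN : Module.finrank 𝕜 V ≤ N) (f : V →L[𝕜] V [⋀^Fin N]→L[𝕜] W) :
    alternatizeUncurryFin f = 0 := by
  ext v
  refine (alternatizeUncurryFin f).toAlternatingMap.map_linearDependent v fun hv => ?_
  have := hv.fintype_card_le_finrank
  rw [Fintype.card_fin] at this
  omega

variable {E : Type*} [NormedAddCommGroup E] [NormedSpace ℝ E] [NormedSpace ℂ E]
  [IsScalarTower ℝ ℂ E]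

/-- `d(F D) = ∂̄F ∧ D`: the other half `∂F ∧ D` is a complex `(N + 1)`-form on a space of
dimension at most `N`. -/
theorem extDeriv_smul_restrictScalars [FiniteDimensional ℂ E] (hN : Module.finrank ℂ E ≤ N)
    (D : E [⋀^Fin N]→L[ℂ] ℂ) {F : E → ℂ} {p : E} (hF : DifferentiableAt ℝ F p) :
    extDeriv (fun q => F q • D.restrictScalars ℝ) p =
      alternatizeUncurryFin ((antiPart (fderiv ℝ F p)).smulRight (D.restrictScalars ℝ)) := by
  obtain ⟨M, hM⟩ := exists_restrictScalars_add_antiPart (fderiv ℝ F p)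
  have hderiv := (hF.hasFDerivAt.smul_const (D.restrictScalars ℝ)).fderiv
  ext v
  have hMD := congrArg (fun A => A v)
    (alternatizeUncurryFin_eq_zero_of_finrank_le hN (M.smulRight D))
  have hsum : ∑ i : Fin (N + 1), (-1) ^ (i : ℕ) • (M (v i) • D (i.removeNth v)) = 0 := by
    simpa [alternatizeUncurryFin_apply] using hMD
  have hsplit : ∀ w, fderiv ℝ F p w = M w + antiPart (fderiv ℝ F p) w := fun w =>
    congrArg (fun A => A w) hM
  rw [extDeriv, hderiv]
  simp only [alternatizeUncurryFin_apply, ContinuousLinearMap.smulRight_apply,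
    ContinuousAlternatingMap.smul_apply, ContinuousAlternatingMap.add_apply, coe_restrictScalars,
    hsplit, add_smul, smul_add, Finset.sum_add_distrib]
  rw [hsum, zero_add]

theorem norm_extDeriv_smul_restrictScalars_le [FiniteDimensional ℂ E]
    (hN : Module.finrank ℂ E ≤ N)
    (D : E [⋀^Fin N]→L[ℂ] ℂ) {F : E → ℂ} {p : E} (hF : DifferentiableAt ℝ F p) :
    ‖extDeriv (fun q => F q • D.restrictScalars ℝ) p‖ ≤
      (N + 1) * (‖antiPart (fderiv ℝ F p)‖ * ‖D‖) := by
  rw [extDeriv_smul_restrictScalars hN D hF]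
  refine (norm_alternatizeUncurryFin_le _).trans ?_
  gcongr
  refine ContinuousLinearMap.opNorm_le_bound _ (by positivity) fun v => ?_
  rw [ContinuousLinearMap.smulRight_apply, norm_smul, norm_restrictScalars, mul_right_comm]
  gcongr
  exact ContinuousLinearMap.le_opNorm _ v

end HolomorphicForms

section CylinderStokes

open MeasureTheory Set

variable {X G : Type*} [NormedAddCommGroup X] [NormedSpace ℝ X]
  [NormedAddCommGroup G] [NormedSpace ℝ G] {I : Set ℝ} {S : Set X}

theorem contDiff_slice {g : ℝ × X → G} {m : WithTop ℕ∞} (hg : ContDiffOn ℝ m g (I ×ˢ univ))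
    {σ : ℝ} (hσ : σ ∈ I) : ContDiff ℝ m fun t => g (σ, t) :=
  contDiffOn_univ.1 (hg.comp (contDiff_prodMk_right σ).contDiffOn fun _ _ => ⟨hσ, trivial⟩)

theorem fderiv_slice {g : ℝ × X → G} {σ : ℝ} {t : X} (hg : DifferentiableAt ℝ g (σ, t)) (v : X) :
    fderiv ℝ (fun t => g (σ, t)) t v = fderiv ℝ g (σ, t) (0, v) := by
  have := (hg.hasFDerivAt.comp t (hasFDerivAt_prodMk_right σ t)).fderiv
  exact congrArg (fun A => A v) this

variable [FiniteDimensional ℝ X] [MeasurableSpace X] [BorelSpace X] {μ : Measure X}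
  [μ.IsAddHaarMeasure]

theorem integral_fderiv_apply_eq_zero {f : X → G} (hf : ContDiff ℝ 1 f)
    (hfc : HasCompactSupport f) (v : X) : ∫ x, fderiv ℝ f x v ∂μ = 0 := by
  have hderiv : Integrable (fun x => fderiv ℝ f x v) μ :=
    ((hf.continuous_fderiv one_ne_zero).clm_apply continuous_const).integrable_of_hasCompactSupport
      (hfc.fderiv_apply ℝ v)
  simpa using integral_smul_fderiv_eq_neg_fderiv_smul_of_integrable (μ := μ) (𝕜 := ℝ)
    (f := fun _ => 1) (g := f) (v := v) (by simp) (by simpa using hderiv)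
    (by simpa using hf.continuous.integrable_of_hasCompactSupport hfc)
    (fun _ _ => differentiableAt_const _) (fun x _ => hf.differentiable one_ne_zero x)

theorem hasDerivAt_integral_of_contDiffOn_cylinder (hI : IsOpen I) (hS : IsCompact S)
    {g : ℝ × X → G} (hg : ContDiffOn ℝ 1 g (I ×ˢ univ))
    (hgS : ∀ σ ∈ I, ∀ t ∉ S, g (σ, t) = 0) {σ : ℝ} (hσ : σ ∈ I) :
    HasDerivAt (fun σ => ∫ t, g (σ, t) ∂μ) (∫ t, fderiv ℝ g (σ, t) (1, 0) ∂μ) σ := by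
  have hopen : IsOpen (I ×ˢ (univ : Set X)) := hI.prod isOpen_univ
  have hcont : ContinuousOn (fun p => fderiv ℝ g p (1, 0)) (I ×ˢ univ) :=
    (hg.continuousOn_fderiv_of_isOpen hopen le_rfl).clm_apply continuousOn_const
  have hcontσ : Continuous fun t => fderiv ℝ g (σ, t) (1, 0) :=
    continuousOn_univ.1 (hcont.comp (by fun_prop) fun _ _ => ⟨hσ, trivial⟩)
  have hderiv : ∀ τ ∈ I, ∀ t, HasDerivAt (fun τ => g (τ, t)) (fderiv ℝ g (τ, t) (1, 0)) τ :=
    fun τ hτ t => ((hg.contDiffAt (hopen.mem_nhds ⟨hτ, trivial⟩)).differentiableAt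
      one_ne_zero).hasFDerivAt.comp_hasDerivAt τ
        ((hasDerivAt_id τ).prodMk (hasDerivAt_const τ t))
  have hderivS : ∀ τ ∈ I, ∀ t ∉ S, fderiv ℝ g (τ, t) (1, 0) = 0 := fun τ hτ t ht =>
    (hderiv τ hτ t).unique ((hasDerivAt_const τ (0 : G)).congr_of_eventuallyEq
      (by filter_upwards [hI.mem_nhds hτ] with τ' hτ' using hgS τ' hτ' t ht))
  obtain ⟨J, hJσ, hJI, hJ⟩ := LocallyCompactSpace.local_compact_nhds σ I (hI.mem_nhds hσ)
  obtain ⟨R, hR⟩ := (hJ.prod hS).exists_bound_of_continuousOn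
    (hcont.mono (prod_mono hJI (subset_univ S)))
  refine (hasDerivAt_integral_of_dominated_loc_of_deriv_le (F := fun τ t => g (τ, t))
    (F' := fun τ t => fderiv ℝ g (τ, t) (1, 0)) (bound := S.indicator fun _ => R) hJσ
    ?_ ?_ hcontσ.aestronglyMeasurable ?_ ?_ ?_).2
  · filter_upwards [hI.mem_nhds hσ] with τ hτ
    exact (contDiff_slice hg hτ).continuous.aestronglyMeasurable
  · exact (contDiff_slice hg hσ).continuous.integrable_of_hasCompactSupport
      (HasCompactSupport.intro hS (hgS σ hσ))
  · refine .of_forall fun t τ hτ => ?_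
    by_cases ht : t ∈ S
    · rw [indicator_of_mem ht]
      exact hR (τ, t) ⟨hτ, ht⟩
    · rw [indicator_of_notMem ht, hderivS τ (hJI hτ) t ht, norm_zero]
  · exact (integrable_indicator_iff hS.measurableSet).2 (integrableOn_const hS.measure_lt_top.ne)
  · exact .of_forall fun t τ hτ => hderiv τ (hJI hτ) t

section Stokes

variable {N : ℕ} {η : ℝ × X → (ℝ × X) [⋀^Fin N]→L[ℝ] G}

/-- In `dη (∂_σ, b₁, …, b_N)` the terms that differentiate along some `b_k` integrate to zero. -/
theorem hasDerivAt_integral_form (hI : IsOpen I) (hS : IsCompact S)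
    (hη : ∀ σ ∈ I, ∀ t, DifferentiableAt ℝ η (σ, t))
    (hηv : ∀ v, ContDiffOn ℝ 1 (fun p => η p v) (I ×ˢ univ))
    (hηS : ∀ σ ∈ I, ∀ t ∉ S, η (σ, t) = 0) (b : Fin N → X) {σ : ℝ} (hσ : σ ∈ I) :
    HasDerivAt (fun σ => ∫ t, η (σ, t) (fun k => (0, b k)) ∂μ)
      (∫ t, extDeriv η (σ, t) (Fin.cons (1, 0) fun k => (0, b k)) ∂μ) σ := by
  have hzero : ∀ v, ∀ σ ∈ I, ∀ t ∉ S, η (σ, t) v = 0 := fun v σ hσ t ht =>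
    congrArg (fun L => L v) (hηS σ hσ t ht)
  have hdiff : ∀ v t, DifferentiableAt ℝ (fun p => η p v) (σ, t) := fun v t =>
    ((hηv v).contDiffAt ((hI.prod isOpen_univ).mem_nhds ⟨hσ, trivial⟩)).differentiableAt
      one_ne_zero
  have htangential : ∀ v w, ∫ t, fderiv ℝ (fun p => η p v) (σ, t) (0, w) ∂μ = 0 := fun v w => by
    simp only [← fderiv_slice (hdiff v _)]
    exact integral_fderiv_apply_eq_zero (contDiff_slice (hηv v) hσ)
      (HasCompactSupport.intro hS (hzero v σ hσ)) w
  have hintg : ∀ v w, Integrable (fun t => fderiv ℝ (fun p => η p v) (σ, t) w) μ := fun v w => by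
    refine Continuous.integrable_of_hasCompactSupport ?_ (HasCompactSupport.intro hS ?_)
    · have := (hηv v).continuousOn_fderiv_of_isOpen (hI.prod isOpen_univ) le_rfl
      exact (continuousOn_univ.1 (this.comp (by fun_prop) fun _ _ => ⟨hσ, trivial⟩)).clm_apply
        continuous_const
    · intro t ht
      have : (fun p => η p v) =ᶠ[nhds (σ, t)] fun _ => 0 := by
        filter_upwards [(hI.prod hS.isClosed.isOpen_compl).mem_nhds ⟨hσ, ht⟩] with p hp
          using hzero v p.1 hp.1 p.2 hp.2
      rw [this.fderiv_eq, fderiv_const_apply, zero_apply]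
  convert hasDerivAt_integral_of_contDiffOn_cylinder (μ := μ) hI hS (hηv _) (hzero _) hσ using 1
  simp only [extDeriv_apply (hη σ hσ _), Fin.sum_univ_succ, Fin.cons_zero, Fin.cons_succ,
    Fin.removeNth_zero, Fin.tail_cons, Fin.val_zero, pow_zero, one_smul, ← map_zsmul,
    Prod.smul_mk, smul_zero]
  rw [integral_add (hintg _ _) (integrable_finsetSum _ fun k _ => hintg _ _),
    integral_finsetSum _ fun k _ => hintg _ _]
  simp only [htangential, Finset.sum_const_zero, add_zero]

theorem norm_integral_form_sub_le (hI : IsOpen I) (hI₀₁ : Icc 0 1 ⊆ I) (hS : IsCompact S)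
    (hη : ∀ σ ∈ I, ∀ t, DifferentiableAt ℝ η (σ, t))
    (hηv : ∀ v, ContDiffOn ℝ 1 (fun p => η p v) (I ×ˢ univ))
    (hηS : ∀ σ ∈ I, ∀ t ∉ S, η (σ, t) = 0) {b : Fin N → X} (hb : ∀ k, ‖b k‖ ≤ 1) {B : ℝ}
    (hB : ∀ σ ∈ Icc (0 : ℝ) 1, ∀ t ∈ S, ‖extDeriv η (σ, t)‖ ≤ B) :
    ‖∫ t, η (1, t) (fun k => (0, b k)) ∂μ - ∫ t, η (0, t) (fun k => (0, b k)) ∂μ‖ ≤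
      B * μ.real S := by
  refine norm_image_sub_le_of_norm_deriv_le_segment_01' (fun σ hσ =>
    (hasDerivAt_integral_form hI hS hη hηv hηS b (hI₀₁ hσ)).hasDerivWithinAt) fun σ hσ => ?_
  have hσ' := Ico_subset_Icc_self hσ
  have hzero : ∀ t ∉ S, extDeriv η (σ, t) = 0 := fun t ht => by
    have : η =ᶠ[nhds (σ, t)] fun _ => 0 := by
      filter_upwards [(hI.prod hS.isClosed.isOpen_compl).mem_nhds ⟨hI₀₁ hσ', ht⟩] with p hp
        using hηS p.1 hp.1 p.2 hp.2
    rw [this.extDeriv_eq, extDeriv, fderiv_const_apply]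
    exact map_zero (ContinuousAlternatingMap.alternatizeUncurryFinCLM ℝ (ℝ × X) G)
  rw [← setIntegral_eq_integral_of_forall_compl_eq_zero (s := S) fun t ht =>
    congrArg (fun L => L (Fin.cons (1, 0) fun k => (0, b k))) (hzero t ht)]
  refine norm_setIntegral_le_of_norm_le_const hS.measure_lt_top fun t ht => ?_
  refine ((extDeriv η (σ, t)).le_opNorm _).trans
    ((mul_le_of_le_one_right (norm_nonneg _) ?_).trans (hB σ hσ' t ht))
  refine Finset.prod_le_one (fun _ _ => norm_nonneg _) fun k _ => ?_
  refine Fin.cases ?_ (fun k => ?_) k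
  · simp
  · simpa using hb k

theorem norm_extDeriv_smul_le {E : Type*} [NormedAddCommGroup E] [NormedSpace ℝ E]
    {θ : E → ℝ} {η : E → E [⋀^Fin N]→L[ℝ] G} {p : E} (hθ : DifferentiableAt ℝ θ p)
    (hη : DifferentiableAt ℝ η p) :
    ‖extDeriv (fun q => θ q • η q) p‖ ≤
      ‖θ p‖ * ‖extDeriv η p‖ + (N + 1) * (‖fderiv ℝ θ p‖ * ‖η p‖) := by
  rw [extDeriv, fderiv_fun_smul hθ hη, ContinuousAlternatingMap.alternatizeUncurryFin_add,
    ContinuousAlternatingMap.alternatizeUncurryFin_smul, ← extDeriv, ← norm_smul]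
  refine (norm_add_le _ _).trans (add_le_add_right ?_ _)
  refine (ContinuousAlternatingMap.norm_alternatizeUncurryFin_le _).trans ?_
  rw [ContinuousLinearMap.norm_smulRight_apply]

end Stokes

end CylinderStokes

section PullbackForm

open MeasureTheory Set

variable {N : ℕ} {E Z : Type*} [NormedAddCommGroup E] [NormedSpace ℝ E] [NormedSpace ℂ E]
  [IsScalarTower ℝ ℂ E] [NormedAddCommGroup Z] [NormedSpace ℝ Z]
  {F : E → ℂ} {D : E [⋀^Fin N]→L[ℂ] ℂ} {H : Z → E} {p : Z}

/-- The pull-back `H^*(F D)` of the form `F D`, where `D` has constant coefficients. -/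
def pullbackForm (F : E → ℂ) (D : E [⋀^Fin N]→L[ℂ] ℂ) (H : Z → E) (p : Z) :
    Z [⋀^Fin N]→L[ℝ] ℂ :=
  (F (H p) • D.restrictScalars ℝ).compContinuousLinearMap (fderiv ℝ H p)

theorem pullbackForm_apply (v : Fin N → Z) :
    pullbackForm F D H p v = F (H p) * D fun k => fderiv ℝ H p (v k) :=
  rfl

theorem norm_pullbackForm_le :
    ‖pullbackForm F D H p‖ ≤ ‖F (H p)‖ * ‖D‖ * ‖fderiv ℝ H p‖ ^ N := by
  refine (ContinuousAlternatingMap.norm_compContinuousLinearMap_le _ _).trans_eq ?_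
  rw [norm_smul, ContinuousAlternatingMap.norm_restrictScalars, Fintype.card_fin]

theorem differentiableAt_pullbackForm (hF : DifferentiableAt ℝ F (H p))
    (hH : ContDiffAt ℝ 2 H p) : DifferentiableAt ℝ (pullbackForm F D H) p :=
  ((hF.comp p (hH.differentiableAt two_ne_zero)).smul_const
    (D.restrictScalars ℝ)).continuousAlternatingMapCompContinuousLinearMap
      ((hH.fderiv_right (m := 1) (by norm_num)).differentiableAt one_ne_zero)

theorem contDiffAt_pullbackForm_apply (hF : ContDiffAt ℝ 1 F (H p)) (hH : ContDiffAt ℝ 2 H p)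
    (v : Fin N → Z) : ContDiffAt ℝ 1 (fun q => pullbackForm F D H q v) p := by
  have hderiv : ContDiffAt ℝ 1 (fun q k => fderiv ℝ H q (v k)) p := contDiffAt_pi.2 fun k =>
    (hH.fderiv_right (by norm_num)).clm_apply contDiffAt_const
  exact (hF.comp p (hH.of_le one_le_two)).mul
    ((D.restrictScalars ℝ).toContinuousMultilinearMap.contDiff.contDiffAt.comp p hderiv)

theorem norm_extDeriv_pullbackForm_le [FiniteDimensional ℂ E] (hN : Module.finrank ℂ E ≤ N)
    (hF : DifferentiableAt ℝ F (H p)) (hH : ContDiffAt ℝ 2 H p) :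
    ‖extDeriv (pullbackForm F D H) p‖ ≤
      (N + 1) * (‖antiPart (fderiv ℝ F (H p))‖ * ‖D‖) * ‖fderiv ℝ H p‖ ^ (N + 1) := by
  have hFD : DifferentiableAt ℝ (fun q => F q • D.restrictScalars ℝ) (H p) := hF.smul_const _
  have hpull : extDeriv (pullbackForm F D H) p =
      (extDeriv (fun q => F q • D.restrictScalars ℝ) (H p)).compContinuousLinearMap
        (fderiv ℝ H p) :=
    extDeriv_pullback hFD hH (by simp)
  rw [hpull]
  refine (ContinuousAlternatingMap.norm_compContinuousLinearMap_le _ _).trans ?_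
  rw [Fintype.card_fin]
  gcongr
  exact norm_extDeriv_smul_restrictScalars_le hN D hF

variable {θ : Z → ℝ}

theorem norm_extDeriv_cutoff_pullbackForm_le [FiniteDimensional ℂ E]
    (hN : Module.finrank ℂ E ≤ N) (hF : DifferentiableAt ℝ F (H p)) (hH : ContDiffAt ℝ 2 H p)
    (hθ : DifferentiableAt ℝ θ p) (hθ₁ : ‖θ p‖ ≤ 1) {R Y : ℝ} (hR : ‖fderiv ℝ H p‖ ≤ R)
    (hantiY : ‖antiPart (fderiv ℝ F (H p))‖ ≤ Y) (hθY : ‖fderiv ℝ θ p‖ * ‖F (H p)‖ ≤ Y) :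
    ‖extDeriv (fun q => θ q • pullbackForm F D H q) p‖ ≤
      (N + 1) * ‖D‖ * (R ^ (N + 1) + R ^ N) * Y := by
  have hY : 0 ≤ Y := (norm_nonneg _).trans hantiY
  have hinterior : ‖θ p‖ * ‖extDeriv (pullbackForm F D H) p‖ ≤
      1 * ((N + 1) * (Y * ‖D‖) * R ^ (N + 1)) := by
    gcongr
    refine (norm_extDeriv_pullbackForm_le hN hF hH).trans ?_
    gcongr
  have hcutoff : ‖fderiv ℝ θ p‖ * ‖pullbackForm F D H p‖ ≤ Y * ‖D‖ * R ^ N :=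
    calc ‖fderiv ℝ θ p‖ * ‖pullbackForm F D H p‖
        ≤ ‖fderiv ℝ θ p‖ * (‖F (H p)‖ * ‖D‖ * ‖fderiv ℝ H p‖ ^ N) := by
          gcongr
          exact norm_pullbackForm_le
      _ = ‖fderiv ℝ θ p‖ * ‖F (H p)‖ * ‖D‖ * ‖fderiv ℝ H p‖ ^ N := by ring
      _ ≤ Y * ‖D‖ * R ^ N := by gcongr
  calc ‖extDeriv (fun q => θ q • pullbackForm F D H q) p‖
      ≤ 1 * ((N + 1) * (Y * ‖D‖) * R ^ (N + 1)) + (N + 1) * (Y * ‖D‖ * R ^ N) :=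
        (norm_extDeriv_smul_le hθ (differentiableAt_pullbackForm hF hH)).trans
          (by gcongr)
    _ = (N + 1) * ‖D‖ * (R ^ (N + 1) + R ^ N) * Y := by ring

end PullbackForm

section Homotopy

open MeasureTheory Set

variable {N : ℕ} {E X : Type*} [NormedAddCommGroup E] [NormedSpace ℝ E] [NormedSpace ℂ E]
  [IsScalarTower ℝ ℂ E] [FiniteDimensional ℂ E] [NormedAddCommGroup X] [NormedSpace ℝ X]
  [FiniteDimensional ℝ X] [MeasurableSpace X] [BorelSpace X] {μ : Measure X} [μ.IsAddHaarMeasure]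

/-- In the bound `R ^ (N + 1)` comes from the pull-back of `∂̄F ∧ D`, and `R ^ N` from the cut-off
term `F dθ ∧ H^*D`. -/
theorem norm_integral_pullbackForm_sub_le (hN : Module.finrank ℂ E ≤ N)
    (D : E [⋀^Fin N]→L[ℂ] ℂ) {T : Set E} (hT : IsOpen T) {F : E → ℂ} (hF : ContDiffOn ℝ 1 F T)
    {I : Set ℝ} (hI : IsOpen I) (hI₀₁ : Icc 0 1 ⊆ I) {W : Set X} (hW : IsOpen W)
    {H : ℝ × X → E} (hH : ContDiffOn ℝ 2 H (I ×ˢ W)) (hHT : MapsTo H (I ×ˢ W) T)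
    {θ : X → ℝ} (hθ : ContDiff ℝ 1 θ) (hθc : HasCompactSupport θ) (hθW : tsupport θ ⊆ W)
    {b : Fin N → X} (hb : ∀ k, ‖b k‖ ≤ 1) {R Y : ℝ} (hθ₁ : ∀ t, ‖θ t‖ ≤ 1)
    (hR : ∀ σ ∈ Icc (0 : ℝ) 1, ∀ t ∈ tsupport θ, ‖fderiv ℝ H (σ, t)‖ ≤ R)
    (hanti : ∀ σ ∈ Icc (0 : ℝ) 1, ∀ t ∈ tsupport θ, ‖antiPart (fderiv ℝ F (H (σ, t)))‖ ≤ Y)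
    (hθY : ∀ σ ∈ Icc (0 : ℝ) 1, ∀ t ∈ tsupport θ, ‖fderiv ℝ θ t‖ * ‖F (H (σ, t))‖ ≤ Y) :
    ‖∫ t, θ t • pullbackForm F D H (1, t) (fun k => (0, b k)) ∂μ -
        ∫ t, θ t • pullbackForm F D H (0, t) (fun k => (0, b k)) ∂μ‖ ≤
      (N + 1) * ‖D‖ * (R ^ (N + 1) + R ^ N) * Y * μ.real (tsupport θ) := by
  have hHat : ∀ p ∈ I ×ˢ W, ContDiffAt ℝ 2 H p := fun p hp =>
    hH.contDiffAt ((hI.prod hW).mem_nhds hp)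
  have hFat : ∀ p ∈ I ×ˢ W, ContDiffAt ℝ 1 F (H p) := fun p hp =>
    hF.contDiffAt (hT.mem_nhds (hHT hp))
  have hθat : ∀ p : ℝ × X, ContDiffAt ℝ 1 (fun p : ℝ × X => θ p.2) p := fun p =>
    hθ.contDiffAt.comp p contDiffAt_snd
  have hzero : ∀ p : ℝ × X, p.2 ∉ tsupport θ →
      (fun q : ℝ × X => θ q.2 • pullbackForm F D H q) =ᶠ[nhds p] 0 := fun p hp => by
    filter_upwards [continuousAt_snd.preimage_mem_nhds
      ((isClosed_tsupport θ).isOpen_compl.mem_nhds hp)] with q hq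
    rw [image_eq_zero_of_notMem_tsupport hq, zero_smul, Pi.zero_apply]
  refine norm_integral_form_sub_le (η := fun q => θ q.2 • pullbackForm F D H q) hI hI₀₁ hθc
    (fun σ hσ t => ?_) (fun v p hp => ?_) (fun σ _ t ht => (hzero (σ, t) ht).eq_of_nhds) hb
    (fun σ hσ t ht => ?_)
  · by_cases ht : t ∈ tsupport θ
    · exact ((hθat _).differentiableAt one_ne_zero).smul (differentiableAt_pullbackForm
        ((hFat _ ⟨hσ, hθW ht⟩).differentiableAt one_ne_zero) (hHat _ ⟨hσ, hθW ht⟩))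
    · exact (differentiableAt_const 0).congr_of_eventuallyEq (hzero (σ, t) ht)
  · by_cases ht : p.2 ∈ tsupport θ
    · exact ((hθat p).smul (contDiffAt_pullbackForm_apply (hFat p ⟨hp.1, hθW ht⟩)
        (hHat p ⟨hp.1, hθW ht⟩) v)).contDiffWithinAt
    · exact (contDiffAt_const.congr_of_eventuallyEq
        ((hzero p ht).fun_comp fun L => L v)).contDiffWithinAt
  · have hp : (σ, t) ∈ I ×ˢ W := ⟨hI₀₁ hσ, hθW ht⟩
    refine norm_extDeriv_cutoff_pullbackForm_le (θ := fun p : ℝ × X => θ p.2) hN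
      ((hFat _ hp).differentiableAt one_ne_zero) (hHat _ hp)
      ((hθat _).differentiableAt one_ne_zero) (hθ₁ t) (hR σ hσ t ht) (hanti σ hσ t ht)
      (le_trans ?_ (hθY σ hσ t ht))
    have hsnd : fderiv ℝ (fun p : ℝ × X => θ p.2) (σ, t) =
        (fderiv ℝ θ t).comp (ContinuousLinearMap.snd ℝ ℝ X) :=
      ((hθ.differentiable one_ne_zero t).hasFDerivAt.comp (σ, t) hasFDerivAt_snd).fderiv
    rw [hsnd]
    gcongr
    exact (ContinuousLinearMap.opNorm_comp_le _ _).trans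
      (mul_le_of_le_one_right (norm_nonneg _) (ContinuousLinearMap.norm_snd_le ..))

end Homotopy

section Conjugation

variable {n : ℕ}

@[simp] theorem conjVec_apply (x : Cn n) (j : Fin n) : conjVec x j = (starRingEnd ℂ) (x j) := rfl

@[simp] theorem norm_conjVec (x : Cn n) : ‖conjVec x‖ = ‖x‖ := by
  simp only [EuclideanSpace.norm_eq, conjVec_apply, RCLike.norm_conj]

@[simp] theorem conjVec_conjVec (x : Cn n) : conjVec (conjVec x) = x := by ext j; simp

/-- Complex conjugation on `ℂⁿ` as a real-linear isometry. -/
def conjIsometry (n : ℕ) : Cn n →ₗᵢ[ℝ] Cn n where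
  toFun := conjVec
  map_add' x y := by ext j; simp
  map_smul' c x := by ext j; simp
  norm_map' := norm_conjVec

@[simp] theorem conjVec_zero : conjVec (0 : Cn n) = 0 := map_zero (conjIsometry n)

theorem conjVec_add (x y : Cn n) : conjVec (x + y) = conjVec x + conjVec y :=
  (conjIsometry n).map_add x y

theorem conjVec_sub (x y : Cn n) : conjVec (x - y) = conjVec x - conjVec y :=
  (conjIsometry n).map_sub x y

theorem conjVec_smul (c : ℝ) (x : Cn n) : conjVec (c • x) = c • conjVec x :=
  (conjIsometry n).map_smul c x

theorem conjVec_I_smul (x : Cn n) : conjVec (Complex.I • x) = -(Complex.I • conjVec x) := by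
  ext j; simp

theorem continuous_conjVec : Continuous (conjVec : Cn n → Cn n) := (conjIsometry n).continuous

/-- The anti-diagonal embedding `x ↦ (x, x̄)`. -/
def antidiag (n : ℕ) : Cn n →L[ℝ] Cn n × Cn n :=
  (ContinuousLinearMap.id ℝ (Cn n)).prod (conjIsometry n).toContinuousLinearMap

@[simp] theorem antidiag_apply (x : Cn n) : antidiag n x = (x, conjVec x) := rfl

theorem norm_sub_conjVec_le (p : Cn n × Cn n) (y : Cn n) :
    ‖p.1 - conjVec p.2‖ ≤ 2 * ‖p - antidiag n y‖ := by
  have hsplit : p.1 - conjVec p.2 = (p - antidiag n y).1 - conjVec (p - antidiag n y).2 := by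
    simp [conjVec_sub]
  rw [hsplit]
  refine (norm_sub_le _ _).trans ?_
  rw [norm_conjVec, two_mul]
  exact add_le_add (norm_fst_le _) (norm_snd_le _)

end Conjugation

section Tube

variable {n : ℕ} {U : Set (Cn n)} {ρ : ℝ}

theorem mem_tube_iff {p : Cn n × Cn n} :
    p ∈ tube U ρ ↔ (1 / 2 : ℝ) • (p.1 + conjVec p.2) ∈ U ∧
      ‖(1 / 2 : ℝ) • (p.1 - conjVec p.2)‖ < ρ := by
  constructor
  · rintro ⟨x, hx, z, hz, rfl⟩
    have hmid : (1 / 2 : ℝ) • (x + z + conjVec (conjVec x - conjVec z)) = x := by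
      rw [conjVec_sub, conjVec_conjVec, conjVec_conjVec]; module
    have hhalf : (1 / 2 : ℝ) • (x + z - conjVec (conjVec x - conjVec z)) = z := by
      rw [conjVec_sub, conjVec_conjVec, conjVec_conjVec]; module
    simp only [hmid, hhalf]
    exact ⟨hx, hz⟩
  · rintro ⟨hmid, hhalf⟩
    refine ⟨_, hmid, _, hhalf, Prod.ext ?_ ?_⟩
    · dsimp only; module
    · simp only [conjVec_smul, conjVec_add, conjVec_sub, conjVec_conjVec]; module

theorem isOpen_tube (hU : IsOpen U) (ρ : ℝ) : IsOpen (tube U ρ) := by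
  have htube : tube U ρ = (fun p : Cn n × Cn n => (1 / 2 : ℝ) • (p.1 + conjVec p.2)) ⁻¹' U ∩
      {p | ‖(1 / 2 : ℝ) • (p.1 - conjVec p.2)‖ < ρ} := by
    ext p; exact mem_tube_iff
  have hconj := continuous_conjVec (n := n)
  rw [htube]
  exact (hU.preimage (by fun_prop)).inter (isOpen_lt (by fun_prop) continuous_const)

theorem antidiag_mem_tube (hρ : 0 < ρ) {y : Cn n} (hy : y ∈ U) : antidiag n y ∈ tube U ρ :=
  ⟨y, hy, 0, by simpa using hρ, by simp⟩

end Tube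

section FlatWeight

variable {s C t : ℝ}

theorem flatWeight_nonneg (hC : 0 ≤ C) : 0 ≤ flatWeight s C t := by
  unfold flatWeight; split_ifs <;> positivity

@[simp] theorem flatWeight_zero : flatWeight s C 0 = 0 := by simp [flatWeight]

theorem flatWeight_mono {t' : ℝ} (hs : 1 ≤ s) (hC : 0 ≤ C) (ht : 0 ≤ t) (htt' : t ≤ t') :
    flatWeight s C t ≤ flatWeight s C t' := by
  rcases ht.eq_or_lt with rfl | htpos
  · simpa using flatWeight_nonneg hC
  · have hpow : t' ^ (-(1 / (s - 1))) ≤ t ^ (-(1 / (s - 1))) :=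
      Real.rpow_le_rpow_of_nonpos htpos htt' (by simpa using hs)
    rw [flatWeight, flatWeight, if_neg htpos.ne', if_neg (htpos.trans_le htt').ne']
    gcongr

theorem flatWeight_le_of_le {C' : ℝ} (hC : 0 < C) (hCC' : C ≤ C') (ht : 0 ≤ t) :
    flatWeight s C t ≤ flatWeight s C' t := by
  have hC' : 0 < C' := hC.trans_le hCC'
  unfold flatWeight
  split_ifs
  · exact le_rfl
  · gcongr

theorem exists_flatWeight_le_sq (hs : 1 < s) (hC : 0 < C) :
    ∃ M, 0 ≤ M ∧ ∀ t, 0 ≤ t → flatWeight s C t ≤ M * t ^ 2 := by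
  set p : ℝ := 2 * (s - 1) with hp
  have hs' : 0 < s - 1 := sub_pos.2 hs
  refine ⟨C * ((p + 1) / C⁻¹) ^ p, by positivity, fun t ht => ?_⟩
  rcases ht.eq_or_lt with rfl | htpos
  · simp
  set τ : ℝ := t ^ (-(1 / (s - 1))) with hτ
  have hτp : τ ^ p = (t ^ 2)⁻¹ := by
    rw [hτ, ← Real.rpow_mul ht, ← Real.rpow_natCast, ← Real.rpow_neg ht]
    congr 1
    rw [hp]
    push_cast
    field_simp
  have hexp := rpow_le_mul_exp (inv_pos.2 hC) (by positivity : 0 ≤ p)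
    (Real.rpow_nonneg ht (-(1 / (s - 1))))
  rw [hτp, inv_le_iff_one_le_mul₀ (by positivity)] at hexp
  rw [flatWeight, if_neg htpos.ne', ← hτ, mul_assoc, Real.exp_neg]
  gcongr
  rw [inv_le_iff_one_le_mul₀ (Real.exp_pos _)]
  linarith

end FlatWeight

section DbarFlat

variable {n : ℕ}

theorem eq_sum_smul_reIm (ζ : Cn n × Cn n) :
    ζ = ∑ j, ζ.1 j • ((reIm n (Sum.inl j), 0) : Cn n × Cn n) +
      ∑ j, ζ.2 j • ((0, reIm n (Sum.inl j)) : Cn n × Cn n) := by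
  have hsum (x : Cn n) : x = ∑ j, x j • reIm n (Sum.inl j) := by
    ext i
    simp [reIm, Pi.single_apply]
  ext1
  · simpa [Prod.fst_sum] using hsum ζ.1
  · simpa [Prod.snd_sum] using hsum ζ.2

theorem I_smul_reIm_inl (j : Fin n) : Complex.I • reIm n (Sum.inl j) = reIm n (Sum.inr j) := by
  ext i
  simp [reIm]

theorem antiPart_fderiv_apply {E : Type*} [NormedAddCommGroup E] [NormedSpace ℝ E]
    [NormedSpace ℂ E] [IsScalarTower ℝ ℂ E] (f : E → ℂ) (p v : E) :
    antiPart (fderiv ℝ f p) v = dbar v (Complex.I • v) f p := antiPart_apply _ _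

theorem DbarFlat.norm_antiPart_fderiv_le {s C : ℝ} {f : Cn n × Cn n → ℂ} {T : Set (Cn n × Cn n)}
    (hf : DbarFlat s C f T) (hC : 0 ≤ C) {p : Cn n × Cn n} (hp : p ∈ T) :
    ‖antiPart (fderiv ℝ f p)‖ ≤ 2 * n * flatWeight s C ‖p.1 - conjVec p.2‖ := by
  set w := flatWeight s C ‖p.1 - conjVec p.2‖
  have hw0 : 0 ≤ w := flatWeight_nonneg hC
  refine ContinuousLinearMap.opNorm_le_bound _ (by positivity) fun ζ => ?_
  have hsum (c : Cn n) (hc : ‖c‖ ≤ ‖ζ‖) (v : Fin n → Cn n × Cn n)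
      (hv : ∀ j, ‖antiPart (fderiv ℝ f p) (v j)‖ ≤ w) :
      ‖antiPart (fderiv ℝ f p) (∑ j, c j • v j)‖ ≤ n * (‖ζ‖ * w) := by
    rw [map_sum]
    refine (norm_sum_le_of_le _ fun j _ => ?_).trans_eq
      (by rw [Finset.sum_const, Finset.card_univ, Fintype.card_fin, nsmul_eq_mul])
    rw [antiPart_smul, norm_mul, RCLike.norm_conj]
    exact mul_le_mul ((PiLp.norm_apply_le c j).trans hc) (hv j) (norm_nonneg _) (norm_nonneg _)
  have hfst := hsum ζ.1 (norm_fst_le ζ) (fun j => (reIm n (Sum.inl j), 0)) fun j => by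
    rw [antiPart_fderiv_apply, Prod.smul_mk, I_smul_reIm_inl, smul_zero]
    exact (hf p hp j).1
  have hsnd := hsum ζ.2 (norm_snd_le ζ) (fun j => (0, reIm n (Sum.inl j))) fun j => by
    rw [antiPart_fderiv_apply, Prod.smul_mk, I_smul_reIm_inl, smul_zero]
    exact (hf p hp j).2
  conv_lhs => rw [eq_sum_smul_reIm ζ, map_add]
  refine (norm_add_le_of_le hfst hsnd).trans_eq ?_
  ring

end DbarFlat

section MixedDifference

variable {E₁ E₂ G : Type*} [NormedAddCommGroup E₁] [NormedSpace ℝ E₁] [NormedAddCommGroup E₂]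
  [NormedSpace ℝ E₂] [NormedAddCommGroup G] [NormedSpace ℝ G]

theorem norm_comp_inl_le (L : E₁ × E₂ →L[ℝ] G) : ‖L.comp (ContinuousLinearMap.inl ℝ E₁ E₂)‖ ≤ ‖L‖ :=
  (L.opNorm_comp_le _).trans
    (mul_le_of_le_one_right (norm_nonneg L) (ContinuousLinearMap.norm_inl_le_one ℝ E₁ E₂))

theorem norm_comp_inr_le (L : E₁ × E₂ →L[ℝ] G) :
    ‖L.comp (ContinuousLinearMap.inr ℝ E₁ E₂)‖ ≤ ‖L‖ :=
  (L.opNorm_comp_le _).trans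
    (mul_le_of_le_one_right (norm_nonneg L) (ContinuousLinearMap.norm_inr_le_one ℝ E₁ E₂))

theorem norm_sub_sub_inl_le {f : E₁ × E₂ → G} {A : Set E₁} (hA : Convex ℝ A) {y : E₂}
    (hd : ∀ a ∈ A, DifferentiableAt ℝ f (a, y)) {H : E₁ × E₂ →L[ℝ] G} {ε : ℝ}
    (hε : ∀ a ∈ A, ‖fderiv ℝ f (a, y) - H‖ ≤ ε) {x x' : E₁} (hx : x ∈ A) (hx' : x' ∈ A) :
    ‖f (x', y) - f (x, y) - H (x' - x, 0)‖ ≤ ε * ‖x' - x‖ := by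
  simpa using hA.norm_image_sub_le_of_norm_hasFDerivWithin_le'
    (f := fun a => f (a, y)) (φ := H.comp (ContinuousLinearMap.inl ℝ E₁ E₂))
    (fun a ha => ((hd a ha).hasFDerivAt.comp a (hasFDerivAt_prodMk_left a y)).hasFDerivWithinAt)
    (fun a ha => by
      rw [← ContinuousLinearMap.sub_comp]
      exact (norm_comp_inl_le _).trans (hε a ha)) hx hx'

theorem norm_mixed_difference_sub_le {f : E₁ × E₂ → G} {A : Set E₁} {B : Set E₂}
    (hA : Convex ℝ A) (hB : Convex ℝ B) (hd : ∀ p ∈ A ×ˢ B, DifferentiableAt ℝ f p)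
    (hdd : ∀ p ∈ A ×ˢ B, DifferentiableAt ℝ (fderiv ℝ f) p)
    {H : E₁ × E₂ →L[ℝ] E₁ × E₂ →L[ℝ] G} {ε : ℝ}
    (hε : ∀ p ∈ A ×ˢ B, ‖fderiv ℝ (fderiv ℝ f) p - H‖ ≤ ε)
    {x x' : E₁} {y y' : E₂} (hx : x ∈ A) (hx' : x' ∈ A) (hy : y ∈ B) (hy' : y' ∈ B) :
    ‖f (x', y') - f (x', y) - f (x, y') + f (x, y) - H (x' - x, 0) (0, y' - y)‖ ≤
      ε * ‖x' - x‖ * ‖y' - y‖ := by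
  have hfirst : ∀ b ∈ B, ‖fderiv ℝ f (x', b) - fderiv ℝ f (x, b) - H (x' - x, 0)‖ ≤
      ε * ‖x' - x‖ := fun b hb =>
    norm_sub_sub_inl_le hA (fun a ha => hdd _ ⟨ha, hb⟩) (fun a ha => hε _ ⟨ha, hb⟩) hx hx'
  have hsecond := hB.norm_image_sub_le_of_norm_hasFDerivWithin_le'
    (f := fun b => f (x', b) - f (x, b))
    (f' := fun b => (fderiv ℝ f (x', b) - fderiv ℝ f (x, b)).comp
      (ContinuousLinearMap.inr ℝ E₁ E₂))
    (φ := (H (x' - x, 0)).comp (ContinuousLinearMap.inr ℝ E₁ E₂))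
    (fun b hb => by
      rw [ContinuousLinearMap.sub_comp]
      exact (((hd (x', b) ⟨hx', hb⟩).hasFDerivAt.comp b (hasFDerivAt_prodMk_right x' b)).sub
        ((hd (x, b) ⟨hx, hb⟩).hasFDerivAt.comp b
          (hasFDerivAt_prodMk_right x b))).hasFDerivWithinAt)
    (fun b hb => by
      rw [← ContinuousLinearMap.sub_comp]
      exact (norm_comp_inr_le _).trans (hfirst b hb)) hy hy'
  convert hsecond using 2
  simp only [ContinuousLinearMap.comp_apply, ContinuousLinearMap.inr_apply]
  abel

theorem exists_norm_mixed_difference_sub_le {f : E₁ × E₂ → G} {p₀ : E₁ × E₂}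
    (hf : ContDiffAt ℝ 2 f p₀) {ε : ℝ} (hε : 0 < ε) :
    ∃ R > 0, ∀ x ∈ Metric.ball p₀.1 R, ∀ x' ∈ Metric.ball p₀.1 R,
      ∀ y ∈ Metric.ball p₀.2 R, ∀ y' ∈ Metric.ball p₀.2 R,
      ‖f (x', y') - f (x', y) - f (x, y') + f (x, y) -
        fderiv ℝ (fderiv ℝ f) (x, y) (x' - x, 0) (0, y' - y)‖ ≤ ε * ‖x' - x‖ * ‖y' - y‖ := by
  have hcont : ContinuousAt (fderiv ℝ (fderiv ℝ f)) p₀ :=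
    ((hf.fderiv_right (m := 1) (by norm_num)).fderiv_right (m := 0) (by norm_num)).continuousAt
  have hnear : ∀ᶠ p in nhds p₀, ContDiffAt ℝ 2 f p ∧
      dist (fderiv ℝ (fderiv ℝ f) p) (fderiv ℝ (fderiv ℝ f) p₀) < ε / 2 :=
    (hf.eventually (by simp)).and (hcont.eventually (Metric.ball_mem_nhds _ (half_pos hε)))
  obtain ⟨R, hR, hball⟩ := Metric.eventually_nhds_iff_ball.1 hnear
  rw [← Prod.mk.eta (p := p₀), ← ball_prod_same] at hball
  refine ⟨R, hR, fun x hx x' hx' y hy y' hy' => norm_mixed_difference_sub_le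
    (convex_ball p₀.1 R) (convex_ball p₀.2 R)
    (fun p hp => (hball p hp).1.differentiableAt (by norm_num))
    (fun p hp => ((hball p hp).1.fderiv_right (m := 1) (by norm_num)).differentiableAt
      (by norm_num)) (fun p hp => ?_) hx hx' hy hy'⟩
  rw [← dist_eq_norm]
  linarith [dist_triangle_right (fderiv ℝ (fderiv ℝ f) p) (fderiv ℝ (fderiv ℝ f) (x, y))
    (fderiv ℝ (fderiv ℝ f) p₀), (hball p hp).2, (hball (x, y) ⟨hx, hy⟩).2]

end MixedDifference

section SecondDerivative

variable {E : Type*} [NormedAddCommGroup E] [NormedSpace ℝ E]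

theorem im_fderiv_ofReal_apply (f : E → ℝ) (x v : E) :
    (fderiv ℝ (fun t => (f t : ℂ)) x v).im = 0 := by
  by_cases hd : DifferentiableAt ℝ (fun t => (f t : ℂ)) x
  · have him := Complex.imCLM.hasFDerivAt.comp x hd.hasFDerivAt
    have hzero : Complex.imCLM ∘ (fun t => (f t : ℂ)) = fun _ => (0 : ℝ) :=
      funext fun t => Complex.ofReal_im (f t)
    rw [hzero] at him
    exact congrArg (fun L : E →L[ℝ] ℝ => L v) (him.unique (hasFDerivAt_const 0 x))
  · simp [fderiv_zero_of_not_differentiableAt hd]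

theorem hasFDerivAt_fderiv_apply {f : E → ℂ} {x : E} (hf : DifferentiableAt ℝ (fderiv ℝ f) x)
    (v : E) : HasFDerivAt (fun t => fderiv ℝ f t v) ((fderiv ℝ (fderiv ℝ f) x).flip v) x :=
  (hf.hasFDerivAt.clm_apply (hasFDerivAt_const v x)).congr_fderiv (by ext u; simp)

theorem im_fderiv_fderiv_ofReal_apply {f : E → ℝ} {x : E}
    (hf : DifferentiableAt ℝ (fderiv ℝ fun t => (f t : ℂ)) x) (u v : E) :
    (fderiv ℝ (fderiv ℝ fun t => (f t : ℂ)) x u v).im = 0 := by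
  have hreal : (fun t => fderiv ℝ (fun t => (f t : ℂ)) t v) =
      fun t => ((fderiv ℝ (fun t => (f t : ℂ)) t v).re : ℂ) :=
    funext fun t => Complex.ext rfl (by simp [im_fderiv_ofReal_apply f t])
  rw [← ContinuousLinearMap.flip_apply, ← (hasFDerivAt_fderiv_apply hf v).fderiv, hreal]
  exact im_fderiv_ofReal_apply _ x u

theorem del_dbar_eq {f : E → ℂ} {x : E} (hf : DifferentiableAt ℝ (fderiv ℝ f) x)
    (v w v' w' : E) :
    del v w (dbar v' w' f) x =
      (fderiv ℝ (fderiv ℝ f) x v v' + fderiv ℝ (fderiv ℝ f) x w w' +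
        Complex.I * (fderiv ℝ (fderiv ℝ f) x v w' - fderiv ℝ (fderiv ℝ f) x w v')) / 4 := by
  have hdbar : HasFDerivAt (dbar v' w' f) ((2 : ℂ)⁻¹ • ((fderiv ℝ (fderiv ℝ f) x).flip v' +
      Complex.I • (fderiv ℝ (fderiv ℝ f) x).flip w')) x :=
    (((hasFDerivAt_fderiv_apply hf v').add
      ((hasFDerivAt_fderiv_apply hf w').const_mul Complex.I)).const_mul 2⁻¹).congr_of_eventuallyEq
      (Filter.Eventually.of_forall fun t => by simp [dbar, div_eq_inv_mul])
  rw [del, hdbar.fderiv]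
  simp only [smul_apply, add_apply, ContinuousLinearMap.flip_apply, smul_eq_mul]
  linear_combination (-(1 / 4 : ℂ) * fderiv ℝ (fderiv ℝ f) x w w') * Complex.I_sq

end SecondDerivative

section PolarForm

variable {n : ℕ}

/-- The algebra of the Hessian of an almost holomorphic polarization at an anti-diagonal point: a
symmetric complex-bilinear form on `ℂⁿ × ℂⁿ`, real on the anti-diagonal. It is only a real form
as far as types are concerned, and complex linearity in the first variable is left to symmetry. -/
structure IsPolarForm (H : Cn n × Cn n →L[ℝ] Cn n × Cn n →L[ℝ] ℂ) : Prop where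
  smul_right : ∀ (c : ℂ) (ζ η : Cn n × Cn n), H ζ (c • η) = c * H ζ η
  symm : ∀ ζ η, H ζ η = H η ζ
  real : ∀ z w : Cn n, (H (antidiag n z) (antidiag n w)).im = 0

namespace IsPolarForm

variable {H : Cn n × Cn n →L[ℝ] Cn n × Cn n →L[ℝ] ℂ}

theorem smul_left (hH : IsPolarForm H) (c : ℂ) (ζ η : Cn n × Cn n) :
    H (c • ζ) η = c * H ζ η := by
  rw [hH.symm, hH.smul_right, hH.symm]

theorem four_mul_eq (hH : IsPolarForm H) (z w : Cn n) :
    4 * H (z, 0) (0, conjVec w) =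
      H (antidiag n z) (antidiag n w) +
        H (antidiag n (Complex.I • z)) (antidiag n (Complex.I • w)) +
        Complex.I * (H (antidiag n z) (antidiag n (Complex.I • w)) -
          H (antidiag n (Complex.I • z)) (antidiag n w)) := by
  have hsplit (z : Cn n) : antidiag n z = (z, 0) + (0, conjVec z) := by simp
  have hsplitI (z : Cn n) : antidiag n (Complex.I • z) =
      Complex.I • ((z, 0) : Cn n × Cn n) - Complex.I • ((0, conjVec z) : Cn n × Cn n) := by
    simp [conjVec_I_smul]
  rw [hsplitI, hsplitI, hsplit, hsplit]
  simp only [map_add, map_sub, add_apply, sub_apply, hH.smul_right, hH.smul_left]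
  ring_nf
  rw [Complex.I_sq]
  ring

theorem re_comm (hH : IsPolarForm H) (z w : Cn n) :
    (H (z, 0) (0, conjVec w)).re = (H (w, 0) (0, conjVec z)).re := by
  have hre (z w : Cn n) : 4 * (H (z, 0) (0, conjVec w)).re = (H (antidiag n z) (antidiag n w)).re +
      (H (antidiag n (Complex.I • z)) (antidiag n (Complex.I • w))).re := by
    simpa [-antidiag_apply, hH.real] using congrArg Complex.re (hH.four_mul_eq z w)
  have hwz := hre w z
  rw [hH.symm (antidiag n w), hH.symm (antidiag n (Complex.I • w))] at hwz
  linarith [hre z w]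

theorem re_homotopy (hH : IsPolarForm H) (z w : Cn n) (σ : ℝ) :
    (H (z + σ • w, 0) (0, conjVec (σ • w - z))).re =
      σ ^ 2 * (H (w, 0) (0, conjVec w)).re - (H (z, 0) (0, conjVec z)).re := by
  have hleft : ((z + σ • w, 0) : Cn n × Cn n) = (z, 0) + σ • (w, 0) := by simp
  have hright : ((0, conjVec (σ • w - z)) : Cn n × Cn n) =
      σ • (0, conjVec w) - (0, conjVec z) := by simp [conjVec_sub, conjVec_smul]
  rw [hleft, hright]
  simp only [map_add, map_sub, map_smul, add_apply, smul_apply,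
    Complex.add_re, Complex.sub_re, Complex.real_smul, Complex.re_ofReal_mul]
  rw [hH.re_comm z w]
  ring

theorem re_homotopy_le (hH : IsPolarForm H)
    (hpos : ∀ w : Cn n, 0 ≤ (H (w, 0) (0, conjVec w)).re) (z w : Cn n)
    {σ : ℝ} (hσ₀ : 0 ≤ σ) (hσ₁ : σ ≤ 1) :
    (H (z + σ • w, 0) (0, conjVec (σ • w - z))).re ≤ (H (z + w, 0) (0, conjVec (w - z))).re := by
  have hone := hH.re_homotopy z w 1
  rw [one_smul, one_pow] at hone
  rw [hH.re_homotopy, hone]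
  gcongr
  · exact hpos w
  · exact pow_le_one₀ hσ₀ hσ₁

end IsPolarForm

end PolarForm

section Hessian

open Filter Topology

variable {n : ℕ} {s C ρ : ℝ} {Φ : Cn n → ℝ} {U : Set (Cn n)} {Ψ : Cn n × Cn n → ℂ} {y : Cn n}

/-- The properties of a polarization `Ψ` of `Φ` on which the change of contour rests: `Ψ` is of
class `C²`, restricts to `Φ` on the anti-diagonal and is almost holomorphic there, with flatness
constant `C`. -/
structure IsFlatPolarization (s C : ℝ) (Φ : Cn n → ℝ) (U : Set (Cn n)) (ρ : ℝ)
    (Ψ : Cn n × Cn n → ℂ) : Prop where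
  contDiffOn : ContDiffOn ℝ 2 Ψ (tube U ρ)
  diag : ∀ x ∈ U, Ψ (x, conjVec x) = (Φ x : ℂ)
  flat : DbarFlat s C Ψ (tube U ρ)

theorem DbarFlat.antiPart_fderiv_fderiv_eq_zero {T : Set (Cn n × Cn n)} (hΨ : DbarFlat s C Ψ T)
    (hs : 1 < s) (hC : 0 < C) (hT : T ∈ 𝓝 (antidiag n y))
    (hd : DifferentiableAt ℝ (fderiv ℝ Ψ) (antidiag n y)) (ζ : Cn n × Cn n) :
    antiPart (fderiv ℝ (fderiv ℝ Ψ) (antidiag n y) ζ) = 0 := by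
  obtain ⟨M, hM, hflat⟩ := exists_flatWeight_le_sq hs hC
  have hO : (fun q => antiPart (fderiv ℝ Ψ q)) =O[𝓝 (antidiag n y)]
      fun q => ‖q - antidiag n y‖ ^ 2 := by
    refine Asymptotics.IsBigO.of_bound (2 * n * (M * 4)) ?_
    filter_upwards [hT] with q hq
    rw [norm_pow, norm_norm]
    calc ‖antiPart (fderiv ℝ Ψ q)‖ ≤ 2 * n * flatWeight s C ‖q.1 - conjVec q.2‖ :=
          hΨ.norm_antiPart_fderiv_le hC.le hq
      _ ≤ 2 * n * (M * ‖q.1 - conjVec q.2‖ ^ 2) := by gcongr; exact hflat _ (norm_nonneg _)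
      _ ≤ 2 * n * (M * (2 * ‖q - antidiag n y‖) ^ 2) := by gcongr; exact norm_sub_conjVec_le q y
      _ = 2 * n * (M * 4) * ‖q - antidiag n y‖ ^ 2 := by ring
  have hzero : HasFDerivAt (𝕜 := ℝ) (fun q => antiPart (fderiv ℝ Ψ q)) 0 (antidiag n y) :=
    hO.hasFDerivAt one_lt_two
  have hcomp := (LinearMap.toContinuousLinearMap
    ((antiPart (E := Cn n × Cn n)).restrictScalars ℝ)).hasFDerivAt.comp _ hd.hasFDerivAt
  exact congrArg (fun L : Cn n × Cn n →L[ℝ] (Cn n × Cn n →L[ℝ] ℂ) => L ζ) (hcomp.unique hzero)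

namespace IsFlatPolarization

theorem contDiffAt (hΨ : IsFlatPolarization s C Φ U ρ Ψ) (hU : IsOpen U) {p : Cn n × Cn n}
    (hp : p ∈ tube U ρ) : ContDiffAt ℝ 2 Ψ p :=
  hΨ.contDiffOn.contDiffAt ((isOpen_tube hU ρ).mem_nhds hp)

theorem differentiableAt_fderiv (hΨ : IsFlatPolarization s C Φ U ρ Ψ) (hU : IsOpen U)
    {p : Cn n × Cn n} (hp : p ∈ tube U ρ) : DifferentiableAt ℝ (fderiv ℝ Ψ) p :=
  ((hΨ.contDiffAt hU hp).fderiv_right (m := 1) (by norm_num)).differentiableAt (by norm_num)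

theorem fderiv_diag (hΨ : IsFlatPolarization s C Φ U ρ Ψ) (hU : IsOpen U) (hρ : 0 < ρ)
    (hy : y ∈ U) :
    fderiv ℝ (fun x => (Φ x : ℂ)) y = (fderiv ℝ Ψ (antidiag n y)).comp (antidiag n) := by
  have hcomp : HasFDerivAt (fun x => Ψ (antidiag n x))
      ((fderiv ℝ Ψ (antidiag n y)).comp (antidiag n)) y :=
    ((hΨ.contDiffAt hU (antidiag_mem_tube hρ hy)).differentiableAt
      (by norm_num)).hasFDerivAt.comp y (antidiag n).hasFDerivAt
  refine (hcomp.congr_of_eventuallyEq ?_).fderiv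
  filter_upwards [hU.mem_nhds hy] with x hx
  exact (hΨ.diag x hx).symm

theorem hasFDerivAt_fderiv_diag (hΨ : IsFlatPolarization s C Φ U ρ Ψ) (hU : IsOpen U)
    (hρ : 0 < ρ) (hy : y ∈ U) :
    HasFDerivAt (fderiv ℝ fun x => (Φ x : ℂ))
      (((ContinuousLinearMap.compL ℝ (Cn n) (Cn n × Cn n) ℂ).flip (antidiag n)).comp
        ((fderiv ℝ (fderiv ℝ Ψ) (antidiag n y)).comp (antidiag n))) y := by
  have hcomp : HasFDerivAt (fun x => fderiv ℝ Ψ (antidiag n x))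
      ((fderiv ℝ (fderiv ℝ Ψ) (antidiag n y)).comp (antidiag n)) y :=
    (hΨ.differentiableAt_fderiv hU (antidiag_mem_tube hρ hy)).hasFDerivAt.comp y
      (antidiag n).hasFDerivAt
  have hpull := ((ContinuousLinearMap.compL ℝ (Cn n) (Cn n × Cn n) ℂ).flip
    (antidiag n)).hasFDerivAt.comp y hcomp
  refine hpull.congr_of_eventuallyEq ?_
  filter_upwards [hU.mem_nhds hy] with x hx
  exact hΨ.fderiv_diag hU hρ hx

theorem fderiv_fderiv_diag_apply (hΨ : IsFlatPolarization s C Φ U ρ Ψ) (hU : IsOpen U)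
    (hρ : 0 < ρ) (hy : y ∈ U) (v w : Cn n) :
    fderiv ℝ (fderiv ℝ fun x => (Φ x : ℂ)) y v w =
      fderiv ℝ (fderiv ℝ Ψ) (antidiag n y) (antidiag n v) (antidiag n w) := by
  rw [(hΨ.hasFDerivAt_fderiv_diag hU hρ hy).fderiv]
  rfl

theorem isPolarForm (hΨ : IsFlatPolarization s C Φ U ρ Ψ) (hs : 1 < s) (hC : 0 < C)
    (hU : IsOpen U) (hρ : 0 < ρ) (hy : y ∈ U) :
    IsPolarForm (fderiv ℝ (fderiv ℝ Ψ) (antidiag n y)) where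
  smul_right c ζ η := by
    obtain ⟨L, hL⟩ :=
      exists_restrictScalars_add_antiPart (fderiv ℝ (fderiv ℝ Ψ) (antidiag n y) ζ)
    rw [hΨ.flat.antiPart_fderiv_fderiv_eq_zero hs hC
      ((isOpen_tube hU ρ).mem_nhds (antidiag_mem_tube hρ hy))
      (hΨ.differentiableAt_fderiv hU (antidiag_mem_tube hρ hy)), add_zero] at hL
    rw [hL]
    exact map_smul L c η
  symm := (hΨ.contDiffAt hU (antidiag_mem_tube hρ hy)).isSymmSndFDerivAt (by simp)
  real z w := by
    rw [← hΨ.fderiv_fderiv_diag_apply hU hρ hy]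
    exact im_fderiv_fderiv_ofReal_apply (hΨ.hasFDerivAt_fderiv_diag hU hρ hy).differentiableAt z w

theorem del_dbar_diag_eq (hΨ : IsFlatPolarization s C Φ U ρ Ψ) (hs : 1 < s) (hC : 0 < C)
    (hU : IsOpen U) (hρ : 0 < ρ) (hy : y ∈ U) (v w : Cn n) :
    del v (Complex.I • v) (dbar w (Complex.I • w) fun x => (Φ x : ℂ)) y =
      fderiv ℝ (fderiv ℝ Ψ) (antidiag n y) (v, 0) (0, conjVec w) := by
  rw [del_dbar_eq (hΨ.hasFDerivAt_fderiv_diag hU hρ hy).differentiableAt]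
  simp only [hΨ.fderiv_fderiv_diag_apply hU hρ hy]
  rw [← (hΨ.isPolarForm hs hC hU hρ hy).four_mul_eq]
  ring

theorem leviForm_eq (hΨ : IsFlatPolarization s C Φ U ρ Ψ) (hs : 1 < s) (hC : 0 < C)
    (hU : IsOpen U) (hρ : 0 < ρ) (hy : y ∈ U) (ξ : Cn n) :
    leviForm Φ y ξ = fderiv ℝ (fderiv ℝ Ψ) (antidiag n y) (ξ, 0) (0, conjVec ξ) := by
  have hH := hΨ.isPolarForm hs hC hU hρ hy
  have hconj (k : Fin n) : conjVec (reIm n (Sum.inl k)) = reIm n (Sum.inl k) := by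
    ext i
    simp only [conjVec_apply, reIm, Sum.elim_inl, PiLp.single_apply]
    split_ifs <;> simp
  have hfst : ((ξ, 0) : Cn n × Cn n) = ∑ j, ξ j • ((reIm n (Sum.inl j), 0) : Cn n × Cn n) := by
    simpa using eq_sum_smul_reIm ((ξ, 0) : Cn n × Cn n)
  have hsnd : ((0, conjVec ξ) : Cn n × Cn n) =
      ∑ k, (starRingEnd ℂ) (ξ k) • ((0, reIm n (Sum.inl k)) : Cn n × Cn n) := by
    simpa using eq_sum_smul_reIm ((0, conjVec ξ) : Cn n × Cn n)
  rw [hfst, hsnd, leviForm]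
  simp only [map_sum, sum_apply, hH.smul_left, hH.smul_right]
  rw [Finset.sum_comm]
  refine Finset.sum_congr rfl fun k _ => Finset.sum_congr rfl fun j _ => ?_
  rw [← I_smul_reIm_inl, ← I_smul_reIm_inl, hΨ.del_dbar_diag_eq hs hC hU hρ hy, hconj]
  ring

end IsFlatPolarization

end Hessian

section Contraction

variable {n : ℕ}

/-- The antilinear involution `(x, ỹ) ↦ (conj ỹ, conj x)`, whose fixed points are the
anti-diagonal and whose `-1`-eigenspace is the affine contour `{(z, -z̄)}`. -/
def swapConj (n : ℕ) : Cn n × Cn n →L[ℝ] Cn n × Cn n :=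
  ((conjIsometry n).toContinuousLinearMap.comp (ContinuousLinearMap.snd ℝ (Cn n) (Cn n))).prod
    ((conjIsometry n).toContinuousLinearMap.comp (ContinuousLinearMap.fst ℝ (Cn n) (Cn n)))

@[simp] theorem swapConj_apply (e : Cn n × Cn n) : swapConj n e = (conjVec e.2, conjVec e.1) := rfl

theorem norm_swapConj (e : Cn n × Cn n) : ‖swapConj n e‖ = ‖e‖ := by
  simp [Prod.norm_def, max_comm]

/-- The map `(z + w, conj (w - z)) ↦ (z + σ w, conj (σ w - z))`, which for `σ = 1` is the identity
and for `σ = 0` is the projection onto the affine contour `{(z, -z̄)}`. -/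
def contraction (σ : ℝ) : Cn n × Cn n →L[ℝ] Cn n × Cn n :=
  ((1 + σ) / 2) • ContinuousLinearMap.id ℝ (Cn n × Cn n) - ((1 - σ) / 2) • swapConj n

theorem contraction_apply (σ : ℝ) (e : Cn n × Cn n) :
    contraction σ e = ((1 + σ) / 2) • e - ((1 - σ) / 2) • swapConj n e := rfl

theorem contraction_one (e : Cn n × Cn n) : contraction 1 e = e := by
  rw [contraction_apply]
  norm_num

theorem contraction_add (z w : Cn n) (σ : ℝ) :
    contraction σ (z + w, conjVec (w - z)) = (z + σ • w, conjVec (σ • w - z)) := by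
  simp only [contraction_apply, swapConj_apply, conjVec_conjVec, conjVec_add, conjVec_sub,
    conjVec_smul]
  ext1
  · simp only [Prod.fst_sub, Prod.smul_fst]
    module
  · simp only [Prod.snd_sub, Prod.smul_snd]
    module

theorem exists_eq_add_conjVec_sub (e : Cn n × Cn n) : ∃ z w, e = (z + w, conjVec (w - z)) := by
  refine ⟨(1 / 2 : ℝ) • (e.1 - conjVec e.2), (1 / 2 : ℝ) • (e.1 + conjVec e.2), Prod.ext ?_ ?_⟩
  · dsimp only
    module
  · simp only [conjVec_sub, conjVec_smul, conjVec_add, conjVec_conjVec]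
    module

theorem norm_contraction_le (σ : ℝ) : ‖contraction (n := n) σ‖ ≤ max 1 |σ| := by
  refine ContinuousLinearMap.opNorm_le_bound _ (by positivity) fun e => ?_
  rw [contraction_apply]
  refine (norm_sub_le _ _).trans ?_
  rw [norm_smul, norm_smul, norm_swapConj, ← add_mul]
  gcongr
  rw [Real.norm_eq_abs, Real.norm_eq_abs]
  grind

theorem norm_contraction_apply_le {σ : ℝ} (hσ₀ : 0 ≤ σ) (hσ₁ : σ ≤ 1) (e : Cn n × Cn n) :
    ‖contraction σ e‖ ≤ ‖e‖ := by
  simpa [abs_of_nonneg hσ₀, hσ₁] using (contraction σ).le_of_opNorm_le (norm_contraction_le σ) e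

theorem IsPolarForm.re_contraction_le {H : Cn n × Cn n →L[ℝ] Cn n × Cn n →L[ℝ] ℂ}
    (hH : IsPolarForm H) (hpos : ∀ w : Cn n, 0 ≤ (H (w, 0) (0, conjVec w)).re) {σ : ℝ}
    (hσ₀ : 0 ≤ σ) (hσ₁ : σ ≤ 1) (e : Cn n × Cn n) :
    (H ((contraction σ e).1, 0) (0, (contraction σ e).2)).re ≤ (H (e.1, 0) (0, e.2)).re := by
  obtain ⟨z, w, rfl⟩ := exists_eq_add_conjVec_sub e
  rw [contraction_add]
  exact hH.re_homotopy_le hpos z w hσ₀ hσ₁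

end Contraction

section Phase

open Filter Topology Metric

variable {n : ℕ} {s C ρ : ℝ} {Φ : Cn n → ℝ} {U : Set (Cn n)} {Ψ : Cn n × Cn n → ℂ}

theorem mem_tube_of_norm_lt {ε : ℝ} {y : Cn n} (hy : ball y ε ⊆ U) (hε : ε ≤ ρ)
    {p : Cn n × Cn n} (hp : ‖p - antidiag n y‖ < ε) : p ∈ tube U ρ := by
  have hfst : ‖p.1 - y‖ < ε := (norm_fst_le (p - antidiag n y)).trans_lt hp
  have hsnd : ‖conjVec p.2 - y‖ < ε := by
    rw [← norm_conjVec, conjVec_sub, conjVec_conjVec]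
    exact (norm_snd_le (p - antidiag n y)).trans_lt hp
  rw [mem_tube_iff]
  constructor
  · apply hy
    have hsplit : (1 / 2 : ℝ) • (p.1 + conjVec p.2) - y =
        (1 / 2 : ℝ) • ((p.1 - y) + (conjVec p.2 - y)) := by module
    rw [mem_ball_iff_norm, hsplit, norm_smul, Real.norm_of_nonneg (by norm_num)]
    linarith [norm_add_le (p.1 - y) (conjVec p.2 - y)]
  · refine lt_of_lt_of_le ?_ hε
    have hsplit : p.1 - conjVec p.2 = (p.1 - y) - (conjVec p.2 - y) := by abel
    rw [hsplit, norm_smul, Real.norm_of_nonneg (by norm_num)]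
    linarith [norm_sub_le (p.1 - y) (conjVec p.2 - y)]

theorem exists_abs_re_phase_sub_le (hΨ : IsFlatPolarization s C Φ U ρ Ψ) (hU : IsOpen U)
    (hρ : 0 < ρ) {y₀ : Cn n} (hy₀ : y₀ ∈ U) {c : ℝ} (hc : 0 < c) :
    ∃ ε > 0, ∀ᶠ y in 𝓝 y₀, ∀ e : Cn n × Cn n, ‖e‖ < ε →
      |(phase Ψ (antidiag n y) (antidiag n y + e)).re -
        (fderiv ℝ (fderiv ℝ Ψ) (antidiag n y) (e.1, 0) (0, e.2)).re| ≤ c * ‖e‖ ^ 2 := by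
  obtain ⟨R, hR, hmixed⟩ :=
    exists_norm_mixed_difference_sub_le (hΨ.contDiffAt hU (antidiag_mem_tube hρ hy₀)) hc
  refine ⟨R / 2, half_pos hR, ?_⟩
  filter_upwards [ball_mem_nhds y₀ (half_pos hR)] with y hy e he
  have hy' : dist (conjVec y) (conjVec y₀) = dist y y₀ := (conjIsometry n).dist_map y y₀
  have hfst := norm_fst_le e
  have hsnd := norm_snd_le e
  have hadd {b b₀ u : Cn n} (hb : dist b b₀ = dist y y₀) (hu : ‖u‖ ≤ ‖e‖) : b + u ∈ ball b₀ R := by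
    have hbu : dist (b + u) b = ‖u‖ := by simp
    rw [mem_ball] at hy ⊢
    linarith [dist_triangle (b + u) b b₀]
  have hbound := hmixed y (by simpa using hadd rfl (norm_zero.trans_le (norm_nonneg e)))
    (y + e.1) (hadd rfl hfst)
    (conjVec y) (by simpa using hadd hy' (norm_zero.trans_le (norm_nonneg e)))
    (conjVec y + e.2) (hadd hy' hsnd)
  simp only [add_sub_cancel_left] at hbound
  rw [← Complex.sub_re]
  refine (Complex.abs_re_le_norm _).trans (hbound.trans ?_)
  rw [mul_assoc, sq]
  gcongr

theorem sq_norm_le_add_sq (e : Cn n × Cn n) : ‖e‖ ^ 2 ≤ ‖e.1‖ ^ 2 + ‖e.2‖ ^ 2 := by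
  rw [Prod.norm_def]
  rcases max_choice ‖e.1‖ ‖e.2‖ with h | h <;> rw [h] <;>
    linarith [sq_nonneg ‖e.1‖, sq_nonneg ‖e.2‖]

theorem exists_phase_contraction_le (hΨ : IsFlatPolarization s C Φ U ρ Ψ) (hs : 1 < s)
    (hC : 0 < C) (hU : IsOpen U) (hρ : 0 < ρ) (hlevi : ∀ y ∈ U, ∀ ξ, 0 ≤ (leviForm Φ y ξ).re)
    {K : ℝ} (hK : 0 < K) {y₀ : Cn n} (hy₀ : y₀ ∈ U) :
    ∃ ε > 0, ∀ᶠ y in 𝓝 y₀, ∀ e : Cn n × Cn n, ‖e‖ < ε →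
      (phase Ψ (antidiag n y) (antidiag n y + e)).re ≤ -(K⁻¹ * (‖e.1‖ ^ 2 + ‖e.2‖ ^ 2)) →
      ∀ σ, 0 ≤ σ → σ ≤ 1 →
        (phase Ψ (antidiag n y) (antidiag n y + contraction σ e)).re ≤
          -((2 * K)⁻¹ * ‖e‖ ^ 2) := by
  obtain ⟨ε, hε, htaylor⟩ :=
    exists_abs_re_phase_sub_le hΨ hU hρ hy₀ (c := (4 * K)⁻¹) (by positivity)
  refine ⟨ε, hε, ?_⟩
  filter_upwards [htaylor, hU.mem_nhds hy₀] with y hy hyU e he hgood σ hσ₀ hσ₁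
  have hnorm := norm_contraction_apply_le hσ₀ hσ₁ e
  have hstart := (abs_le.1 (hy e he)).1
  have hend := (abs_le.1 (hy _ (hnorm.trans_lt he))).2
  have hhess := (hΨ.isPolarForm hs hC hU hρ hyU).re_contraction_le
    (fun w => by rw [← hΨ.leviForm_eq hs hC hU hρ hyU]; exact hlevi y hyU w) hσ₀ hσ₁ e
  have hsq : (4 * K)⁻¹ * ‖contraction σ e‖ ^ 2 ≤ (4 * K)⁻¹ * ‖e‖ ^ 2 := by gcongr
  have hgauss : K⁻¹ * ‖e‖ ^ 2 ≤ K⁻¹ * (‖e.1‖ ^ 2 + ‖e.2‖ ^ 2) := by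
    gcongr
    exact sq_norm_le_add_sq e
  have hquarter : (4 * K)⁻¹ = K⁻¹ / 4 := by field_simp
  have hhalf : (2 * K)⁻¹ = K⁻¹ / 2 := by field_simp
  rw [hquarter] at hstart hend hsq
  rw [hhalf]
  linarith

end Phase

section Integrand

variable {n : ℕ} {s C A h : ℝ} {T : Set (Cn n × Cn n)} {Ψ b : Cn n × Cn n → ℂ} {y : Cn n}
  {p : Cn n × Cn n}

/-- An amplitude at a fixed value of `h`, reduced to what the change of contour uses: it is of
class `C¹`, bounded by `A`, and almost holomorphic along the anti-diagonal with flatness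
constant `C`. -/
structure IsFlatSymbol (s C A : ℝ) (T : Set (Cn n × Cn n)) (b : Cn n × Cn n → ℂ) : Prop where
  contDiffOn : ContDiffOn ℝ 1 b T
  norm_le : ∀ p ∈ T, ‖b p‖ ≤ A
  flat : DbarFlat s C b T

/-- The points at which the phase based at `(y, ȳ)` is defined. -/
def phaseDomain (T : Set (Cn n × Cn n)) (y : Cn n) : Set (Cn n × Cn n) :=
  {p | p ∈ T ∧ (p.1, conjVec y) ∈ T ∧ (y, p.2) ∈ T}

theorem isOpen_phaseDomain (hT : IsOpen T) (y : Cn n) : IsOpen (phaseDomain T y) :=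
  hT.inter ((hT.preimage (by fun_prop : Continuous fun p : Cn n × Cn n => (p.1, conjVec y))).inter
    (hT.preimage (by fun_prop : Continuous fun p : Cn n × Cn n => (y, p.2))))

theorem mem_phaseDomain_of_norm_lt {U : Set (Cn n)} {ρ ε : ℝ} (hy : Metric.ball y ε ⊆ U)
    (hε : ε ≤ ρ) (hp : ‖p - antidiag n y‖ < ε) : p ∈ phaseDomain (tube U ρ) y := by
  refine ⟨mem_tube_of_norm_lt hy hε hp, mem_tube_of_norm_lt hy hε ?_,
    mem_tube_of_norm_lt hy hε ?_⟩
  · simpa using (norm_fst_le (p - antidiag n y)).trans_lt hp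
  · simpa using (norm_snd_le (p - antidiag n y)).trans_lt hp

theorem contDiffOn_phase (hΨ : ContDiffOn ℝ 1 Ψ T) (y : Cn n) :
    ContDiffOn ℝ 1 (phase Ψ (antidiag n y)) (phaseDomain T y) := by
  have hboth : ContDiffOn ℝ 1 (fun p : Cn n × Cn n => Ψ (p.1, p.2)) (phaseDomain T y) :=
    hΨ.mono fun p hp => hp.1
  have hfst : ContDiffOn ℝ 1 (fun p : Cn n × Cn n => Ψ (p.1, conjVec y)) (phaseDomain T y) :=
    hΨ.comp (by fun_prop) fun p hp => hp.2.1
  have hsnd : ContDiffOn ℝ 1 (fun p : Cn n × Cn n => Ψ (y, p.2)) (phaseDomain T y) :=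
    hΨ.comp (by fun_prop) fun p hp => hp.2.2
  exact ((hboth.sub hfst).sub hsnd).add contDiffOn_const

theorem DbarFlat.norm_antiPart_fderiv_le_flatWeight (hf : DbarFlat s C b T) (hs : 1 ≤ s)
    (hC : 0 ≤ C) {d : ℝ} (hp : p ∈ T) (hd : ‖p - antidiag n y‖ ≤ d) :
    ‖antiPart (fderiv ℝ b p)‖ ≤ 2 * n * flatWeight s C (2 * d) := by
  refine (hf.norm_antiPart_fderiv_le hC hp).trans ?_
  gcongr
  exact flatWeight_mono hs hC (norm_nonneg _) ((norm_sub_conjVec_le p y).trans (by gcongr))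

theorem hasFDerivAt_phase (hT : IsOpen T) (hΨ : ContDiffOn ℝ 1 Ψ T) (hp : p ∈ phaseDomain T y) :
    HasFDerivAt (phase Ψ (antidiag n y))
      (fderiv ℝ Ψ p -
        (fderiv ℝ Ψ (p.1, conjVec y)).comp (((ContinuousLinearMap.inl ℂ (Cn n) (Cn n)).comp
          (ContinuousLinearMap.fst ℂ (Cn n) (Cn n))).restrictScalars ℝ) -
        (fderiv ℝ Ψ (y, p.2)).comp (((ContinuousLinearMap.inr ℂ (Cn n) (Cn n)).comp
          (ContinuousLinearMap.snd ℂ (Cn n) (Cn n))).restrictScalars ℝ)) p := by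
  have hΨat : ∀ q ∈ T, HasFDerivAt Ψ (fderiv ℝ Ψ q) q := fun q hq =>
    ((hΨ.contDiffAt (hT.mem_nhds hq)).differentiableAt one_ne_zero).hasFDerivAt
  have hfst : HasFDerivAt (fun q : Cn n × Cn n => Ψ (q.1, conjVec y)) _ p :=
    HasFDerivAt.comp (f := fun q : Cn n × Cn n => (q.1, conjVec y)) p (hΨat _ hp.2.1)
      (hasFDerivAt_fst.prodMk (hasFDerivAt_const _ _))
  have hsnd : HasFDerivAt (fun q : Cn n × Cn n => Ψ (y, q.2)) _ p :=
    HasFDerivAt.comp (f := fun q : Cn n × Cn n => (y, q.2)) p (hΨat _ hp.2.2)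
      ((hasFDerivAt_const _ _).prodMk hasFDerivAt_snd)
  exact (((hΨat p hp.1).sub hfst).sub hsnd).add_const _

theorem norm_antiPart_comp_le {E E' : Type*} [NormedAddCommGroup E] [NormedSpace ℝ E]
    [NormedSpace ℂ E] [IsScalarTower ℝ ℂ E] [NormedAddCommGroup E'] [NormedSpace ℝ E']
    [NormedSpace ℂ E'] [IsScalarTower ℝ ℂ E'] (L : E →L[ℝ] ℂ) {P : E' →L[ℂ] E} (hP : ‖P‖ ≤ 1) :
    ‖antiPart (L.comp (P.restrictScalars ℝ))‖ ≤ ‖antiPart L‖ := by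
  rw [antiPart_comp_restrictScalars]
  exact (ContinuousLinearMap.opNorm_comp_le _ _).trans
    (mul_le_of_le_one_right (norm_nonneg _) (by rwa [ContinuousLinearMap.norm_restrictScalars]))

theorem norm_antiPart_phase_le (hs : 1 ≤ s) (hC : 0 ≤ C) (hT : IsOpen T)
    (hΨ : ContDiffOn ℝ 1 Ψ T) (hf : DbarFlat s C Ψ T) (hp : p ∈ phaseDomain T y) :
    ‖antiPart (fderiv ℝ (phase Ψ (antidiag n y)) p)‖ ≤
      6 * n * flatWeight s C (2 * ‖p - antidiag n y‖) := by
  have hboth := hf.norm_antiPart_fderiv_le_flatWeight hs hC (y := y) hp.1 le_rfl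
  have hfst := hf.norm_antiPart_fderiv_le_flatWeight hs hC (y := y) hp.2.1
    (d := ‖p - antidiag n y‖) (by simpa using norm_fst_le (p - antidiag n y))
  have hsnd := hf.norm_antiPart_fderiv_le_flatWeight hs hC (y := y) hp.2.2
    (d := ‖p - antidiag n y‖) (by simpa using norm_snd_le (p - antidiag n y))
  rw [(hasFDerivAt_phase hT hΨ hp).fderiv, map_sub, map_sub]
  have hinl := norm_antiPart_comp_le (fderiv ℝ Ψ (p.1, conjVec y)) (P :=
    (ContinuousLinearMap.inl ℂ (Cn n) (Cn n)).comp (ContinuousLinearMap.fst ℂ (Cn n) (Cn n)))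
    ((ContinuousLinearMap.opNorm_comp_le _ _).trans (mul_le_one₀
      (ContinuousLinearMap.norm_inl_le_one ..) (norm_nonneg _)
      (ContinuousLinearMap.norm_fst_le ..)))
  have hinr := norm_antiPart_comp_le (fderiv ℝ Ψ (y, p.2)) (P :=
    (ContinuousLinearMap.inr ℂ (Cn n) (Cn n)).comp (ContinuousLinearMap.snd ℂ (Cn n) (Cn n)))
    ((ContinuousLinearMap.opNorm_comp_le _ _).trans (mul_le_one₀
      (ContinuousLinearMap.norm_inr_le_one ..) (norm_nonneg _)
      (ContinuousLinearMap.norm_snd_le ..)))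
  refine (norm_sub_le_of_le (norm_sub_le_of_le hboth (hinl.trans hfst)) (hinr.trans hsnd)).trans_eq
    ?_
  ring

/-- The integrand `(2ih)^{-n} e^{2φ(y, ȳ; p)/h} b(p)`. -/
def integrand (Ψ b : Cn n × Cn n → ℂ) (y : Cn n) (h : ℝ) (p : Cn n × Cn n) : ℂ :=
  1 / (2 * Complex.I * (h : ℂ)) ^ n *
    (Complex.exp (2 / (h : ℂ) * phase Ψ (antidiag n y) p) * b p)

theorem contDiffOn_integrand (hΨ : ContDiffOn ℝ 1 Ψ T) (hb : ContDiffOn ℝ 1 b T) (y : Cn n)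
    (h : ℝ) : ContDiffOn ℝ 1 (integrand Ψ b y h) (phaseDomain T y) :=
  contDiffOn_const.mul
    ((contDiffOn_const.mul (contDiffOn_phase hΨ y)).cexp.mul (hb.mono fun _ hp => hp.1))

theorem norm_exp_phase (Ψ : Cn n × Cn n → ℂ) (y : Cn n) (h : ℝ) (p : Cn n × Cn n) :
    ‖Complex.exp (2 / (h : ℂ) * phase Ψ (antidiag n y) p)‖ =
      Real.exp (2 / h * (phase Ψ (antidiag n y) p).re) := by
  rw [Complex.norm_exp, ← Complex.re_ofReal_mul]
  push_cast
  rfl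

theorem norm_prefactor_le (n : ℕ) (hh : 0 < h) :
    ‖(1 / (2 * Complex.I * (h : ℂ)) ^ n : ℂ)‖ ≤ h⁻¹ ^ n := by
  rw [norm_div, norm_pow, norm_one, one_div, ← inv_pow]
  gcongr
  simp only [norm_mul, Complex.norm_I, Complex.norm_real, Complex.norm_ofNat,
    Real.norm_of_nonneg hh.le]
  linarith

theorem norm_integrand_le (hb : ∀ p ∈ T, ‖b p‖ ≤ A) (hh : 0 < h) (hp : p ∈ T) :
    ‖integrand Ψ b y h p‖ ≤
      h⁻¹ ^ n * (Real.exp (2 / h * (phase Ψ (antidiag n y) p).re) * A) := by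
  rw [integrand, norm_mul, norm_mul, norm_exp_phase]
  gcongr
  exacts [norm_prefactor_le n hh, hb p hp]

theorem norm_antiPart_integrand_le (hs : 1 ≤ s) (hC : 0 ≤ C) (hT : IsOpen T)
    (hΨ : ContDiffOn ℝ 1 Ψ T) (hf : DbarFlat s C Ψ T) (hb : IsFlatSymbol s C A T b)
    (hp : p ∈ phaseDomain T y) (hh : 0 < h) :
    ‖antiPart (fderiv ℝ (integrand Ψ b y h) p)‖ ≤
      h⁻¹ ^ n * (Real.exp (2 / h * (phase Ψ (antidiag n y) p).re) *
        ((12 * n * A * h⁻¹ + 2 * n) * flatWeight s C (2 * ‖p - antidiag n y‖))) := by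
  have hφ := (((contDiffOn_phase hΨ y).contDiffAt
    ((isOpen_phaseDomain hT y).mem_nhds hp)).differentiableAt one_ne_zero).hasFDerivAt
  have hb' := ((hb.contDiffOn.contDiffAt (hT.mem_nhds hp.1)).differentiableAt
    one_ne_zero).hasFDerivAt
  have hder : fderiv ℝ (integrand Ψ b y h) p = _ :=
    ((((hφ.const_mul (2 / (h : ℂ))).cexp).mul hb').const_mul _).fderiv
  rw [hder, ← norm_exp_phase]
  set w := Complex.exp (2 / (h : ℂ) * phase Ψ (antidiag n y) p)
  simp only [map_smul, map_add, norm_smul]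
  have hphase := norm_antiPart_phase_le hs hC hT hΨ hf hp
  have hsymbol := hb.flat.norm_antiPart_fderiv_le_flatWeight hs hC (y := y) hp.1 le_rfl
  have hA := hb.norm_le p hp.1
  have hA₀ : 0 ≤ A := (norm_nonneg _).trans hA
  have htwo : ‖(2 / (h : ℂ))‖ = 2 * h⁻¹ := by
    simp [abs_of_pos hh, div_eq_mul_inv]
  set d := ‖p - antidiag n y‖
  refine mul_le_mul (norm_prefactor_le n hh) ?_ (norm_nonneg _) (by positivity)
  calc _ ≤ ‖w‖ * ‖antiPart (fderiv ℝ b p)‖ + ‖b p‖ * (‖w‖ * (‖(2 / (h : ℂ))‖ *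
        ‖antiPart (fderiv ℝ (phase Ψ (antidiag n y)) p)‖)) := by
        refine (norm_add_le _ _).trans_eq ?_
        simp only [norm_smul]
    _ ≤ ‖w‖ * (2 * n * flatWeight s C (2 * d)) +
        A * (‖w‖ * (2 * h⁻¹ * (6 * n * flatWeight s C (2 * d)))) := by
        rw [htwo]
        gcongr
    _ = _ := by ring

/-- The exponential rate produced by a Gaussian of strength `K⁻¹` and a flat weight with
constant `C`. -/
def rate (s K C : ℝ) : ℝ := min K⁻¹ (C⁻¹ * 2 ^ (-(1 / (s - 1))))

theorem rate_pos {K : ℝ} (hK : 0 < K) (hC : 0 < C) : 0 < rate s K C :=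
  lt_min (by positivity) (by positivity)

theorem exp_mul_flatWeight_le {K d x : ℝ} (hs : 1 < s) (hK : 0 < K) (hC : 0 < C) (hd : 0 ≤ d)
    (hh : 0 < h) (hx : x ≤ -((2 * K)⁻¹ * d ^ 2)) :
    Real.exp (2 / h * x) * flatWeight s C (2 * d) ≤ C * gevreyDecay s (rate s K C) h := by
  rcases hd.eq_or_lt with rfl | hd
  · rw [mul_zero, flatWeight_zero, mul_zero]
    exact mul_nonneg hC.le gevreyDecay_pos.le
  have hgauss : 2 / h * x ≤ -(K⁻¹ * (d ^ 2 / h)) :=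
    calc 2 / h * x ≤ 2 / h * -((2 * K)⁻¹ * d ^ 2) := by gcongr
      _ = -(K⁻¹ * (d ^ 2 / h)) := by field_simp
  have hmin := min_mul_rpow_neg_le_gaussian_add_flat (A := K⁻¹)
    (B := C⁻¹ * 2 ^ (-(1 / (s - 1)))) hs (by positivity) (by positivity) hd hh
  rw [flatWeight, if_neg (by positivity), mul_left_comm, ← Real.exp_add,
    Real.mul_rpow (by norm_num) hd.le, ← mul_assoc C⁻¹, gevreyDecay, rate]
  gcongr
  linarith

end Integrand

section Coordinates

open Module

variable {n : ℕ}

/-- The form `dx_1 ∧ … ∧ dx_n ∧ dỹ_1 ∧ … ∧ dỹ_n` on `ℂⁿ × ℂⁿ`. -/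
def volumeForm (n : ℕ) : (Cn n × Cn n) [⋀^Fin (n + n)]→L[ℂ] ℂ :=
  let coord : Cn n × Cn n →ₗ[ℂ] Fin n ⊕ Fin n → ℂ :=
    { toFun ζ := Sum.elim ζ.1 ζ.2
      map_add' ζ η := by ext i; cases i <;> rfl
      map_smul' c ζ := by ext i; cases i <;> rfl }
  { (Matrix.detRowAlternating.compLinearMap coord).domDomCongr finSumFinEquiv with
    cont := by
      refine Continuous.matrix_det (continuous_matrix fun k i => ?_)
      have hcoord : Continuous coord := coord.continuous_of_finiteDimensional
      exact (continuous_apply i).comp (hcoord.comp (continuous_apply _)) }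

theorem volumeForm_apply (v : Fin n ⊕ Fin n → Cn n × Cn n) :
    volumeForm n (v ∘ finSumFinEquiv.symm) =
      (Matrix.of fun i k => Sum.elim (v k).1 (v k).2 i).det := by
  rw [← Matrix.det_transpose]
  change Matrix.det _ = _
  congr 1
  ext i k
  simp only [Function.comp_apply, Equiv.symm_apply_apply]
  rfl

theorem finrank_cn_prod_cn : finrank ℂ (Cn n × Cn n) = n + n := by
  rw [finrank_prod, finrank_euclideanSpace_fin]

/-- The coordinate frame of `ℝ²ⁿ`, real parts first. -/
def stdFrame (n : ℕ) (k : Fin (n + n)) : R2n n :=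
  EuclideanSpace.single (finSumFinEquiv.symm k) 1

theorem norm_stdFrame (k : Fin (n + n)) : ‖stdFrame n k‖ = 1 := by
  simp [stdFrame]

theorem Contour.jac_eq_volumeForm (Γ : Contour n) (y : Cn n) (t : R2n n) :
    Γ.jac y t = volumeForm n fun k => fderiv ℝ (Γ.map y) t (stdFrame n k) :=
  (volumeForm_apply (Γ.partial y t)).symm

/-- The identification `ℂⁿ = ℝ²ⁿ`. -/
def realCoord (n : ℕ) : Cn n ≃ₗᵢ[ℝ] R2n n where
  toFun q := WithLp.toLp 2 (Sum.elim (fun j => (q j).re) (fun j => (q j).im))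
  invFun t := WithLp.toLp 2 fun j => ⟨t (Sum.inl j), t (Sum.inr j)⟩
  map_add' p q := by ext i; cases i <;> simp
  map_smul' c q := by ext i; cases i <;> simp
  left_inv _ := rfl
  right_inv t := by ext i; cases i <;> rfl
  norm_map' q := by
    change ‖(WithLp.toLp 2 (Sum.elim (fun j => (q j).re) (fun j => (q j).im)) : R2n n)‖ = ‖q‖
    rw [EuclideanSpace.norm_eq, EuclideanSpace.norm_eq, Fintype.sum_sum_type,
      ← Finset.sum_add_distrib]
    congr! with j
    rw [Complex.sq_norm, Complex.normSq_apply, Real.norm_eq_abs, Real.norm_eq_abs, sq_abs, sq_abs]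
    simp only [Sum.elim_inl, Sum.elim_inr]
    ring

theorem realCoord_symm_apply (t : R2n n) (j : Fin n) :
    (realCoord n).symm t j = t (Sum.inl j) + t (Sum.inr j) * Complex.I :=
  Complex.mk_eq_add_mul_I _ _

/-- The map `(x, ỹ) ↦ x - conj ỹ` in real coordinates; it vanishes on the anti-diagonal, and its
restriction to the affine contour `z ↦ (z, -z̄)` is `2z`. -/
def offset (n : ℕ) : Cn n × Cn n →L[ℝ] R2n n :=
  (realCoord n).toContinuousLinearEquiv.toContinuousLinearMap.comp
    (ContinuousLinearMap.fst ℝ (Cn n) (Cn n) -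
      (conjIsometry n).toContinuousLinearMap.comp (ContinuousLinearMap.snd ℝ (Cn n) (Cn n)))

theorem offset_apply (e : Cn n × Cn n) : offset n e = realCoord n (e.1 - conjVec e.2) := rfl

theorem norm_offset_le (e : Cn n × Cn n) : ‖offset n e‖ ≤ 2 * ‖e‖ := by
  rw [offset_apply, LinearIsometryEquiv.norm_map]
  refine (norm_sub_le _ _).trans ?_
  rw [norm_conjVec]
  linarith [norm_fst_le e, norm_snd_le e]

/-- The affine contour `(z, -z̄)`, parametrized by the real coordinates of its `offset` `2z`. -/
def affineContour (n : ℕ) (u : R2n n) : Cn n × Cn n :=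
  (1 / 2 : ℝ) • ((realCoord n).symm u, -conjVec ((realCoord n).symm u))

theorem affineContour_offset (e : Cn n × Cn n) :
    affineContour n (offset n e) = contraction 0 e := by
  rw [affineContour, offset_apply, LinearIsometryEquiv.symm_apply_apply, contraction_apply,
    conjVec_sub, conjVec_conjVec, neg_sub, add_zero, sub_zero, swapConj_apply, ← smul_sub]
  rfl

/-- The Jacobian matrix of `affineContour`. -/
def affineMatrix (n : ℕ) : Matrix (Fin n ⊕ Fin n) (Fin n ⊕ Fin n) ℂ :=
  Matrix.fromBlocks (Matrix.diagonal fun _ => 1 / 2) (Matrix.diagonal fun _ => Complex.I / 2)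
    (Matrix.diagonal fun _ => -1 / 2) (Matrix.diagonal fun _ => Complex.I / 2)

theorem affineContour_apply (u : R2n n) (i : Fin n ⊕ Fin n) :
    Sum.elim (affineContour n u).1 (affineContour n u).2 i =
      ∑ k, affineMatrix n i k * (u k : ℂ) := by
  rw [Fintype.sum_sum_type]
  rcases i with j | j <;>
    simp [affineContour, affineMatrix, realCoord_symm_apply, Matrix.diagonal_apply]
      <;> ring

theorem det_comp_eq_det_matrix (A : Cn n × Cn n →L[ℝ] R2n n) (L : R2n n →L[ℝ] Cn n × Cn n) :
    (A.comp L).det =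
      (Matrix.of fun i k => A (L (EuclideanSpace.single k 1)) i).det := by
  rw [ContinuousLinearMap.det, ← LinearMap.det_toMatrix
    (EuclideanSpace.basisFun (Fin n ⊕ Fin n) ℝ).toBasis]
  congr 1

theorem Contour.det_orientMatrix (Γ : Contour n) (y : Cn n) :
    (Γ.orientMatrix y).det = ((offset n).comp (fderiv ℝ (Γ.map y) 0)).det := by
  rw [det_comp_eq_det_matrix]
  congr 1

theorem volumeForm_contraction_zero (L : R2n n →L[ℝ] Cn n × Cn n) :
    volumeForm n (fun k => contraction 0 (L (stdFrame n k))) =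
      (affineMatrix n).det * (((offset n).comp L).det : ℝ) := by
  have hcast (M : Matrix (Fin n ⊕ Fin n) (Fin n ⊕ Fin n) ℝ) :
      ((M.det : ℝ) : ℂ) = (M.map Complex.ofReal).det := RingHom.map_det Complex.ofRealHom M
  rw [det_comp_eq_det_matrix, hcast, ← Matrix.det_mul]
  refine (volumeForm_apply fun k => contraction 0 (L (EuclideanSpace.single k 1))).trans ?_
  congr 1
  ext i k
  rw [Matrix.of_apply, ← affineContour_offset, affineContour_apply, Matrix.mul_apply]
  rfl

end Coordinates

section InverseFunction

open Filter Topology Set Metric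
open scoped NNReal

variable {E F Y : Type*} [NormedAddCommGroup E] [NormedSpace ℝ E] [NormedAddCommGroup F]
  [NormedSpace ℝ F]

theorem exists_eventually_approximatesLinearOn [TopologicalSpace Y] {f : Y → E → F}
    {f' : Y → E → E →L[ℝ] F} {y₀ : Y}
    (hder : ∀ᶠ p : Y × E in 𝓝 (y₀, 0), HasFDerivAt (f p.1) (f' p.1 p.2) p.2)
    (hcont : ContinuousAt (fun p : Y × E => f' p.1 p.2) (y₀, 0)) {c : ℝ≥0} (hc : 0 < c) :
    ∃ r > 0, ∀ᶠ y in 𝓝 y₀, ApproximatesLinearOn (f y) (f' y₀ 0) (ball 0 r) c := by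
  have hclose : ∀ᶠ p : Y × E in 𝓝 (y₀, 0), ‖f' p.1 p.2 - f' y₀ 0‖ < c :=
    (hcont.sub continuousAt_const).norm.eventually_lt continuousAt_const (by simpa using hc)
  have hboth := hder.and hclose
  rw [nhds_prod_eq] at hboth
  obtain ⟨P, hP, Q, hQ, hPQ⟩ := eventually_prod_iff.1 hboth
  obtain ⟨r, hr, hball⟩ := Metric.eventually_nhds_iff_ball.1 hQ
  refine ⟨r, hr, hP.mono fun y hy x hx x' hx' => ?_⟩
  exact Convex.norm_image_sub_le_of_norm_hasFDerivWithin_le'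
    (fun t ht => (hPQ hy (hball t ht)).1.hasFDerivWithinAt)
    (fun t ht => (hPQ hy (hball t ht)).2.le) (convex_ball 0 r) hx' hx

theorem exists_injOn_and_closedBall_subset_image [CompleteSpace E] (A : E ≃L[ℝ] F) :
    ∃ c : ℝ≥0, 0 < c ∧ ∃ m : ℝ, 0 < m ∧ ∀ (f : E → F) (r₀ : ℝ),
      ApproximatesLinearOn f (A : E →L[ℝ] F) (ball 0 r₀) c →
        InjOn f (ball 0 r₀) ∧
          ∀ r, 0 < r → r < r₀ → closedBall (f 0) (m * r) ⊆ f '' closedBall 0 r := by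
  -- The `+ 1` keeps the radii positive when `E` is trivial.
  set N : ℝ≥0 := ‖(A.symm : F →L[ℝ] E)‖₊ + 1 with hN
  refine ⟨N⁻¹ / 2, by positivity, (N : ℝ)⁻¹ / 2, by positivity, fun f r₀ hf => ⟨?_, ?_⟩⟩
  · refine hf.injOn ?_
    rcases subsingleton_or_nontrivial E with hE | hE
    · exact .inl hE
    refine .inr ?_
    have hpos : 0 < ‖(A.symm : F →L[ℝ] E)‖₊ := A.nnnorm_symm_pos
    calc N⁻¹ / 2 < N⁻¹ := NNReal.half_lt_self (by positivity)
      _ ≤ ‖(A.symm : F →L[ℝ] E)‖₊⁻¹ := by gcongr; exact le_self_add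
  · intro r hr hrr₀
    let B : (A : E →L[ℝ] F).NonlinearRightInverse :=
      { toFun := A.symm
        nnnorm := N
        bound' := fun v => ((A.symm : F →L[ℝ] E).le_opNorm v).trans (by
          gcongr
          simp [hN])
        right_inv' := A.apply_symm_apply }
    have hsurj := hf.surjOn_closedBall_of_nonlinearRightInverse B hr.le
      (closedBall_subset_ball hrr₀)
    have hradius : ((B.nnnorm : ℝ)⁻¹ - (N⁻¹ / 2 : ℝ≥0)) * r = (N : ℝ)⁻¹ / 2 * r := by
      change ((N : ℝ)⁻¹ - _) * r = _
      push_cast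
      ring
    rwa [hradius] at hsurj

end InverseFunction

section ContourIntegral

open MeasureTheory Set Metric

variable {n : ℕ}

/-- The homotopy `σ ↦ c + contraction σ (g - c)` between a contour `g` centred at `c` (at `σ = 1`)
and its projection to the affine contour through `c` (at `σ = 0`). -/
def contractionHomotopy {X : Type*} (g : X → Cn n × Cn n) (c : Cn n × Cn n) (p : ℝ × X) :
    Cn n × Cn n :=
  c + contraction p.1 (g p.2 - c)

theorem contraction_eq_add_smul (σ : ℝ) (e : Cn n × Cn n) :
    contraction σ e = contraction 0 e + σ • (1 / 2 : ℝ) • (e + swapConj n e) := by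
  simp only [contraction_apply]
  module

theorem contractionHomotopy_eq_add_smul {X : Type*} (g : X → Cn n × Cn n) (c : Cn n × Cn n) :
    contractionHomotopy g c = fun p : ℝ × X =>
      c + (contraction 0 (g p.2 - c) + p.1 • (1 / 2 : ℝ) • (g p.2 - c + swapConj n (g p.2 - c))) :=
  funext fun _ => congrArg (c + ·) (contraction_eq_add_smul _ _)

section

variable {X : Type*} [NormedAddCommGroup X] [NormedSpace ℝ X] {g : X → Cn n × Cn n}
  {c : Cn n × Cn n} {σ : ℝ} {t : X}

theorem contDiffAt_contractionHomotopy {k : WithTop ℕ∞} (hg : ContDiffAt ℝ k g t) :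
    ContDiffAt ℝ k (contractionHomotopy g c) (σ, t) := by
  have _he : ContDiffAt ℝ k (fun p : ℝ × X => g p.2 - c) (σ, t) :=
    (hg.comp (σ, t) contDiffAt_snd).sub contDiffAt_const
  rw [contractionHomotopy_eq_add_smul]
  fun_prop

theorem hasFDerivAt_contractionHomotopy {g' : X →L[ℝ] Cn n × Cn n} (hg : HasFDerivAt g g' t) :
    HasFDerivAt (contractionHomotopy g c)
      (((contraction σ).comp g').comp (ContinuousLinearMap.snd ℝ ℝ X) +
        (ContinuousLinearMap.fst ℝ ℝ X).smulRight
          ((1 / 2 : ℝ) • (g t - c + swapConj n (g t - c)))) (σ, t) := by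
  have he : HasFDerivAt (fun p : ℝ × X => g p.2 - c)
      (g'.comp (ContinuousLinearMap.snd ℝ ℝ X)) (σ, t) :=
    (hg.comp (σ, t) hasFDerivAt_snd).sub_const c
  have hσ : HasFDerivAt (fun p : ℝ × X => p.1) (ContinuousLinearMap.fst ℝ ℝ X) (σ, t) :=
    hasFDerivAt_fst
  rw [contractionHomotopy_eq_add_smul]
  refine ((((contraction 0).hasFDerivAt.comp (σ, t) he).add
    (hσ.smul ((he.add ((swapConj n).hasFDerivAt.comp (σ, t) he)).const_smul
      (1 / 2 : ℝ)))).const_add c).congr_fderiv (ContinuousLinearMap.ext fun v => ?_)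
  change contraction 0 (g' v.2) + (σ • (1 / 2 : ℝ) • (g' v.2 + swapConj n (g' v.2)) + _) =
    contraction σ (g' v.2) + _
  rw [contraction_eq_add_smul σ, add_assoc]
  rfl

theorem norm_fderiv_contractionHomotopy_le (hg : DifferentiableAt ℝ g t) (hσ₀ : 0 ≤ σ)
    (hσ₁ : σ ≤ 1) :
    ‖fderiv ℝ (contractionHomotopy g c) (σ, t)‖ ≤ ‖fderiv ℝ g t‖ + ‖g t - c‖ := by
  rw [(hasFDerivAt_contractionHomotopy hg.hasFDerivAt).fderiv]
  refine ContinuousLinearMap.opNorm_le_bound _ (by positivity) fun v => ?_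
  have hmean : ‖(1 / 2 : ℝ) • (g t - c + swapConj n (g t - c))‖ ≤ ‖g t - c‖ := by
    rw [norm_smul, Real.norm_of_nonneg (by norm_num)]
    linarith [norm_add_le (g t - c) (swapConj n (g t - c)), norm_swapConj (g t - c)]
  calc ‖contraction σ (fderiv ℝ g t v.2) +
        v.1 • (1 / 2 : ℝ) • (g t - c + swapConj n (g t - c))‖
      ≤ ‖fderiv ℝ g t‖ * ‖v.2‖ + ‖v.1‖ * ‖g t - c‖ := by
        refine (norm_add_le _ _).trans (add_le_add ?_ ?_)
        · exact (norm_contraction_apply_le hσ₀ hσ₁ _).trans ((fderiv ℝ g t).le_opNorm _)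
        · rw [norm_smul]
          gcongr
    _ ≤ (‖fderiv ℝ g t‖ + ‖g t - c‖) * ‖v‖ := by
        rw [add_mul, mul_comm ‖v.1‖]
        gcongr
        · exact norm_snd_le v
        · exact norm_fst_le v

theorem pullbackForm_contractionHomotopy (F : Cn n × Cn n → ℂ) {N : ℕ}
    (D : (Cn n × Cn n) [⋀^Fin N]→L[ℂ] ℂ) (hg : DifferentiableAt ℝ g t) (b : Fin N → X) :
    pullbackForm F D (contractionHomotopy g c) (σ, t) (fun k => (0, b k)) =
      F (c + contraction σ (g t - c)) * D fun k => contraction σ (fderiv ℝ g t (b k)) := by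
  rw [pullbackForm_apply, (hasFDerivAt_contractionHomotopy hg.hasFDerivAt).fderiv]
  congr 2
  funext k
  simp

end

theorem norm_setIntegral_sub_integral_smul_le {X E : Type*} [MeasurableSpace X] {μ : Measure X}
    [NormedAddCommGroup E] [NormedSpace ℝ E] {S Q : Set X} (hS : MeasurableSet S)
    (hQ : μ Q ≠ ⊤) (hSQ : S ⊆ Q) {f : X → E} {θ : X → ℝ} (hf : IntegrableOn f S μ)
    (hθf : Integrable (fun t => θ t • f t) μ) (hθ₀ : ∀ t, 0 ≤ θ t) (hθ₁ : ∀ t, θ t ≤ 1)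
    (hθQ : ∀ t ∉ Q, θ t = 0) {B : ℝ} (hB : 0 ≤ B) (hin : ∀ t ∈ S, θ t ≠ 1 → ‖f t‖ ≤ B)
    (hout : ∀ t ∈ Q \ S, θ t ≠ 0 → ‖f t‖ ≤ B) :
    ‖∫ t in S, f t ∂μ - ∫ t, θ t • f t ∂μ‖ ≤ B * μ.real Q := by
  have hzero : ∀ t ∉ Q, S.indicator f t - θ t • f t = 0 := fun t ht => by
    rw [indicator_of_notMem fun h => ht (hSQ h), hθQ t ht, zero_smul, sub_zero]
  rw [← integral_indicator hS, ← integral_sub (hf.integrable_indicator hS) hθf,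
    ← setIntegral_eq_integral_of_forall_compl_eq_zero hzero]
  refine norm_setIntegral_le_of_norm_le_const hQ.lt_top fun t ht => ?_
  by_cases htS : t ∈ S
  · rw [indicator_of_mem htS, show f t - θ t • f t = (1 - θ t) • f t by rw [sub_smul, one_smul],
      norm_smul, Real.norm_of_nonneg (by linarith [hθ₁ t])]
    rcases eq_or_ne (θ t) 1 with h | h
    · simpa [h] using hB
    · exact (mul_le_of_le_one_left (norm_nonneg _) (by linarith [hθ₀ t])).trans (hin t htS h)
  · rw [indicator_of_notMem htS, zero_sub, norm_neg, norm_smul, Real.norm_of_nonneg (hθ₀ t)]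
    rcases eq_or_ne (θ t) 0 with h | h
    · simpa [h] using hB
    · exact (mul_le_of_le_one_left (norm_nonneg _) (hθ₁ t)).trans (hout t ⟨ht, htS⟩ h)

end ContourIntegral

section ContourComparison

open MeasureTheory Set Metric Module

variable {n : ℕ}

/-- A parametrized contour `g : Q → ℂⁿ × ℂⁿ` near the centre `c`: the radius `r` is such that
`t ↦ offset n (g t - c)` is an orientation preserving chart on `ball 0 (2 * r)` under which
`closedBall 0 r` covers `ball 0 δ`, and `R` bounds `g` and its derivative. -/
structure IsContourChart (Q : Set (R2n n)) (g : R2n n → Cn n × Cn n) (c : Cn n × Cn n)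
    (r δ R : ℝ) : Prop where
  radius_pos : 0 < r
  contDiffAt : ∀ t ∈ Q, ContDiffAt ℝ 2 g t
  norm_fderiv_le : ∀ t ∈ Q, ‖fderiv ℝ g t‖ ≤ R
  norm_sub_le : ∀ t ∈ Q, ‖g t - c‖ ≤ R
  ball_subset : ball 0 (2 * r) ⊆ Q
  injOn : InjOn (fun t => offset n (g t - c)) (ball 0 (2 * r))
  det_pos : ∀ t ∈ ball 0 (2 * r), 0 < ((offset n).comp (fderiv ℝ g t)).det
  ball_subset_image : ball 0 δ ⊆ (fun t => offset n (g t - c)) '' closedBall 0 r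

/-- `F`, defined on `T`, is bounded by `B` along the contraction of the contour `g` to the affine
contour, away from the centre `c`, and its antiholomorphic derivative is bounded by `B`
everywhere along the contraction. The parameters are those of `IsContourChart`. -/
structure IsSmallAlongContraction (F : Cn n × Cn n → ℂ) (T : Set (Cn n × Cn n)) (Q : Set (R2n n))
    (g : R2n n → Cn n × Cn n) (c : Cn n × Cn n) (r δ B : ℝ) : Prop where
  mapsTo : MapsTo g Q T
  mapsTo_homotopy : MapsTo (contractionHomotopy g c) (Ioo (-1) 2 ×ˢ ball 0 (2 * r)) T
  norm_le_far : ∀ t ∈ Q, t ∉ ball 0 r → ‖F (g t)‖ ≤ B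
  norm_le_off_center : ∀ σ ∈ Icc (0 : ℝ) 1, ∀ t ∈ ball 0 (2 * r),
    t ∉ ball 0 r ∨ δ ≤ ‖offset n (g t - c)‖ → ‖F (contractionHomotopy g c (σ, t))‖ ≤ B
  norm_antiPart_le : ∀ σ ∈ Icc (0 : ℝ) 1, ∀ t ∈ ball 0 (2 * r),
    ‖antiPart (fderiv ℝ F (contractionHomotopy g c (σ, t)))‖ ≤ B

/-- The density on the parameter space of `F dx ∧ dỹ` pulled back to the contour at the stage `σ`
of the contraction. -/
def contractionDensity (F : Cn n × Cn n → ℂ) (g : R2n n → Cn n × Cn n) (c : Cn n × Cn n) (σ : ℝ)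
    (t : R2n n) : ℂ :=
  pullbackForm F (volumeForm n) (contractionHomotopy g c) (σ, t) fun k => (0, stdFrame n k)

variable {F : Cn n × Cn n → ℂ} {T : Set (Cn n × Cn n)} {Q : Set (R2n n)}
  {g : R2n n → Cn n × Cn n} {c : Cn n × Cn n} {r δ R B σ : ℝ} {t : R2n n}

theorem contractionHomotopy_one (g : R2n n → Cn n × Cn n) (c : Cn n × Cn n) (t : R2n n) :
    contractionHomotopy g c (1, t) = g t := by
  rw [contractionHomotopy, contraction_one, add_sub_cancel]

theorem contractionDensity_one (hg : DifferentiableAt ℝ g t) :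
    contractionDensity F g c 1 t =
      F (g t) * volumeForm n fun k => fderiv ℝ g t (stdFrame n k) := by
  simp only [contractionDensity, pullbackForm_contractionHomotopy F _ hg, contraction_one,
    add_sub_cancel]

theorem contractionDensity_zero (hg : DifferentiableAt ℝ g t) :
    contractionDensity F g c 0 t = F (c + affineContour n (offset n (g t - c))) *
      ((affineMatrix n).det * (((offset n).comp (fderiv ℝ g t)).det : ℝ)) := by
  rw [contractionDensity, pullbackForm_contractionHomotopy F _ hg, volumeForm_contraction_zero,
    affineContour_offset]

theorem continuousAt_contractionDensity (hF : ContDiffAt ℝ 1 F (contractionHomotopy g c (σ, t)))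
    (hg : ContDiffAt ℝ 2 g t) : ContinuousAt (contractionDensity F g c σ) t :=
  ((contDiffAt_pullbackForm_apply hF (contDiffAt_contractionHomotopy hg) _).continuousAt).comp
    (Continuous.prodMk_right σ).continuousAt

namespace IsContourChart

variable (hgQ : IsContourChart Q g c r δ R)
include hgQ

theorem differentiableAt (ht : t ∈ Q) : DifferentiableAt ℝ g t :=
  (hgQ.contDiffAt t ht).differentiableAt two_ne_zero

theorem norm_fderiv_homotopy_le (ht : t ∈ Q) (hσ : σ ∈ Icc (0 : ℝ) 1) :
    ‖fderiv ℝ (contractionHomotopy g c) (σ, t)‖ ≤ 2 * R := by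
  linarith [norm_fderiv_contractionHomotopy_le (c := c) (hgQ.differentiableAt ht)
    hσ.1 hσ.2, hgQ.norm_fderiv_le t ht, hgQ.norm_sub_le t ht]

theorem norm_contractionDensity_le (ht : t ∈ Q) (hσ : σ ∈ Icc (0 : ℝ) 1)
    (hB : ‖F (contractionHomotopy g c (σ, t))‖ ≤ B) :
    ‖contractionDensity F g c σ t‖ ≤ B * (‖volumeForm n‖ * (2 * R) ^ (n + n)) := by
  have hB₀ : 0 ≤ B := (norm_nonneg _).trans hB
  refine (ContinuousAlternatingMap.le_opNorm _ _).trans ?_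
  simp only [Prod.norm_mk, norm_zero, norm_stdFrame, max_eq_right zero_le_one,
    Finset.prod_const_one, mul_one]
  rw [← mul_assoc]
  refine norm_pullbackForm_le.trans ?_
  gcongr
  exact hgQ.norm_fderiv_homotopy_le ht hσ

theorem closedBall_subset_ball : closedBall (0 : R2n n) r ⊆ ball 0 (2 * r) :=
  Metric.closedBall_subset_ball (by linarith [hgQ.radius_pos])

theorem hasFDerivAt_offset (ht : t ∈ Q) :
    HasFDerivAt (fun t => offset n (g t - c)) ((offset n).comp (fderiv ℝ g t)) t :=
  (offset n).hasFDerivAt.comp t ((hgQ.differentiableAt ht).hasFDerivAt.sub_const c)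

/-- The part of the parameter space that the chart maps onto `ball 0 δ`. -/
def core (g : R2n n → Cn n × Cn n) (c : Cn n × Cn n) (r δ : ℝ) : Set (R2n n) :=
  ball 0 (2 * r) ∩ (fun t => offset n (g t - c)) ⁻¹' ball 0 δ

omit hgQ in
theorem core_subset_ball : core g c r δ ⊆ ball 0 (2 * r) := inter_subset_left

theorem measurableSet_core : MeasurableSet (core g c r δ) :=
  (ContinuousOn.isOpen_inter_preimage (fun _ ht => (hgQ.hasFDerivAt_offset
    (hgQ.ball_subset ht)).continuousAt.continuousWithinAt) isOpen_ball isOpen_ball).measurableSet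

theorem core_subset_closedBall : core g c r δ ⊆ closedBall 0 r := by
  rintro t ⟨ht, htδ⟩
  obtain ⟨t', ht', heq⟩ := hgQ.ball_subset_image htδ
  rwa [← hgQ.injOn (hgQ.closedBall_subset_ball ht') ht heq]

theorem image_core : (fun t => offset n (g t - c)) '' core g c r δ = ball 0 δ := by
  refine Subset.antisymm (image_subset_iff.2 inter_subset_right) fun u hu => ?_
  obtain ⟨t, ht, rfl⟩ := hgQ.ball_subset_image hu
  exact ⟨t, ⟨hgQ.closedBall_subset_ball ht, hu⟩, rfl⟩

theorem setIntegral_contractionDensity_zero (F : Cn n × Cn n → ℂ) :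
    ∫ t in core g c r δ, contractionDensity F g c 0 t =
      (affineMatrix n).det * ∫ u in ball (0 : R2n n) δ, F (c + affineContour n u) := by
  rw [← hgQ.image_core, integral_image_eq_integral_abs_det_fderiv_smul volume
    hgQ.measurableSet_core (fun t ht => (hgQ.hasFDerivAt_offset
      (hgQ.ball_subset (core_subset_ball ht))).hasFDerivWithinAt)
    (hgQ.injOn.mono core_subset_ball), ← integral_const_mul]
  refine setIntegral_congr_fun hgQ.measurableSet_core fun t ht => ?_
  have htW := core_subset_ball ht
  simp only [contractionDensity_zero (hgQ.differentiableAt (hgQ.ball_subset htW)),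
    abs_of_pos (hgQ.det_pos t htW), Complex.real_smul]
  ring

end IsContourChart

end ContourComparison

section ContourComparison

open MeasureTheory Set Metric Module

variable {n : ℕ} {F : Cn n × Cn n → ℂ} {T : Set (Cn n × Cn n)} {Q : Set (R2n n)}
  {g : R2n n → Cn n × Cn n} {c : Cn n × Cn n} {r δ R B : ℝ}

namespace IsContourChart

variable (hgQ : IsContourChart Q g c r δ R) (hFQ : IsSmallAlongContraction F T Q g c r δ B)
include hgQ hFQ

omit hFQ in
theorem center_mem : (0 : R2n n) ∈ ball 0 (2 * r) :=
  mem_ball_self (by linarith [hgQ.radius_pos])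

omit hFQ in
theorem nonneg : 0 ≤ R :=
  (norm_nonneg _).trans (hgQ.norm_sub_le 0 (hgQ.ball_subset hgQ.center_mem))

theorem bound_nonneg : 0 ≤ B :=
  (norm_nonneg _).trans (hFQ.norm_antiPart_le 0 (left_mem_Icc.2 zero_le_one) 0 hgQ.center_mem)

theorem continuousAt_contractionDensity (hT : IsOpen T) (hF : ContDiffOn ℝ 1 F T) {σ : ℝ}
    (hσ : σ ∈ Icc (0 : ℝ) 1) {t : R2n n} (ht : t ∈ ball 0 (2 * r)) :
    ContinuousAt (contractionDensity F g c σ) t :=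
  GevreyBergman.continuousAt_contractionDensity
    (hF.contDiffAt (hT.mem_nhds (hFQ.mapsTo_homotopy
      ⟨⟨by linarith [hσ.1], by linarith [hσ.2]⟩, ht⟩)))
    (hgQ.contDiffAt t (hgQ.ball_subset ht))

theorem continuousAt_contractionDensity_one (hT : IsOpen T) (hF : ContDiffOn ℝ 1 F T)
    {t : R2n n} (ht : t ∈ Q) : ContinuousAt (contractionDensity F g c 1) t :=
  GevreyBergman.continuousAt_contractionDensity
    (hF.contDiffAt (hT.mem_nhds (by rw [contractionHomotopy_one]; exact hFQ.mapsTo ht)))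
    (hgQ.contDiffAt t ht)

variable (θ : ContDiffBump (0 : R2n n)) (hθin : θ.rIn = r) (hθout : θ.rOut < 2 * r)
include hθin hθout

omit hgQ hFQ hθin in
theorem tsupport_subset_ball : tsupport θ ⊆ ball 0 (2 * r) :=
  θ.tsupport_eq.trans_subset (Metric.closedBall_subset_ball hθout)

omit hθin in
theorem integrable_smul_contractionDensity (hT : IsOpen T) (hF : ContDiffOn ℝ 1 F T) {σ : ℝ}
    (hσ : σ ∈ Icc (0 : ℝ) 1) : Integrable fun t => θ t • contractionDensity F g c σ t := by
  refine Continuous.integrable_of_hasCompactSupport (continuous_of_tsupport fun t ht => ?_)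
    θ.hasCompactSupport.smul_right
  exact θ.continuous.continuousAt.smul (hgQ.continuousAt_contractionDensity hFQ hT hF hσ
    (tsupport_subset_ball θ hθout (tsupport_smul_subset_left _ _ ht)))

omit hgQ hFQ hθin in
theorem mem_ball_of_apply_ne_zero {t : R2n n} (h : θ t ≠ 0) : t ∈ ball 0 (2 * r) :=
  tsupport_subset_ball θ hθout (subset_tsupport _ h)

theorem norm_setIntegral_sub_integral_smul_one_le (hQ : IsCompact Q) (hT : IsOpen T)
    (hF : ContDiffOn ℝ 1 F T) :
    ‖(∫ t in Q, contractionDensity F g c 1 t) - ∫ t, θ t • contractionDensity F g c 1 t‖ ≤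
      B * (‖volumeForm n‖ * (2 * R) ^ (n + n)) * volume.real Q := by
  have h₁ : (1 : ℝ) ∈ Icc (0 : ℝ) 1 := right_mem_Icc.2 zero_le_one
  refine norm_setIntegral_sub_integral_smul_le hQ.measurableSet hQ.measure_lt_top.ne subset_rfl
    (ContinuousOn.integrableOn_compact hQ fun t ht =>
      (hgQ.continuousAt_contractionDensity_one hFQ hT hF ht).continuousWithinAt)
    (hgQ.integrable_smul_contractionDensity hFQ θ hθout hT hF h₁) (fun _ => θ.nonneg)
    (fun _ => θ.le_one) (fun t ht => ?_) ?_ (fun t ht hne => ?_) fun t ht => absurd ht.1 ht.2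
  · by_contra h
    exact ht (hgQ.ball_subset (mem_ball_of_apply_ne_zero θ hθout h))
  · have := hgQ.nonneg
    have := hgQ.bound_nonneg hFQ
    positivity
  · refine hgQ.norm_contractionDensity_le ht h₁ ?_
    rw [contractionHomotopy_one]
    exact hFQ.norm_le_far t ht fun h => hne (θ.one_of_mem_closedBall
      (hθin ▸ ball_subset_closedBall h))

theorem norm_integral_smul_zero_sub_le (hQ : IsCompact Q) (hT : IsOpen T)
    (hF : ContDiffOn ℝ 1 F T) :
    ‖(∫ t in core g c r δ, contractionDensity F g c 0 t) -
        ∫ t, θ t • contractionDensity F g c 0 t‖ ≤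
      B * (‖volumeForm n‖ * (2 * R) ^ (n + n)) * volume.real Q := by
  have h₀ : (0 : ℝ) ∈ Icc (0 : ℝ) 1 := left_mem_Icc.2 zero_le_one
  have hcore : ∀ t ∈ core g c r δ, θ t = 1 := fun t ht =>
    θ.one_of_mem_closedBall (hθin ▸ hgQ.core_subset_closedBall ht)
  have hintg := hgQ.integrable_smul_contractionDensity hFQ θ hθout hT hF h₀
  refine norm_setIntegral_sub_integral_smul_le hgQ.measurableSet_core hQ.measure_lt_top.ne
    (core_subset_ball.trans hgQ.ball_subset) ?_ hintg (fun _ => θ.nonneg) (fun _ => θ.le_one)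
    (fun t ht => ?_) ?_ (fun t ht hne => absurd (hcore t ht) hne) fun t ht hne => ?_
  · exact hintg.integrableOn.congr_fun (fun t ht => by simp [hcore t ht]) hgQ.measurableSet_core
  · by_contra h
    exact ht (hgQ.ball_subset (mem_ball_of_apply_ne_zero θ hθout h))
  · have := hgQ.nonneg
    have := hgQ.bound_nonneg hFQ
    positivity
  · have htW := mem_ball_of_apply_ne_zero θ hθout hne
    refine hgQ.norm_contractionDensity_le ht.1 h₀ (hFQ.norm_le_off_center 0 h₀ t htW (Or.inr ?_))
    by_contra h
    exact ht.2 ⟨htW, by simpa using h⟩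

theorem norm_integral_smul_one_sub_zero_le (hQ : IsCompact Q) (hT : IsOpen T)
    (hF : ContDiffOn ℝ 1 F T) {Θ : ℝ} (hΘ : ∀ t, ‖fderiv ℝ θ t‖ ≤ Θ) :
    ‖(∫ t, θ t • contractionDensity F g c 1 t) - ∫ t, θ t • contractionDensity F g c 0 t‖ ≤
      ((n + n : ℕ) + 1) * ‖volumeForm n‖ * ((2 * R) ^ (n + n + 1) + (2 * R) ^ (n + n)) *
        ((1 + Θ) * B) * volume.real Q := by
  have hR := hgQ.nonneg
  have hB := hgQ.bound_nonneg hFQ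
  have hΘ₀ : 0 ≤ Θ := (norm_nonneg _).trans (hΘ 0)
  have hθW := tsupport_subset_ball θ hθout
  have hH : ContDiffOn ℝ 2 (contractionHomotopy g c) (Ioo (-1) 2 ×ˢ ball 0 (2 * r)) :=
    fun p hp => (contDiffAt_contractionHomotopy
      (hgQ.contDiffAt p.2 (hgQ.ball_subset hp.2))).contDiffWithinAt
  refine (norm_integral_pullbackForm_sub_le (Y := (1 + Θ) * B) finrank_cn_prod_cn.le
    (volumeForm n) hT hF isOpen_Ioo (Icc_subset_Ioo (by norm_num) (by norm_num)) isOpen_ball hH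
    hFQ.mapsTo_homotopy θ.contDiff θ.hasCompactSupport hθW (fun k => (norm_stdFrame k).le)
    (fun t => ?_)
    (fun σ hσ t ht => hgQ.norm_fderiv_homotopy_le (hgQ.ball_subset (hθW ht)) hσ)
    (fun σ hσ t ht => (hFQ.norm_antiPart_le σ hσ t (hθW ht)).trans ?_)
    fun σ hσ t ht => ?_).trans ?_
  · rw [Real.norm_of_nonneg θ.nonneg]
    exact θ.le_one
  · nlinarith
  · by_cases htr : t ∈ ball 0 r
    · have hone : θ =ᶠ[nhds t] fun _ => 1 := by
        filter_upwards [isOpen_ball.mem_nhds htr] with u hu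
        exact θ.one_of_mem_closedBall (hθin ▸ ball_subset_closedBall hu)
      rw [hone.fderiv_eq, fderiv_const_apply, norm_zero, zero_mul]
      positivity
    · calc _ ≤ Θ * B := by
            gcongr
            exacts [hΘ t, hFQ.norm_le_off_center σ hσ t (hθW ht) (Or.inl htr)]
        _ ≤ _ := by nlinarith
  · gcongr
    exacts [hQ.measure_lt_top.ne, hθW.trans hgQ.ball_subset]

end IsContourChart

theorem exists_norm_contourIntegral_sub_le (hQ : IsCompact Q) (hr : 0 < r) (R : ℝ) :
    ∃ M : ℝ, ∀ (g : R2n n → Cn n × Cn n) (c : Cn n × Cn n) (F : Cn n × Cn n → ℂ)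
      (T : Set (Cn n × Cn n)) (δ B : ℝ), IsOpen T → ContDiffOn ℝ 1 F T →
      IsContourChart Q g c r δ R → IsSmallAlongContraction F T Q g c r δ B →
      ‖(∫ t in Q, F (g t) * volumeForm n fun k => fderiv ℝ g t (stdFrame n k)) -
          (affineMatrix n).det * ∫ u in ball (0 : R2n n) δ, F (c + affineContour n u)‖ ≤ M * B := by
  let θ : ContDiffBump (0 : R2n n) := ⟨r, 3 / 2 * r, hr, by linarith⟩
  have hθout : θ.rOut < 2 * r := show 3 / 2 * r < 2 * r by linarith
  obtain ⟨Θ, hΘ⟩ : ∃ Θ, ∀ t, ‖fderiv ℝ θ t‖ ≤ Θ :=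
    ((θ.contDiff (n := 1)).continuous_fderiv one_ne_zero).bounded_above_of_compact_support
      (θ.hasCompactSupport.fderiv ℝ)
  refine ⟨(2 * (‖volumeForm n‖ * (2 * R) ^ (n + n)) +
    ((n + n : ℕ) + 1) * ‖volumeForm n‖ * ((2 * R) ^ (n + n + 1) + (2 * R) ^ (n + n)) *
      (1 + Θ)) * volume.real Q, fun g c F T δ B hT hF hgQ hFQ => ?_⟩
  have hend := hgQ.norm_setIntegral_sub_integral_smul_one_le hFQ θ rfl hθout hQ hT hF
  have hstart := hgQ.norm_integral_smul_zero_sub_le hFQ θ rfl hθout hQ hT hF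
  have hstokes := hgQ.norm_integral_smul_one_sub_zero_le hFQ θ rfl hθout hQ hT hF hΘ
  rw [setIntegral_congr_fun hQ.measurableSet fun t ht =>
    contractionDensity_one (hgQ.differentiableAt ht)] at hend
  rw [hgQ.setIntegral_contractionDensity_zero] at hstart
  simp only [← dist_eq_norm] at hend hstokes hstart ⊢
  rw [dist_comm] at hstart
  refine (dist_triangle4 _ _ _ _).trans ((add_le_add_three hend hstokes hstart).trans_eq ?_)
  ring

end ContourComparison

section RealBounds

variable {s K C A d : ℝ}

theorem exists_inv_pow_mul_exp_le_gevreyDecay {c : ℝ} (hs : 1 < s) (hK : 0 < K) (hd : 0 < d)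
    (hc : 0 < c) (hA : 0 ≤ A) (n : ℕ) :
    ∃ M, ∀ h, 0 < h → ∀ x ≤ -((2 * K)⁻¹ * d ^ 2),
      h⁻¹ ^ n * (Real.exp (2 / h * x) * A) ≤ M * gevreyDecay s c h := by
  obtain ⟨M₁, hM₁, hexp⟩ := exists_exp_neg_div_le_gevreyDecay (c := 2 * c) (c' := K⁻¹ * d ^ 2) hs
    (by positivity) (by positivity)
  obtain ⟨M₂, -, hpow⟩ := exists_inv_pow_mul_gevreyDecay_le hs hc n
  refine ⟨M₁ * A * M₂, fun h hh x hx => ?_⟩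
  have hgauss : Real.exp (2 / h * x) ≤ M₁ * gevreyDecay s (2 * c) h :=
    calc Real.exp (2 / h * x) ≤ Real.exp (2 / h * -((2 * K)⁻¹ * d ^ 2)) := by gcongr
      _ = Real.exp (-(K⁻¹ * d ^ 2 / h)) := by
          congr 1
          field_simp
      _ ≤ M₁ * gevreyDecay s (2 * c) h := hexp h hh
  calc h⁻¹ ^ n * (Real.exp (2 / h * x) * A)
      ≤ h⁻¹ ^ n * (M₁ * gevreyDecay s (2 * c) h * A) := by gcongr
    _ = M₁ * A * (h⁻¹ ^ n * gevreyDecay s (2 * c) h) := by ring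
    _ ≤ M₁ * A * (M₂ * gevreyDecay s c h) :=
        mul_le_mul_of_nonneg_left (hpow h hh) (by positivity)
    _ = _ := by ring

theorem exists_inv_pow_mul_exp_mul_flatWeight_le_gevreyDecay (hs : 1 < s) (hK : 0 < K)
    (hC : 0 < C) (hA : 0 ≤ A) (n : ℕ) :
    ∃ M, ∀ h, 0 < h → ∀ d, 0 ≤ d → ∀ x ≤ -((2 * K)⁻¹ * d ^ 2),
      h⁻¹ ^ n * (Real.exp (2 / h * x) * ((12 * n * A * h⁻¹ + 2 * n) * flatWeight s C (2 * d))) ≤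
        M * gevreyDecay s (rate s K C / 2) h := by
  have hrate := rate_pos (s := s) hK hC
  obtain ⟨M₁, -, hpow₁⟩ := exists_inv_pow_mul_gevreyDecay_le hs (half_pos hrate) (n + 1)
  obtain ⟨M₂, -, hpow₂⟩ := exists_inv_pow_mul_gevreyDecay_le hs (half_pos hrate) n
  rw [mul_div_cancel₀ _ (two_ne_zero' ℝ)] at hpow₁ hpow₂
  refine ⟨12 * n * A * C * M₁ + 2 * n * C * M₂, fun h hh d hd x hx => ?_⟩
  calc _ = h⁻¹ ^ n * (12 * n * A * h⁻¹ + 2 * n) *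
        (Real.exp (2 / h * x) * flatWeight s C (2 * d)) := by ring
    _ ≤ h⁻¹ ^ n * (12 * n * A * h⁻¹ + 2 * n) * (C * gevreyDecay s (rate s K C) h) :=
        mul_le_mul_of_nonneg_left (exp_mul_flatWeight_le hs hK hC hd hh hx) (by positivity)
    _ = 12 * n * A * C * (h⁻¹ ^ (n + 1) * gevreyDecay s (rate s K C) h) +
        2 * n * C * (h⁻¹ ^ n * gevreyDecay s (rate s K C) h) := by ring
    _ ≤ 12 * n * A * C * (M₁ * gevreyDecay s (rate s K C / 2) h) +
        2 * n * C * (M₂ * gevreyDecay s (rate s K C / 2) h) :=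
        add_le_add (mul_le_mul_of_nonneg_left (hpow₁ h hh) (by positivity))
          (mul_le_mul_of_nonneg_left (hpow₂ h hh) (by positivity))
    _ = _ := by ring

end RealBounds

section GoodContour

open Set Metric Filter Topology

theorem exists_eventually_forall_mem_ball {X E : Type*} [TopologicalSpace X]
    [PseudoMetricSpace E] {P : X → E → Prop} {x₀ : X} {t₀ : E}
    (hP : ∀ᶠ p in 𝓝 (x₀, t₀), P p.1 p.2) :
    ∃ r > 0, ∀ᶠ x in 𝓝 x₀, ∀ t ∈ ball t₀ r, P x t := by
  obtain ⟨Q, hQ, Q', hQ', hQP⟩ := eventually_prod_iff.1 (nhds_prod_eq (x := x₀) (y := t₀) ▸ hP)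
  obtain ⟨r, hr, hball⟩ := eventually_nhds_iff_ball.1 hQ'
  exact ⟨r, hr, hQ.mono fun x hx t ht => hQP hx (hball t ht)⟩

theorem contDiffAt_of_uncurry {E F G : Type*} [NormedAddCommGroup E] [NormedSpace ℝ E]
    [NormedAddCommGroup F] [NormedSpace ℝ F] [NormedAddCommGroup G] [NormedSpace ℝ G]
    {k : WithTop ℕ∞} {f : E → F → G} {p : E × F}
    (hf : ContDiffAt ℝ k (fun q : E × F => f q.1 q.2) p) : ContDiffAt ℝ k (f p.1) p.2 :=
  ContDiffAt.comp (f := fun t => (p.1, t)) p.2 hf (by fun_prop)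

namespace IsGoodContour

variable {n : ℕ} {T : Set (Cn n × Cn n)} {Ψ : Cn n × Cn n → ℂ} {K : ℝ} {L : Set (Cn n)}
  {Γ : Contour n} {y y₀ : Cn n} {t : R2n n} {r ε : ℝ} (hΓ : IsGoodContour T Ψ K L Γ)
include hΓ

theorem contDiffAt_uncurry (hy : y ∈ L) (ht : t ∈ Γ.dom) :
    ContDiffAt ℝ 2 (fun p : Cn n × R2n n => Γ.map p.1 p.2) (y, t) := by
  obtain ⟨O, hO, hLO, hsmooth⟩ := hΓ.smooth
  exact (hsmooth.contDiffAt (hO.mem_nhds (hLO ⟨hy, ht⟩))).of_le (by norm_cast)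

theorem contDiffAt (hy : y ∈ L) (ht : t ∈ Γ.dom) : ContDiffAt ℝ 2 (Γ.map y) t :=
  contDiffAt_of_uncurry (hΓ.contDiffAt_uncurry hy ht)

theorem continuousAt_fderiv (hy : y ∈ L) (ht : t ∈ Γ.dom) :
    ContinuousAt (fun p : Cn n × R2n n => fderiv ℝ (Γ.map p.1) p.2) (y, t) :=
  (ContDiffAt.fderiv (m := 1) (f := fun p : Cn n × R2n n => Γ.map p.1) (g := Prod.snd)
    ((hΓ.contDiffAt_uncurry hy ht).comp ((y, t), t)
      (by fun_prop : ContDiffAt ℝ 2 (fun q : (Cn n × R2n n) × R2n n => (q.1.1, q.2)) ((y, t), t)))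
    contDiffAt_snd (by norm_num)).continuousAt

theorem continuousAt_sub_antidiag (hy : y ∈ L) (ht : t ∈ Γ.dom) :
    ContinuousAt (fun p : Cn n × R2n n => Γ.map p.1 p.2 - antidiag n p.1) (y, t) :=
  (hΓ.contDiffAt_uncurry hy ht).continuousAt.sub (by fun_prop)

theorem zero_mem_dom : (0 : R2n n) ∈ Γ.dom :=
  mem_of_mem_nhds hΓ.dom_nhds

theorem exists_norm_le (hL : IsCompact L) :
    ∃ R, ∀ y ∈ L, ∀ t ∈ Γ.dom, ‖fderiv ℝ (Γ.map y) t‖ ≤ R ∧ ‖Γ.map y t - antidiag n y‖ ≤ R := by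
  obtain ⟨R₁, hR₁⟩ := (hL.prod hΓ.compact_dom).exists_bound_of_continuousOn fun p hp =>
    (hΓ.continuousAt_fderiv hp.1 hp.2).continuousWithinAt
  obtain ⟨R₂, hR₂⟩ := (hL.prod hΓ.compact_dom).exists_bound_of_continuousOn fun p hp =>
    (hΓ.continuousAt_sub_antidiag hp.1 hp.2).continuousWithinAt
  exact ⟨max R₁ R₂, fun y hy t ht => ⟨(hR₁ (y, t) ⟨hy, ht⟩).trans (le_max_left _ _),
    (hR₂ (y, t) ⟨hy, ht⟩).trans (le_max_right _ _)⟩⟩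

theorem exists_le_norm_sub_antidiag (hL : IsCompact L) (hr : 0 < r) :
    ∃ d > 0, ∀ y ∈ L, ∀ t ∈ Γ.dom, t ∉ ball 0 r → d ≤ ‖Γ.map y t - antidiag n y‖ := by
  obtain ⟨d, hd, hfar⟩ := (hL.prod (hΓ.compact_dom.diff isOpen_ball)).exists_forall_le'
    (f := fun p : Cn n × R2n n => ‖Γ.map p.1 p.2 - antidiag n p.1‖) (a := 0)
    (fun p hp => (hΓ.continuousAt_sub_antidiag hp.1 hp.2.1).norm.continuousWithinAt)
    (by
      rintro ⟨y, t⟩ ⟨hy, ht, htr⟩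
      refine norm_pos_iff.2 (sub_ne_zero.2 fun heq => htr ?_)
      obtain rfl : t = 0 := hΓ.injective y hy ht hΓ.zero_mem_dom (heq.trans (hΓ.center y hy).symm)
      exact mem_ball_self hr)
  exact ⟨d, hd, fun y hy t ht htr => hfar (y, t) ⟨hy, ht, htr⟩⟩

theorem eventually_norm_lt_and_det_pos (hy₀ : y₀ ∈ L) (hε : 0 < ε) :
    ∀ᶠ p in 𝓝 (y₀, (0 : R2n n)), p.2 ∈ Γ.dom ∧ ‖Γ.map p.1 p.2 - antidiag n p.1‖ < ε ∧
      0 < ((offset n).comp (fderiv ℝ (Γ.map p.1) p.2)).det := by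
  refine (continuousAt_snd.eventually_mem hΓ.dom_nhds).and (.and ?_ ?_)
  · refine (hΓ.continuousAt_sub_antidiag hy₀ hΓ.zero_mem_dom).norm.eventually_lt
      continuousAt_const ?_
    simpa [hΓ.center y₀ hy₀] using hε
  · refine continuousAt_const.eventually_lt (ContinuousLinearMap.continuous_det.continuousAt.comp
      (continuousAt_const.clm_comp (hΓ.continuousAt_fderiv hy₀ hΓ.zero_mem_dom))) ?_
    exact Γ.det_orientMatrix y₀ ▸ hΓ.oriented y₀ hy₀

theorem exists_eventually_injOn_offset (hy₀ : y₀ ∈ L) :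
    ∃ r₀ > 0, ∃ m > 0, ∀ᶠ y in 𝓝 y₀, y ∈ L →
      InjOn (fun t => offset n (Γ.map y t - antidiag n y)) (ball 0 r₀) ∧
      ∀ r, 0 < r → r < r₀ → closedBall 0 (m * r) ⊆
        (fun t => offset n (Γ.map y t - antidiag n y)) '' closedBall 0 r := by
  have hdet : ((offset n).comp (fderiv ℝ (Γ.map y₀) 0)).det ≠ 0 :=
    Γ.det_orientMatrix y₀ ▸ (hΓ.oriented y₀ hy₀).ne'
  obtain ⟨c, hc, m, hm, hinverse⟩ := exists_injOn_and_closedBall_subset_image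
    (ContinuousLinearMap.toContinuousLinearEquivOfDetNeZero _ hdet)
  obtain ⟨r₀, hr₀, happrox⟩ := exists_eventually_approximatesLinearOn (y₀ := y₀)
    (f := fun y t => offset n (Γ.map y t - antidiag n y))
    (f' := fun y t => (offset n).comp (fderiv ℝ (Γ.map y) t))
    (by
      filter_upwards [(hΓ.contDiffAt_uncurry hy₀ hΓ.zero_mem_dom).eventually (by simp)] with p hp
      exact (offset n).hasFDerivAt.comp p.2
        (((contDiffAt_of_uncurry hp).differentiableAt two_ne_zero).hasFDerivAt.sub_const _))
    (continuousAt_const.clm_comp (hΓ.continuousAt_fderiv hy₀ hΓ.zero_mem_dom)) hc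
  refine ⟨r₀, hr₀, m, hm, happrox.mono fun y hy hyL => ?_⟩
  have hzero : offset n (Γ.map y 0 - antidiag n y) = 0 := by
    rw [hΓ.center y hyL, antidiag_apply, sub_self, map_zero]
  simpa only [hzero] using hinverse _ r₀ hy

theorem exists_eventually_isContourChart (hL : IsCompact L) (hy₀ : y₀ ∈ L) (hε : 0 < ε) :
    ∃ r > 0, ∃ R, ∃ δ₀ > 0, ∀ δ ≤ δ₀, ∀ᶠ y in 𝓝 y₀, y ∈ L →
      IsContourChart Γ.dom (Γ.map y) (antidiag n y) r δ R ∧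
      ∀ t ∈ ball 0 (2 * r), ‖Γ.map y t - antidiag n y‖ < ε := by
  obtain ⟨R, hR⟩ := hΓ.exists_norm_le hL
  obtain ⟨r₀, hr₀, m, hm, hchart⟩ := hΓ.exists_eventually_injOn_offset hy₀
  obtain ⟨r₁, hr₁, hnear⟩ :=
    exists_eventually_forall_mem_ball (P := fun y t => t ∈ Γ.dom ∧ ‖Γ.map y t - antidiag n y‖ < ε ∧
      0 < ((offset n).comp (fderiv ℝ (Γ.map y) t)).det) (hΓ.eventually_norm_lt_and_det_pos hy₀ hε)
  set r := min r₀ r₁ / 2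
  have hr : 0 < r := half_pos (lt_min hr₀ hr₁)
  have hr₀' : 2 * r ≤ r₀ := (mul_div_cancel₀ _ two_ne_zero).trans_le (min_le_left _ _)
  have hr₁' : 2 * r ≤ r₁ := (mul_div_cancel₀ _ two_ne_zero).trans_le (min_le_right _ _)
  refine ⟨r, hr, R, m * r, by positivity, fun δ hδ => ?_⟩
  filter_upwards [hchart, hnear] with y hychart hynear hyL
  obtain ⟨hinj, himage⟩ := hychart hyL
  have hball := fun t ht => hynear t (ball_subset_ball hr₁' ht)
  exact ⟨{ radius_pos := hr
           contDiffAt := fun t => hΓ.contDiffAt hyL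
           norm_fderiv_le := fun t ht => (hR y hyL t ht).1
           norm_sub_le := fun t ht => (hR y hyL t ht).2
           ball_subset := fun t ht => (hball t ht).1
           injOn := hinj.mono (ball_subset_ball hr₀')
           det_pos := fun t ht => (hball t ht).2.2
           ball_subset_image := (ball_subset_closedBall.trans
             (closedBall_subset_closedBall hδ)).trans (himage r hr (by linarith)) },
    fun t ht => (hball t ht).2.1⟩

end IsGoodContour

end GoodContour

section Comparison

open MeasureTheory Set Metric Filter Topology

variable {n : ℕ} {s ρ K C A h h₀ r δ ε d B σ : ℝ} {Φ : Cn n → ℝ} {U L : Set (Cn n)}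
  {T : Set (Cn n × Cn n)} {Ψ b : Cn n × Cn n → ℂ} {a : ℝ → Cn n × Cn n → ℂ} {Γ : Contour n}
  {Q : Set (R2n n)} {g : R2n n → Cn n × Cn n} {t : R2n n} {y y₀ : Cn n}

/-- Along the contraction of the contour `g` to the affine contour through `(y, ȳ)`, the real part
of the phase is at most `-(2K)⁻¹ |p - (y, ȳ)|²`, and at most `-(2K)⁻¹ d²` away from the centre. The
other parameters are those of `IsContourChart`. -/
structure IsDampedAlongContraction (Ψ : Cn n × Cn n → ℂ) (T : Set (Cn n × Cn n))
    (Q : Set (R2n n)) (g : R2n n → Cn n × Cn n) (y : Cn n) (r δ K d : ℝ) : Prop where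
  mapsTo : MapsTo g Q (phaseDomain T y)
  mapsTo_homotopy : MapsTo (contractionHomotopy g (antidiag n y)) (Ioo (-1) 2 ×ˢ ball 0 (2 * r))
    (phaseDomain T y)
  re_phase_le_far : ∀ t ∈ Q, t ∉ ball 0 r →
    (phase Ψ (antidiag n y) (g t)).re ≤ -((2 * K)⁻¹ * d ^ 2)
  re_phase_le_off_center : ∀ σ ∈ Icc (0 : ℝ) 1, ∀ t ∈ ball 0 (2 * r),
    t ∉ ball 0 r ∨ δ ≤ ‖offset n (g t - antidiag n y)‖ →
      (phase Ψ (antidiag n y) (contractionHomotopy g (antidiag n y) (σ, t))).re ≤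
        -((2 * K)⁻¹ * d ^ 2)
  re_phase_le : ∀ σ ∈ Icc (0 : ℝ) 1, ∀ t ∈ ball 0 (2 * r),
    (phase Ψ (antidiag n y) (contractionHomotopy g (antidiag n y) (σ, t))).re ≤
      -((2 * K)⁻¹ * ‖contractionHomotopy g (antidiag n y) (σ, t) - antidiag n y‖ ^ 2)

theorem IsDampedAlongContraction.isSmallAlongContraction
    (hg : IsDampedAlongContraction Ψ T Q g y r δ K d) (hs : 1 ≤ s) (hC : 0 ≤ C) (hh : 0 < h)
    (hT : IsOpen T) (hΨ : ContDiffOn ℝ 1 Ψ T) (hf : DbarFlat s C Ψ T)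
    (hb : IsFlatSymbol s C A T b)
    (hexp : ∀ x ≤ -((2 * K)⁻¹ * d ^ 2), h⁻¹ ^ n * (Real.exp (2 / h * x) * A) ≤ B)
    (hflat : ∀ d', 0 ≤ d' → ∀ x ≤ -((2 * K)⁻¹ * d' ^ 2), h⁻¹ ^ n * (Real.exp (2 / h * x) *
      ((12 * n * A * h⁻¹ + 2 * n) * flatWeight s C (2 * d'))) ≤ B) :
    IsSmallAlongContraction (integrand Ψ b y h) (phaseDomain T y) Q g (antidiag n y) r δ B := by
  have hhomotopy : ∀ σ ∈ Icc (0 : ℝ) 1, ∀ t ∈ ball 0 (2 * r),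
      contractionHomotopy g (antidiag n y) (σ, t) ∈ phaseDomain T y := fun σ hσ t ht =>
    hg.mapsTo_homotopy ⟨⟨by linarith [hσ.1], by linarith [hσ.2]⟩, ht⟩
  exact
    { mapsTo := hg.mapsTo
      mapsTo_homotopy := hg.mapsTo_homotopy
      norm_le_far := fun t ht htr => (norm_integrand_le hb.norm_le hh (hg.mapsTo ht).1).trans
        (hexp _ (hg.re_phase_le_far t ht htr))
      norm_le_off_center := fun σ hσ t ht hout =>
        (norm_integrand_le hb.norm_le hh (hhomotopy σ hσ t ht).1).trans
          (hexp _ (hg.re_phase_le_off_center σ hσ t ht hout))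
      norm_antiPart_le := fun σ hσ t ht =>
        (norm_antiPart_integrand_le hs hC hT hΨ hf hb (hhomotopy σ hσ t ht) hh).trans
          (hflat _ (norm_nonneg _) _ (hg.re_phase_le σ hσ t ht)) }

theorem contractionHomotopy_sub_self (g : R2n n → Cn n × Cn n) (c : Cn n × Cn n) (σ : ℝ)
    (t : R2n n) : contractionHomotopy g c (σ, t) - c = contraction σ (g t - c) :=
  add_sub_cancel_left _ _

theorem contractionHomotopy_mem_phaseDomain (hy : ball y ε ⊆ U) (hε : ε ≤ ρ)
    (hσ : σ ∈ Ioo (-1 : ℝ) 2) (hg : ‖g t - antidiag n y‖ < ε / 2) :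
    contractionHomotopy g (antidiag n y) (σ, t) ∈ phaseDomain (tube U ρ) y := by
  refine mem_phaseDomain_of_norm_lt hy hε ?_
  have hnorm : max 1 |σ| ≤ 2 := max_le one_le_two (abs_le.2 ⟨by linarith [hσ.1], hσ.2.le⟩)
  rw [contractionHomotopy_sub_self]
  calc ‖contraction σ (g t - antidiag n y)‖ ≤ 2 * ‖g t - antidiag n y‖ :=
        (contraction σ).le_of_opNorm_le ((norm_contraction_le σ).trans hnorm) _
    _ < ε := by linarith

theorem IsGoodContour.isDampedAlongContraction (hΓ : IsGoodContour (tube U ρ) Ψ K L Γ)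
    (hyL : y ∈ L) (hK : 0 < K) (hd : 0 ≤ d) (hyU : ball y ε ⊆ U) (hε : ε ≤ ρ)
    (hball : ball 0 (2 * r) ⊆ Γ.dom)
    (hnear : ∀ t ∈ ball 0 (2 * r), ‖Γ.map y t - antidiag n y‖ < ε / 2)
    (hphase : ∀ t ∈ ball 0 (2 * r), ∀ σ ∈ Icc (0 : ℝ) 1,
      (phase Ψ (antidiag n y) (contractionHomotopy (Γ.map y) (antidiag n y) (σ, t))).re ≤
        -((2 * K)⁻¹ * ‖Γ.map y t - antidiag n y‖ ^ 2))
    (hfar : ∀ t ∈ Γ.dom, t ∉ ball 0 r → d ≤ ‖Γ.map y t - antidiag n y‖) (hdδ : 2 * d ≤ δ) :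
    IsDampedAlongContraction Ψ (tube U ρ) Γ.dom (Γ.map y) y r δ K d where
  mapsTo t ht := by
    obtain ⟨hmem, hfst, hsnd, -⟩ := hΓ.mem_domain y hyL t ht
    exact ⟨hmem, hfst, hsnd⟩
  mapsTo_homotopy p hp := contractionHomotopy_mem_phaseDomain hyU hε hp.1 (hnear _ hp.2)
  re_phase_le_far t ht htr := by
    refine (hΓ.good y hyL t ht).trans (neg_le_neg ?_)
    calc (2 * K)⁻¹ * d ^ 2 ≤ K⁻¹ * ‖Γ.map y t - antidiag n y‖ ^ 2 := by
          gcongr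
          exacts [by linarith, hfar t ht htr]
      _ ≤ _ := by
          gcongr
          exact sq_norm_le_add_sq _
  re_phase_le_off_center σ hσ t ht hout := by
    have hdle : d ≤ ‖Γ.map y t - antidiag n y‖ := by
      rcases hout with htr | htδ
      · exact hfar t (hball ht) htr
      · linarith [htδ.trans (norm_offset_le _)]
    refine (hphase t ht σ hσ).trans ?_
    gcongr
  re_phase_le σ hσ t ht := by
    refine (hphase t ht σ hσ).trans ?_
    rw [contractionHomotopy_sub_self]
    gcongr
    exact norm_contraction_apply_le hσ.1 hσ.2 _

theorem exists_eventually_ball_subset (hU : IsOpen U) (hy₀ : y₀ ∈ U) :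
    ∃ ε > 0, ∀ᶠ y in 𝓝 y₀, ball y ε ⊆ U := by
  obtain ⟨ε, hε, hball⟩ := Metric.isOpen_iff.1 hU y₀ hy₀
  refine ⟨ε / 2, half_pos hε, ?_⟩
  filter_upwards [ball_mem_nhds y₀ (half_pos hε)] with y hy
  exact (ball_subset_ball' (by linarith [mem_ball.1 hy])).trans hball

theorem IsGoodContour.exists_isContourChart_and_isDampedAlongContraction (hs : 1 < s)
    (hρ : 0 < ρ) (hK : 0 < K) (hC : 0 < C) (hU : IsOpen U)
    (hΨ : IsFlatPolarization s C Φ U ρ Ψ) (hlevi : ∀ y ∈ U, ∀ ξ, 0 ≤ (leviForm Φ y ξ).re)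
    (hL : IsCompact L) (hΓ : IsGoodContour (tube U ρ) Ψ K L Γ) (hy₀ : y₀ ∈ L) (hy₀U : y₀ ∈ U) :
    ∃ r > 0, ∃ R, ∃ δ₀ > 0, ∀ δ, 0 < δ → δ ≤ δ₀ → ∃ d > 0, ∀ᶠ y in 𝓝 y₀, y ∈ L →
      IsContourChart Γ.dom (Γ.map y) (antidiag n y) r δ R ∧
      IsDampedAlongContraction Ψ (tube U ρ) Γ.dom (Γ.map y) y r δ K d := by
  obtain ⟨ε₁, hε₁, hphase⟩ := exists_phase_contraction_le hΨ hs hC hU hρ hlevi hK hy₀U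
  obtain ⟨ε₂, hε₂, hball⟩ := exists_eventually_ball_subset hU hy₀U
  set ε := min ε₁ (min ε₂ ρ)
  have hε : 0 < ε := lt_min hε₁ (lt_min hε₂ hρ)
  obtain ⟨r, hr, R, δ₀, hδ₀, hchart⟩ :=
    hΓ.exists_eventually_isContourChart hL hy₀ (half_pos hε)
  obtain ⟨d₁, hd₁, hfar⟩ := hΓ.exists_le_norm_sub_antidiag hL hr
  refine ⟨r, hr, R, δ₀, hδ₀, fun δ hδ hδδ₀ => ⟨min d₁ (δ / 2), lt_min hd₁ (half_pos hδ), ?_⟩⟩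
  filter_upwards [hphase, hball, hchart δ hδδ₀] with y hyphase hyball hychart hyL
  obtain ⟨hgQ, hnear⟩ := hychart hyL
  refine ⟨hgQ, hΓ.isDampedAlongContraction hyL hK (le_min hd₁.le (half_pos hδ).le)
    ((ball_subset_ball ((min_le_right _ _).trans (min_le_left _ _))).trans hyball)
    ((min_le_right _ _).trans (min_le_right _ _)) hgQ.ball_subset hnear (fun t ht σ hσ => ?_)
    (fun t ht htr => (min_le_left _ _).trans (hfar y hyL t ht htr))
    (by linarith [min_le_right d₁ (δ / 2)])⟩
  refine hyphase _ ((hnear t ht).trans_le ((half_le_self hε.le).trans (min_le_left _ _))) ?_ σ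
    hσ.1 hσ.2
  rw [add_sub_cancel]
  exact hΓ.good y hyL t (hgQ.ball_subset ht)

theorem contourOp_eq_integral (Ψ : Cn n × Cn n → ℂ) (Γ : Contour n) (a : ℝ → Cn n × Cn n → ℂ)
    (y : Cn n) (h : ℝ) :
    contourOp Ψ Γ a y h = ∫ t in Γ.dom, integrand Ψ (a h) y h (Γ.map y t) *
      volumeForm n fun k => fderiv ℝ (Γ.map y) t (stdFrame n k) := by
  simp only [contourOp, ← integral_const_mul, Contour.jac_eq_volumeForm, integrand, mul_assoc,
    antidiag_apply]

/-- The operator with amplitude `b` over the part `|2z| < δ` of the affine contour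
`z ↦ (y + z, ȳ - z̄)`, with which the operators over all good contours are compared. -/
def affineOp (Ψ b : Cn n × Cn n → ℂ) (δ : ℝ) (y : Cn n) (h : ℝ) : ℂ :=
  (affineMatrix n).det *
    ∫ u in ball (0 : R2n n) δ, integrand Ψ b y h (antidiag n y + affineContour n u)

theorem IsGoodContour.exists_norm_contourOp_sub_affineOp_le (hs : 1 < s) (hρ : 0 < ρ)
    (hK : 0 < K) (hC : 0 < C) (hA : 0 ≤ A) (hU : IsOpen U) (hΨ : IsFlatPolarization s C Φ U ρ Ψ)
    (hlevi : ∀ y ∈ U, ∀ ξ, 0 ≤ (leviForm Φ y ξ).re)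
    (ha : ∀ h, 0 < h → h ≤ h₀ → IsFlatSymbol s C A (tube U ρ) (a h))
    (hL : IsCompact L) (hΓ : IsGoodContour (tube U ρ) Ψ K L Γ) (hy₀ : y₀ ∈ L) (hy₀U : y₀ ∈ U) :
    ∃ δ₀ > 0, ∀ δ, 0 < δ → δ ≤ δ₀ → ∃ M, ∀ᶠ y in 𝓝 y₀, y ∈ L → ∀ h, 0 < h → h ≤ h₀ →
      ‖contourOp Ψ Γ a y h - affineOp Ψ (a h) δ y h‖ ≤
        M * gevreyDecay s (rate s K C / 2) h := by
  obtain ⟨r, hr, R, δ₀, hδ₀, hlocal⟩ := hΓ.exists_isContourChart_and_isDampedAlongContraction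
    hs hρ hK hC hU hΨ hlevi hL hy₀ hy₀U
  obtain ⟨M, hM⟩ := exists_norm_contourIntegral_sub_le hΓ.compact_dom hr R
  refine ⟨δ₀, hδ₀, fun δ hδ hδδ₀ => ?_⟩
  obtain ⟨d, hd, hlocal⟩ := hlocal δ hδ hδδ₀
  obtain ⟨M₁, hexp⟩ := exists_inv_pow_mul_exp_le_gevreyDecay (A := A) hs hK hd
    (half_pos (rate_pos (s := s) hK hC)) hA n
  obtain ⟨M₂, hflat⟩ := exists_inv_pow_mul_exp_mul_flatWeight_le_gevreyDecay hs hK hC hA n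
  refine ⟨M * max M₁ M₂, hlocal.mono fun y hy hyL h hh hhh₀ => ?_⟩
  obtain ⟨hchart, hdamped⟩ := hy hyL
  have hT := isOpen_tube hU ρ
  have hΨ' := hΨ.contDiffOn.of_le (m := 1) one_le_two
  have hsmall := hdamped.isSmallAlongContraction hs.le hC.le hh hT hΨ' hΨ.flat (ha h hh hhh₀)
    (fun x hx => (hexp h hh x hx).trans
      (mul_le_mul_of_nonneg_right (le_max_left M₁ M₂) gevreyDecay_pos.le))
    (fun d' hd' x hx => (hflat h hh d' hd' x hx).trans
      (mul_le_mul_of_nonneg_right (le_max_right M₁ M₂) gevreyDecay_pos.le))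
  rw [contourOp_eq_integral, affineOp, mul_assoc M]
  exact hM _ _ _ _ _ _ (isOpen_phaseDomain hT y)
    (contDiffOn_integrand hΨ' (ha h hh hhh₀).contDiffOn y h) hchart hsmall

theorem IsGoodContour.exists_norm_contourOp_sub_contourOp_le {Γ₀ Γ₁ : Contour n} (hs : 1 < s)
    (hρ : 0 < ρ) (hK : 0 < K) (hC : 0 < C) (hA : 0 ≤ A) (hU : IsOpen U)
    (hΨ : IsFlatPolarization s C Φ U ρ Ψ) (hlevi : ∀ y ∈ U, ∀ ξ, 0 ≤ (leviForm Φ y ξ).re)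
    (ha : ∀ h, 0 < h → h ≤ h₀ → IsFlatSymbol s C A (tube U ρ) (a h)) (hL : IsCompact L)
    (hΓ₀ : IsGoodContour (tube U ρ) Ψ K L Γ₀) (hΓ₁ : IsGoodContour (tube U ρ) Ψ K L Γ₁)
    (hy₀ : y₀ ∈ L) (hy₀U : y₀ ∈ U) :
    ∃ M, ∀ᶠ y in 𝓝[L] y₀, ∀ h, 0 < h → h ≤ h₀ →
      ‖contourOp Ψ Γ₀ a y h - contourOp Ψ Γ₁ a y h‖ ≤
        M * gevreyDecay s (rate s K C / 2) h := by
  obtain ⟨δ₀, hδ₀, hcompare₀⟩ := hΓ₀.exists_norm_contourOp_sub_affineOp_le hs hρ hK hC hA hU hΨ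
    hlevi ha hL hy₀ hy₀U
  obtain ⟨δ₁, hδ₁, hcompare₁⟩ := hΓ₁.exists_norm_contourOp_sub_affineOp_le hs hρ hK hC hA hU hΨ
    hlevi ha hL hy₀ hy₀U
  obtain ⟨M₀, hM₀⟩ := hcompare₀ (min δ₀ δ₁) (lt_min hδ₀ hδ₁) (min_le_left _ _)
  obtain ⟨M₁, hM₁⟩ := hcompare₁ (min δ₀ δ₁) (lt_min hδ₀ hδ₁) (min_le_right _ _)
  refine ⟨M₀ + M₁, eventually_nhdsWithin_iff.2 ?_⟩
  filter_upwards [hM₀, hM₁] with y hy₀ hy₁ hyL h hh hhh₀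
  rw [add_mul]
  refine (norm_sub_le_norm_sub_add_norm_sub _ (affineOp Ψ (a h) (min δ₀ δ₁) y h) _).trans
    (add_le_add (hy₀ hyL h hh hhh₀) ?_)
  rw [norm_sub_rev]
  exact hy₁ hyL h hh hhh₀

end Comparison

section Compactness

open Topology

theorem exists_forall_le_mul_of_locally {X Y : Type*} [TopologicalSpace X] {L : Set X}
    (hL : IsCompact L) {S : Set Y} {f : X → Y → ℝ} {g : Y → ℝ} (hg : ∀ h ∈ S, 0 ≤ g h)
    (hlocal : ∀ x₀ ∈ L, ∃ M, ∀ᶠ x in 𝓝[L] x₀, ∀ h ∈ S, f x h ≤ M * g h) :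
    ∃ M, ∀ x ∈ L, ∀ h ∈ S, f x h ≤ M * g h := by
  refine hL.induction_on (p := fun t => ∃ M, ∀ x ∈ t, ∀ h ∈ S, f x h ≤ M * g h) ⟨0, by simp⟩
    (fun t t' htt' ⟨M, hM⟩ => ⟨M, fun x hx => hM x (htt' hx)⟩) ?_
    (fun x₀ hx₀ => ?_)
  · rintro t t' ⟨M, hM⟩ ⟨M', hM'⟩
    refine ⟨max M M', fun x hx h hh => ?_⟩
    rcases hx with hx | hx
    · exact (hM x hx h hh).trans (mul_le_mul_of_nonneg_right (le_max_left _ _) (hg h hh))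
    · exact (hM' x hx h hh).trans (mul_le_mul_of_nonneg_right (le_max_right _ _) (hg h hh))
  · obtain ⟨M, hM⟩ := hlocal x₀ hx₀
    exact ⟨_, hM, M, fun _ hx => hx⟩

end Compactness

section Constants

variable {n : ℕ} {s C C' A A' ρ h₀ : ℝ} {Φ : Cn n → ℝ} {U Ω : Set (Cn n)}
  {T : Set (Cn n × Cn n)} {Ψ b : Cn n × Cn n → ℂ} {a : ℝ → Cn n × Cn n → ℂ}

theorem DbarFlat.mono (hb : DbarFlat s C b T) (hC : 0 < C) (hCC' : C ≤ C') :
    DbarFlat s C' b T := fun p hp j =>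
  ⟨(hb p hp j).1.trans (flatWeight_le_of_le hC hCC' (norm_nonneg _)),
    (hb p hp j).2.trans (flatWeight_le_of_le hC hCC' (norm_nonneg _))⟩

theorem IsFlatPolarization.mono (hΨ : IsFlatPolarization s C Φ U ρ Ψ) (hC : 0 < C)
    (hCC' : C ≤ C') : IsFlatPolarization s C' Φ U ρ Ψ :=
  ⟨hΨ.contDiffOn, hΨ.diag, hΨ.flat.mono hC hCC'⟩

theorem IsFlatSymbol.mono (hb : IsFlatSymbol s C A T b) (hC : 0 < C) (hCC' : C ≤ C')
    (hAA' : A ≤ A') : IsFlatSymbol s C' A' T b :=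
  ⟨hb.contDiffOn, fun p hp => (hb.norm_le p hp).trans hAA', hb.flat.mono hC hCC'⟩

theorem IsPolarization.exists_isFlatPolarization (hΨ : IsPolarization s Φ U ρ Ψ) :
    ∃ C > 0, IsFlatPolarization s C Φ U ρ Ψ :=
  let ⟨C, hC, hflat⟩ := hΨ.flat
  ⟨C, hC, hΨ.gevrey.1.of_le (by norm_cast), hΨ.diag, hflat⟩

theorem IsGevreyAmplitude.exists_isFlatSymbol (ha : IsGevreyAmplitude s h₀ T a) :
    ∃ C > 0, ∃ A, ∀ h, 0 < h → h ≤ h₀ → IsFlatSymbol s C A T (a h) := by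
  obtain ⟨C, hC, hflat⟩ := ha.flat
  obtain ⟨_, -, A, -, hexpansion⟩ := ha.expansion
  exact ⟨C, hC, A, fun h hh hhh₀ => ⟨(ha.smooth h hh hhh₀).of_le (by norm_cast),
    fun p hp => by simpa using hexpansion h hh hhh₀ 0 p hp 0 Fin.elim0, hflat h hh hhh₀⟩⟩

theorem StrictlyPSH.leviForm_re_nonneg (hΦ : StrictlyPSH Φ Ω) (hU : U ⊆ Ω) :
    ∀ y ∈ U, ∀ ξ, 0 ≤ (leviForm Φ y ξ).re := by
  obtain ⟨c, -, hc, hle⟩ := hΦ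
  exact fun y hy ξ => (mul_nonneg (hc y (hU hy)).le (sq_nonneg _)).trans (hle y (hU hy) ξ)

end Constants

end GevreyBergman

end

open GevreyBergman in
theorem mainTheorem9_general {n : ℕ} {s ρ h₀ K : ℝ} {Φ : Cn n → ℝ} {U : Set (Cn n)}
    {Ψ : Cn n × Cn n → ℂ} {a : ℝ → Cn n × Cn n → ℂ} (hs : 1 < s) (hρ : 0 < ρ) (hU : IsOpen U)
    (hlevi : ∀ y ∈ U, ∀ ξ, 0 ≤ (leviForm Φ y ξ).re)
    (hΨ : ∃ C > 0, IsFlatPolarization s C Φ U ρ Ψ)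
    (ha : ∃ C > 0, ∃ A, ∀ h, 0 < h → h ≤ h₀ → IsFlatSymbol s C A (tube U ρ) (a h))
    (hK : 0 < K) :
    ∃ C > 0, ∀ L : Set (Cn n), IsCompact L → L ⊆ U → ∀ Γ₀ Γ₁ : Contour n,
      IsGoodContour (tube U ρ) Ψ K L Γ₀ → IsGoodContour (tube U ρ) Ψ K L Γ₁ →
      ∃ M, ∀ y ∈ L, ∀ h, 0 < h → h ≤ h₀ →
        ‖contourOp Ψ Γ₀ a y h - contourOp Ψ Γ₁ a y h‖ ≤
          M * Real.exp (-(C⁻¹ * h ^ (-(1 / (2 * s - 1))))) := by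
  obtain ⟨C₁, hC₁, hΨ⟩ := hΨ
  obtain ⟨C₂, hC₂, A, ha⟩ := ha
  set C := max C₁ C₂
  have hC : 0 < C := hC₁.trans_le (le_max_left _ _)
  refine ⟨(rate s K C / 2)⁻¹, inv_pos.2 (half_pos (rate_pos hK hC)),
    fun L hL hLU Γ₀ Γ₁ hΓ₀ hΓ₁ => ?_⟩
  have hlocal (y₀ : Cn n) (hy₀ : y₀ ∈ L) := hΓ₀.exists_norm_contourOp_sub_contourOp_le hs hρ hK hC
    (abs_nonneg A) hU (hΨ.mono hC₁ (le_max_left _ _)) hlevi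
    (fun h hh hhh₀ => (ha h hh hhh₀).mono hC₂ (le_max_right _ _) (le_abs_self A)) hL hΓ₁ hy₀
    (hLU hy₀)
  obtain ⟨M, hM⟩ := exists_forall_le_mul_of_locally hL (S := {h | 0 < h ∧ h ≤ h₀})
    (fun _ _ => gevreyDecay_pos.le)
    fun y₀ hy₀ => (hlocal y₀ hy₀).imp fun _ hM => hM.mono fun y hy h hh => hy h hh.1 hh.2
  rw [inv_inv]
  exact ⟨M, fun y hy h hh hhh₀ => hM y hy h ⟨hh, hhh₀⟩⟩

theorem mainTheorem9 (n : ℕ) (s : ℝ) (hs : 1 < s)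
    (Ω : Set (GevreyBergman.Cn n)) (hΩ : IsOpen Ω)
    (Φ : GevreyBergman.Cn n → ℝ)
    (hΦ : GevreyBergman.IsGevrey (GevreyBergman.reIm n) s Φ Ω)
    (hpsh : GevreyBergman.StrictlyPSH Φ Ω)
    (x₀ : GevreyBergman.Cn n)
    (U : Set (GevreyBergman.Cn n)) (hU : IsOpen U) (hx₀ : x₀ ∈ U)
    (hUc : IsCompact (closure U)) (hUΩ : closure U ⊆ Ω)
    (ρ : ℝ) (hρ : 0 < ρ)
    (Ψ : GevreyBergman.Cn n × GevreyBergman.Cn n → ℂ)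
    (hΨ : GevreyBergman.IsPolarization s Φ U ρ Ψ) :
    ∃ V₀ : Set (GevreyBergman.Cn n), IsOpen V₀ ∧ x₀ ∈ V₀ ∧
      IsCompact (closure V₀) ∧ closure V₀ ⊆ U ∧
      ∀ (h₀ : ℝ), 0 < h₀ →
      ∀ a : ℝ → GevreyBergman.Cn n × GevreyBergman.Cn n → ℂ,
        GevreyBergman.IsGevreyAmplitude s h₀ (GevreyBergman.tube U ρ) a →
      ∀ K : ℝ, 0 < K → ∃ C : ℝ, 0 < C ∧
        ∀ V : Set (GevreyBergman.Cn n), V ⊆ V₀ →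
        ∀ Γ₀ Γ₁ : GevreyBergman.Contour n,
          GevreyBergman.IsGoodContour (GevreyBergman.tube U ρ) Ψ K (closure V) Γ₀ →
          GevreyBergman.IsGoodContour (GevreyBergman.tube U ρ) Ψ K (closure V) Γ₁ →
          ∃ M : ℝ, ∀ y ∈ V, ∀ h : ℝ, 0 < h → h ≤ h₀ →
            ‖GevreyBergman.contourOp Ψ Γ₀ a y h - GevreyBergman.contourOp Ψ Γ₁ a y h‖ ≤
              M * Real.exp (-(C⁻¹ * h ^ (-(1 / (2 * s - 1))))) := by
  obtain ⟨V₀, hV₀, hx₀V₀, hV₀U, hV₀c⟩ := exists_open_between_and_isCompact_closure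
    isCompact_singleton hU (Set.singleton_subset_iff.2 hx₀)
  refine ⟨V₀, hV₀, Set.singleton_subset_iff.1 hx₀V₀, hV₀c, hV₀U, fun h₀ _ a ha K hK => ?_⟩
  obtain ⟨C, hC, hcompare⟩ := mainTheorem9_general hs hρ hU
    (hpsh.leviForm_re_nonneg (subset_closure.trans hUΩ)) hΨ.exists_isFlatPolarization
    ha.exists_isFlatSymbol hK
  refine ⟨C, hC, fun V hV Γ₀ Γ₁ hΓ₀ hΓ₁ => ?_⟩
  obtain ⟨M, hM⟩ := hcompare (closure V) (hV₀c.closure_of_subset (hV.trans subset_closure))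
    ((closure_mono hV).trans hV₀U) Γ₀ Γ₁ hΓ₀ hΓ₁
  exact ⟨M, fun y hy => hM y (subset_closure hy)⟩
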